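/- **Setting.** Let $p$ be a prime, $l\ge 2$, and $\Lambda=\mathbb{Z}_p[[T_1,\dots,T_l]]$, which is identified with the completed group ring $\mathbb{Z}_p[[\mathbb{Z}_p^l]]$ by sending the standard topological generators $\gamma_1,\dots,\gamma_l$ of $\mathbb{Z}_p^l$ to $1+T_1,\dots,1+T_l$; thus $g=(g_1,\dots,g_l)\in\mathbb{Z}_p^l$ is identified with $\prod_i(1+T_i)^{g_i}\in\Lambda$. Let $X$ be a finite multigraph (loops and multiple edges allowed), choose an orientation of every edge, let $S$ be the resulting set of directed edges, and let $\alpha\colon S\to\mathbb{Z}_p^l$ be a map (voltage assignment), extended to all directed edges by $\alpha(e^{-1})=\alpha(e)^{-1}$. For an abelian group $G$ and a map $\beta\colon S\to G$, the derived graph $X(G,S,\beta)$ has vertices $V(X)\times G$ and, for each $e\in S$ from $v$ to $w$ and each $g\in G$, an edge from $(v,g)$ to $(w,g\beta(e))$; $G$ acts on it by $g'\circ(v,g)=(v,gg')$. Let $X_m=X((\mathbb{Z}/p^m)^l,S,\alpha \bmod p^m)$ for $m\ge 0$ and $X_\infty=X(\mathbb{Z}_p^l,S,\alpha)$. Assume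 that all the graphs $X_m$, $m\ge0$, are connected. For a locally finite multigraph $Y$ let $\mathrm{Div}(Y)$ be the free $\mathbb{Z}_p$-module on its vertices, $\mathrm{Div}^0(Y)$ the submodule of elements of degree zero, $\mathrm{Pr}(Y)$ the $\mathbb{Z}_p$-submodule generated by the elements $\deg(v)\,v-\sum_{e}t(e)$ for $v\in V(Y)$, where $e$ runs over the directed edges with origin $v$ and $t(e)$ is the target of $e$ (a loop gives two directed edges and counts twice in $\deg$), and $J(Y)=\mathrm{Div}^0(Y)/\mathrm{Pr}(Y)$. Put $J_\infty=\varprojlim_m J(X_m)$, a $\Lambda$-module on which $T_i$ acts as $\gamma_i-1$; this is the meaning of $J(X_\infty)\otimes\Lambda$ as a completed tensor product. A $\Lambda$-module is pseudo-null if it is annihilated by two relatively prime elements of $\Lambda$, and a pseudo-isomorphism is a $\Lambda$-linear map with pseudo-null kernel and cokernel. If $A$ is a $\Lambda$-module that has a pseudo-isomorphism $A\to\bigoplus_{i=1}^s\Lambda/(p^{e_i})\oplus\bigoplus_{j=1}^t\Lambda/(g_j)$ with all $g_j$ coprime to $p$, then $\mathrm{Char}(A)$ denotes the ideal generated by $p^{\sum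 e_i}\prod_j g_j$. Let $\Delta_\infty=D-A_\alpha$ be the voltage Laplacian: the $V(X)\times V(X)$-matrix over $\Lambda$ where $D$ is the diagonal matrix of the degrees of the vertices of $X$ and the $(v,w)$-entry of $A_\alpha$ is $\sum_e\alpha(e)$, the sum being over all directed edges $e$ of $X$ from $v$ to $w$ (so a loop $e\in S$ at $v$ contributes $\alpha(e)+\alpha(e)^{-1}$ to the $(v,v)$-entry). **Theorem (Iwasawa main conjecture for graphs).** The $\Lambda$-module $J_\infty$ is finitely generated and torsion, its characteristic ideal is well defined, and $$\mathrm{Char}(J_\infty)=(\det(\Delta_\infty)).$$ The same equality holds for the algebraic tensor product: $\Lambda\otimes_{R}J(X_\infty)$, where $R=\mathbb{Z}_p[\mathbb{Z}_p^l]$ is the ordinary group ring, has a well-defined characteristic ideal (in the sense above), and it equals $(\det(\Delta_\infty))$. -/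

import Mathlib

namespace VoltageIwasawa

/-- The Iwasawa algebra `Λ = ℤ_p[[T_1, …, T_l]]`. -/
abbrev Iwasawa (p l : ℕ) [Fact p.Prime] : Type := MvPowerSeries (Fin l) ℤ_[p]

/-- `(1 + T_1)^{g_1} ⋯ (1 + T_l)^{g_l}`, the element of `Λ` identified with `g ∈ ℤ_p^l`, as a
homomorphism from `ℤ_p^l` written multiplicatively. -/
noncomputable def groupElem (p l : ℕ) [Fact p.Prime] :
    Multiplicative (Fin l → ℤ_[p]) →* Iwasawa p l where
  toFun g := ∏ i : Fin l, MvPowerSeries.rename (fun _ : Unit => i)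
    (PowerSeries.binomialSeries ℤ_[p] (g.toAdd i))
  map_one' := by
    refine Finset.prod_eq_one fun i _ => ?_
    have : (PowerSeries.binomialSeries ℤ_[p] (0 : ℤ_[p])) = 1 := PowerSeries.binomialSeries_zero
    change MvPowerSeries.rename _ (PowerSeries.binomialSeries ℤ_[p] (0 : ℤ_[p])) = 1
    rw [this, map_one]
  map_mul' g h := by
    rw [← Finset.prod_mul_distrib]
    refine Finset.prod_congr rfl fun i _ => ?_
    rw [← map_mul]
    change MvPowerSeries.rename _ (PowerSeries.binomialSeries ℤ_[p] (g.toAdd i + h.toAdd i)) = _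
    rw [PowerSeries.binomialSeries_add]

/-- The group ring `R = ℤ_p[ℤ_p^l]`. -/
abbrev GroupRing (p l : ℕ) [Fact p.Prime] : Type :=
  MonoidAlgebra ℤ_[p] (Multiplicative (Fin l → ℤ_[p]))

/-- `Λ` as an algebra over the group ring, through `γ_i ↦ 1 + T_i`. -/
noncomputable instance (p l : ℕ) [Fact p.Prime] : Algebra (GroupRing p l) (Iwasawa p l) :=
  (MonoidAlgebra.lift ℤ_[p] (Iwasawa p l) (Multiplicative (Fin l → ℤ_[p]))
    (groupElem p l)).toRingHom.toAlgebra

section FiniteLevel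

variable {p : ℕ} [Fact p.Prime] {H H' : Type*}

/-- Elements of the group ring as tuples of coefficients. -/
noncomputable def coeffFun (p : ℕ) [Fact p.Prime] (H : Type*) :
    MonoidAlgebra ℤ_[p] H →+ (H → ℤ_[p]) where
  toFun x h := x.coeff h
  map_zero' := rfl
  map_add' _ _ := rfl

/-- The `p`-adic (coefficientwise) uniform structure on the group ring of a finite group. -/
@[reducible] noncomputable def groupRingUniformSpace (p : ℕ) [Fact p.Prime] (H : Type*) :
    UniformSpace (MonoidAlgebra ℤ_[p] H) :=
  UniformSpace.comap (coeffFun p H) inferInstance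

attribute [local instance] groupRingUniformSpace

lemma isUniformInducing_coeffFun : IsUniformInducing (coeffFun p H) := ⟨rfl⟩

lemma coeffFun_injective : Function.Injective (coeffFun p H) := by
  intro x y h
  ext a
  exact congrFun h a

lemma isUniformAddGroup_groupRing : IsUniformAddGroup (MonoidAlgebra ℤ_[p] H) :=
  IsUniformAddGroup.comap (coeffFun p H)

lemma t2Space_groupRing : T2Space (MonoidAlgebra ℤ_[p] H) :=
  T2Space.of_injective_continuous coeffFun_injective
    isUniformInducing_coeffFun.uniformContinuous.continuous

lemma completeSpace_groupRing [Finite H] : CompleteSpace (MonoidAlgebra ℤ_[p] H) := by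
  have hs : Function.Surjective (coeffFun p H) := fun f =>
    ⟨.ofCoeff (Finsupp.equivFunOnFinite.symm f), by ext a; rfl⟩
  exact (isUniformInducing_coeffFun.completeSpace_congr hs).2 inferInstance

lemma continuous_coeff (h : H) :
    Continuous (fun x : MonoidAlgebra ℤ_[p] H => x.coeff h) :=
  (continuous_apply h).comp isUniformInducing_coeffFun.uniformContinuous.continuous

lemma continuous_to_groupRing {Y : Type*} [TopologicalSpace Y] {f : Y → MonoidAlgebra ℤ_[p] H}
    (hf : ∀ h, Continuous fun y => (f y).coeff h) : Continuous f :=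
  continuous_induced_rng.2 (continuous_pi hf)

lemma isTopologicalRing_groupRing [CommGroup H] [Finite H] :
    IsTopologicalRing (MonoidAlgebra ℤ_[p] H) := by
  classical
  have := Fintype.ofFinite H
  have := isUniformAddGroup_groupRing (p := p) (H := H)
  have : ContinuousMul (MonoidAlgebra ℤ_[p] H) := by
    refine ⟨continuous_to_groupRing fun h => ?_⟩
    have key : ∀ x y : MonoidAlgebra ℤ_[p] H,
        (x * y).coeff h = ∑ a : H, ∑ b : H, if a * b = h then x.coeff a * y.coeff b else 0 := by
      intro x y
      rw [MonoidAlgebra.coeff_mul, Finsupp.sum_fintype _ _ (by simp)]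
      refine Finset.sum_congr rfl fun a _ => ?_
      rw [Finsupp.sum_fintype _ _ (by simp)]
    simp only [key]
    refine continuous_finsetSum _ fun a _ => continuous_finsetSum _ fun b _ => ?_
    split_ifs
    · exact ((continuous_coeff a).comp continuous_fst).mul
        ((continuous_coeff b).comp continuous_snd)
    · exact continuous_const
  exact { }

lemma continuousSMul_groupRing : ContinuousSMul ℤ_[p] (MonoidAlgebra ℤ_[p] H) := by
  refine ⟨continuous_to_groupRing fun h => ?_⟩
  exact continuous_fst.mul ((continuous_coeff h).comp continuous_snd)

lemma mem_span_pow_iff [CommGroup H] [Finite H] (k : ℕ) (x : MonoidAlgebra ℤ_[p] H) :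
    x ∈ Ideal.span {(p : MonoidAlgebra ℤ_[p] H) ^ k} ↔
      ∀ h, ‖x.coeff h‖ ≤ (p : ℝ) ^ (-(k : ℤ)) := by
  have hp : ((p : MonoidAlgebra ℤ_[p] H) ^ k) = algebraMap ℤ_[p] _ ((p : ℤ_[p]) ^ k) := by
    rw [map_pow, map_natCast]
  simp only [PadicInt.norm_le_pow_iff_mem_span_pow, Ideal.mem_span_singleton]
  constructor
  · rintro ⟨y, rfl⟩ h
    rw [hp, ← Algebra.smul_def]
    exact Dvd.intro _ rfl
  · intro hx
    choose c hc using hx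
    refine ⟨.ofCoeff (Finsupp.equivFunOnFinite.symm c), ?_⟩
    rw [hp, ← Algebra.smul_def]
    ext h
    exact hc h

lemma hasBasis_groupRing [CommGroup H] [Finite H] :
    (nhds (0 : MonoidAlgebra ℤ_[p] H)).HasBasis (fun _ : ℕ => True)
      fun k => (Ideal.span {(p : MonoidAlgebra ℤ_[p] H) ^ k} : Set (MonoidAlgebra ℤ_[p] H)) := by
  have := Fintype.ofFinite H
  have hp : (1 : ℝ) < p := by exact_mod_cast (Fact.out : p.Prime).one_lt
  have h1 := Metric.nhds_basis_closedBall_pow (α := H → ℤ_[p]) (x := 0)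
    (inv_pos.2 (zero_lt_one.trans hp)) (inv_lt_one_of_one_lt₀ hp)
  have h2 := h1.comap (coeffFun p H)
  have h3 : nhds (0 : MonoidAlgebra ℤ_[p] H) = (nhds (0 : H → ℤ_[p])).comap (coeffFun p H) := by
    rw [isUniformInducing_coeffFun.isInducing.nhds_eq_comap, map_zero]
  rw [h3]
  convert h2 using 2 with k
  ext x
  have hk : ((p : ℝ)⁻¹) ^ k = (p : ℝ) ^ (-(k : ℤ)) := by simp
  simp only [SetLike.mem_coe, mem_span_pow_iff, Set.mem_preimage, mem_closedBall_zero_iff, hk]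
  rw [pi_norm_le_iff_of_nonneg (by positivity)]
  rfl

lemma isLinearTopology_groupRing [CommGroup H] [Finite H] :
    IsLinearTopology (MonoidAlgebra ℤ_[p] H) (MonoidAlgebra ℤ_[p] H) :=
  IsLinearTopology.mk_of_hasBasis _ hasBasis_groupRing

lemma isTopologicallyNilpotent_groupRing [CommGroup H] [Finite H] {m : ℕ} {g : H}
    (hg : g ^ p ^ m = 1) :
    IsTopologicallyNilpotent (MonoidAlgebra.of ℤ_[p] H g - 1) := by
  obtain ⟨r, hr⟩ := exists_add_pow_prime_pow_eq (Fact.out : p.Prime)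
    (MonoidAlgebra.of ℤ_[p] H g - 1) 1 m
  rw [sub_add_cancel, ← map_pow, hg, map_one, one_pow] at hr
  have h1 : (MonoidAlgebra.of ℤ_[p] H g - 1) ^ p ^ m ∈
      Ideal.span {(p : MonoidAlgebra ℤ_[p] H)} := by
    rw [Ideal.mem_span_singleton]
    exact ⟨-((MonoidAlgebra.of ℤ_[p] H g - 1) * r), by linear_combination -hr⟩
  refine hasBasis_groupRing.tendsto_right_iff.2 fun k _ => ?_
  filter_upwards [Filter.eventually_ge_atTop (p ^ m * k)] with n hn
  refine Ideal.pow_mem_of_pow_mem _ ?_ hn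
  rw [pow_mul, ← Ideal.span_singleton_pow]
  exact Ideal.pow_mem_pow h1 k

lemma hasEval_groupRing [CommGroup H] [Finite H] {ι : Type*} [Finite ι] {m : ℕ} {γ : ι → H}
    (hγ : ∀ i, γ i ^ p ^ m = 1) :
    MvPowerSeries.HasEval fun i => MonoidAlgebra.of ℤ_[p] H (γ i) - 1 where
  hpow i := isTopologicallyNilpotent_groupRing (hγ i)
  tendsto_zero := by simp [Filter.cofinite_eq_bot]

/-- For a finite abelian group `H` and elements `γ_1, …, γ_l ∈ H` of `p`-power order, the continuous
`ℤ_p`-algebra homomorphism `Λ → ℤ_p[H]` with `T_i ↦ γ_i - 1`. -/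
noncomputable def evalGroupRing [CommGroup H] [Finite H] {l m : ℕ} (γ : Fin l → H)
    (hγ : ∀ i, γ i ^ p ^ m = 1) : Iwasawa p l →ₐ[ℤ_[p]] MonoidAlgebra ℤ_[p] H :=
  haveI := isUniformAddGroup_groupRing (p := p) (H := H)
  haveI := isTopologicalRing_groupRing (p := p) (H := H)
  haveI := isLinearTopology_groupRing (p := p) (H := H)
  haveI := completeSpace_groupRing (p := p) (H := H)
  haveI := t2Space_groupRing (p := p) (H := H)
  haveI := continuousSMul_groupRing (p := p) (H := H)
  MvPowerSeries.aeval (hasEval_groupRing hγ)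

lemma evalGroupRing_X [CommGroup H] [Finite H] {l m : ℕ} (γ : Fin l → H)
    (hγ : ∀ i, γ i ^ p ^ m = 1) (i : Fin l) :
    evalGroupRing γ hγ (MvPowerSeries.X i) = MonoidAlgebra.of ℤ_[p] H (γ i) - 1 := by
  have := isUniformAddGroup_groupRing (p := p) (H := H)
  have := isTopologicalRing_groupRing (p := p) (H := H)
  have := isLinearTopology_groupRing (p := p) (H := H)
  have := completeSpace_groupRing (p := p) (H := H)
  have := t2Space_groupRing (p := p) (H := H)
  have := continuousSMul_groupRing (p := p) (H := H)
  unfold evalGroupRing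
  rw [← MvPolynomial.coe_X, MvPowerSeries.aeval_coe, MvPolynomial.aeval_X]

/-- Compatibility of the evaluations with homomorphisms of finite abelian groups. -/
lemma map_evalGroupRing [CommGroup H] [Finite H] [CommGroup H'] [Finite H'] {l m m' : ℕ}
    (φ : H →* H') {γ : Fin l → H} {γ' : Fin l → H'} (hγ : ∀ i, γ i ^ p ^ m = 1)
    (hγ' : ∀ i, γ' i ^ p ^ m' = 1) (h : ∀ i, φ (γ i) = γ' i) (F : Iwasawa p l) :
    MonoidAlgebra.lift ℤ_[p] (MonoidAlgebra ℤ_[p] H') H ((MonoidAlgebra.of ℤ_[p] H').comp φ)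
      (evalGroupRing γ hγ F) = evalGroupRing γ' hγ' F := by
  have := isUniformAddGroup_groupRing (p := p) (H := H)
  have := isTopologicalRing_groupRing (p := p) (H := H)
  have := isLinearTopology_groupRing (p := p) (H := H)
  have := completeSpace_groupRing (p := p) (H := H)
  have := t2Space_groupRing (p := p) (H := H)
  have := continuousSMul_groupRing (p := p) (H := H)
  have := isUniformAddGroup_groupRing (p := p) (H := H')
  have := isTopologicalRing_groupRing (p := p) (H := H')
  have := isLinearTopology_groupRing (p := p) (H := H')
  have := completeSpace_groupRing (p := p) (H := H')
  have := t2Space_groupRing (p := p) (H := H')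
  have := continuousSMul_groupRing (p := p) (H := H')
  set ε := MonoidAlgebra.lift ℤ_[p] (MonoidAlgebra ℤ_[p] H') H
    ((MonoidAlgebra.of ℤ_[p] H').comp φ) with hε
  have hc : Continuous ε := by
    have hsum : ∀ x, ε x = ∑ᶠ a : H, x.coeff a • MonoidAlgebra.of ℤ_[p] H' (φ a) := by
      intro x
      have := Fintype.ofFinite H
      rw [finsum_eq_sum_of_fintype, hε, MonoidAlgebra.lift_apply,
        Finsupp.sum_fintype _ _ (by simp)]
      rfl
    have := Fintype.ofFinite H
    rw [funext hsum]
    simp only [finsum_eq_sum_of_fintype]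
    exact continuous_finsetSum _ fun a _ => (continuous_coeff a).smul continuous_const
  have h2 := DFunLike.congr_fun (MvPowerSeries.comp_aeval (hasEval_groupRing hγ) hc) F
  unfold evalGroupRing
  rw [AlgHom.comp_apply] at h2
  rw [h2]
  congr! 3 with i
  simp [hε, ← h i]

end FiniteLevel

/-! ### Subquotients -/

section Subquotient

variable {R M N L : Type*} [CommRing R] [AddCommGroup M] [Module R M] [AddCommGroup N] [Module R N]
  [AddCommGroup L] [Module R L]

/-- `D / P` for submodules `P ⊆ D` of a module. -/
abbrev Subquotient (D P : Submodule R M) : Type _ := D ⧸ P.submoduleOf D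

/-- The map of subquotients induced by a linear map. -/
def subquotientMap {D P : Submodule R M} {D' P' : Submodule R N} (f : M →ₗ[R] N)
    (hD : ∀ x ∈ D, f x ∈ D') (hP : ∀ x ∈ P, f x ∈ P') :
    Subquotient D P →ₗ[R] Subquotient D' P' :=
  Submodule.mapQ _ _ (f.restrict hD) fun x hx => hP x hx

lemma subquotientMap_mk {D P : Submodule R M} {D' P' : Submodule R N} (f : M →ₗ[R] N)
    (hD : ∀ x ∈ D, f x ∈ D') (hP : ∀ x ∈ P, f x ∈ P') (d : D) :
    subquotientMap f hD hP (Submodule.Quotient.mk d) =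
      Submodule.Quotient.mk (⟨f d, hD d d.2⟩ : D') := rfl

lemma subquotientMap_comp {D P : Submodule R M} {D' P' : Submodule R N} {D'' P'' : Submodule R L}
    (f : M →ₗ[R] N) (g : N →ₗ[R] L) (h : M →ₗ[R] L)
    (hD : ∀ x ∈ D, f x ∈ D') (hP : ∀ x ∈ P, f x ∈ P')
    (gD : ∀ x ∈ D', g x ∈ D'') (gP : ∀ x ∈ P', g x ∈ P'')
    (kD : ∀ x ∈ D, h x ∈ D'') (kP : ∀ x ∈ P, h x ∈ P'') (hh : ∀ x, h x = g (f x))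
    (x : Subquotient D P) :
    subquotientMap g gD gP (subquotientMap f hD hP x) = subquotientMap h kD kP x := by
  obtain ⟨d, rfl⟩ := Submodule.Quotient.mk_surjective _ x
  simp only [subquotientMap_mk]
  congr 2
  exact (hh d).symm

lemma subquotientMap_id {D P : Submodule R M} (f : M →ₗ[R] M)
    (hD : ∀ x ∈ D, f x ∈ D) (hP : ∀ x ∈ P, f x ∈ P) (hf : ∀ x, f x = x) (x : Subquotient D P) :
    subquotientMap f hD hP x = x := by
  obtain ⟨d, rfl⟩ := Submodule.Quotient.mk_surjective _ x
  simp only [subquotientMap_mk]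
  congr 2
  exact hf d

end Subquotient

/-! ### Pseudo-null modules and characteristic ideals -/

section CharIdeal

/-- A module is pseudo-null if it is annihilated by two relatively prime ring elements. -/
def IsPseudoNull (R A : Type*) [CommRing R] [AddCommGroup A] [Module R A] : Prop :=
  ∃ a b : R, IsRelPrime a b ∧ ∀ x : A, a • x = 0 ∧ b • x = 0

/-- A pseudo-isomorphism: kernel and cokernel are pseudo-null. -/
def IsPseudoIso {R A B : Type*} [CommRing R] [AddCommGroup A] [Module R A] [AddCommGroup B]
    [Module R B] (φ : A →ₗ[R] B) : Prop :=
  IsPseudoNull R (LinearMap.ker φ) ∧ IsPseudoNull R (B ⧸ LinearMap.range φ)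

variable (p l : ℕ) [Fact p.Prime]

/-- The elementary module `⨁_i Λ/(p^{e_i}) ⊕ ⨁_j Λ/(g_j)`. -/
abbrev Elementary {s t : ℕ} (e : Fin s → ℕ) (g : Fin t → Iwasawa p l) : Type :=
  (∀ i, Iwasawa p l ⧸ Ideal.span {(p : Iwasawa p l) ^ e i}) × (∀ j, Iwasawa p l ⧸ Ideal.span {g j})

/-- `I` is the characteristic ideal of `A`: there is a pseudo-isomorphism from `A` to an elementary
module `⨁_i Λ/(p^{e_i}) ⊕ ⨁_j Λ/(g_j)` with all `g_j` coprime to `p`, and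
`I = (p^{∑ e_i} ∏ g_j)`. -/
def IsCharIdeal (A : Type*) [AddCommGroup A] [Module (Iwasawa p l) A]
    (I : Ideal (Iwasawa p l)) : Prop :=
  ∃ (s t : ℕ) (e : Fin s → ℕ) (g : Fin t → Iwasawa p l),
    (∀ j, IsRelPrime (g j) (p : Iwasawa p l)) ∧
    (∃ φ : A →ₗ[Iwasawa p l] Elementary p l e g, IsPseudoIso φ) ∧
    I = Ideal.span {(p : Iwasawa p l) ^ (∑ i, e i) * ∏ j, g j}

end CharIdeal

/-! ### Multigraphs, divisors, Jacobians -/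

/-- A locally finite multigraph with vertices `V` and (undirected) edges `E`; loops and multiple
edges are allowed. Every edge carries a reference orientation, i.e. a choice of one of the two
directed edges above it. The directed edges of the graph are the `e : E` and their inverses. -/
structure Multigraph (V E : Type*) where
  src : E → V
  tgt : E → V
  finite_src : ∀ v, Finite {e // src e = v}
  finite_tgt : ∀ v, Finite {e // tgt e = v}

namespace Multigraph

variable {V E V' E' : Type*}

/-- Non-empty, and any two vertices are joined by a path. -/
def Connected (Y : Multigraph V E) : Prop :=
  Nonempty V ∧ ∀ v w, Relation.EqvGen (fun a b => ∃ e, Y.src e = a ∧ Y.tgt e = b) v w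

/-- The degree of a vertex; a loop counts twice. -/
noncomputable def degree (Y : Multigraph V E) (v : V) : ℕ :=
  Nat.card {e // Y.src e = v} + Nat.card {e // Y.tgt e = v}

section Jacobian

variable (p : ℕ) [Fact p.Prime]

/-- `Div(Y)`, with coefficients in `ℤ_p`. -/
abbrev Div (_ : Multigraph V E) : Type _ := V →₀ ℤ_[p]

/-- `Div⁰(Y)`: the divisors of degree zero. -/
noncomputable def Div0 (Y : Multigraph V E) : Submodule ℤ_[p] (Y.Div p) :=
  LinearMap.ker (Finsupp.linearCombination ℤ_[p] (fun _ : V => (1 : ℤ_[p])))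

/-- The principal divisor `p_v = deg(v) v - ∑ t(e)`, where `e` runs over the directed edges with
origin `v`. -/
noncomputable def principal (Y : Multigraph V E) (v : V) : Y.Div p :=
  (Y.degree v : ℤ_[p]) • Finsupp.single v 1
    - ∑ᶠ e : {e // Y.src e = v}, Finsupp.single (Y.tgt e) 1
    - ∑ᶠ e : {e // Y.tgt e = v}, Finsupp.single (Y.src e) 1

/-- `Pr(Y)`, the submodule of principal divisors. -/
noncomputable def Pr (Y : Multigraph V E) : Submodule ℤ_[p] (Y.Div p) :=
  Submodule.span ℤ_[p] (Set.range (Y.principal p))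

/-- `J(Y) = Div⁰(Y) / Pr(Y)`. -/
def Jac (Y : Multigraph V E) : Type _ := Subquotient (Y.Div0 p) (Y.Pr p)

noncomputable instance (Y : Multigraph V E) : AddCommGroup (Y.Jac p) :=
  inferInstanceAs (AddCommGroup (Subquotient (Y.Div0 p) (Y.Pr p)))

noncomputable instance (Y : Multigraph V E) : Module ℤ_[p] (Y.Jac p) :=
  inferInstanceAs (Module ℤ_[p] (Subquotient (Y.Div0 p) (Y.Pr p)))

lemma principal_mem_div0 (Y : Multigraph V E) (v : V) : Y.principal p v ∈ Y.Div0 p := by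
  have := Y.finite_src v
  have := Y.finite_tgt v
  have := Fintype.ofFinite {e // Y.src e = v}
  have := Fintype.ofFinite {e // Y.tgt e = v}
  simp [Div0, principal, degree, finsum_eq_sum_of_fintype, Nat.card_eq_fintype_card]

lemma pr_le_div0 (Y : Multigraph V E) : Y.Pr p ≤ Y.Div0 p := by
  rw [Pr, Submodule.span_le]
  rintro _ ⟨v, rfl⟩
  exact Y.principal_mem_div0 p v

end Jacobian

/-- A covering map of multigraphs (respecting the reference orientations): a morphism which is
bijective on the directed edges starting at a given vertex. -/
structure Covering (Y : Multigraph V E) (Y' : Multigraph V' E') where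
  onV : V → V'
  onE : E → E'
  src_onE : ∀ e, Y'.src (onE e) = onV (Y.src e)
  tgt_onE : ∀ e, Y'.tgt (onE e) = onV (Y.tgt e)
  lift_src : ∀ v e', Y'.src e' = onV v → ∃! e, Y.src e = v ∧ onE e = e'
  lift_tgt : ∀ v e', Y'.tgt e' = onV v → ∃! e, Y.tgt e = v ∧ onE e = e'

namespace Covering

variable {Y : Multigraph V E} {Y' : Multigraph V' E'}

noncomputable def srcEquiv (f : Covering Y Y') (v : V) :
    {e // Y.src e = v} ≃ {e // Y'.src e = f.onV v} :=
  Equiv.ofBijective (fun e => ⟨f.onE e, by rw [f.src_onE, e.2]⟩) <| by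
    constructor
    · intro a b hab
      exact Subtype.ext ((f.lift_src v (f.onE a) (by rw [f.src_onE, a.2])).unique ⟨a.2, rfl⟩
        ⟨b.2, (congrArg Subtype.val hab).symm⟩)
    · intro e'
      obtain ⟨e, he, -⟩ := f.lift_src v e' e'.2
      exact ⟨⟨e, he.1⟩, Subtype.ext he.2⟩

noncomputable def tgtEquiv (f : Covering Y Y') (v : V) :
    {e // Y.tgt e = v} ≃ {e // Y'.tgt e = f.onV v} :=
  Equiv.ofBijective (fun e => ⟨f.onE e, by rw [f.tgt_onE, e.2]⟩) <| by
    constructor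
    · intro a b hab
      exact Subtype.ext ((f.lift_tgt v (f.onE a) (by rw [f.tgt_onE, a.2])).unique ⟨a.2, rfl⟩
        ⟨b.2, (congrArg Subtype.val hab).symm⟩)
    · intro e'
      obtain ⟨e, he, -⟩ := f.lift_tgt v e' e'.2
      exact ⟨⟨e, he.1⟩, Subtype.ext he.2⟩

variable (p : ℕ) [Fact p.Prime]

lemma lmapDomain_principal (f : Covering Y Y') (v : V) :
    Finsupp.lmapDomain ℤ_[p] ℤ_[p] f.onV (Y.principal p v) = Y'.principal p (f.onV v) := by
  have := Y.finite_src v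
  have := Y.finite_tgt v
  have := Fintype.ofFinite {e // Y.src e = v}
  have := Fintype.ofFinite {e // Y.tgt e = v}
  have hs : ∑ᶠ e : {e // Y'.src e = f.onV v}, Finsupp.single (Y'.tgt e) (1 : ℤ_[p])
      = ∑ᶠ e : {e // Y.src e = v}, Finsupp.single (f.onV (Y.tgt e)) (1 : ℤ_[p]) := by
    refine (finsum_eq_of_bijective (f.srcEquiv v) (f.srcEquiv v).bijective fun e => ?_).symm
    rw [← f.tgt_onE]
    rfl
  have ht : ∑ᶠ e : {e // Y'.tgt e = f.onV v}, Finsupp.single (Y'.src e) (1 : ℤ_[p])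
      = ∑ᶠ e : {e // Y.tgt e = v}, Finsupp.single (f.onV (Y.src e)) (1 : ℤ_[p]) := by
    refine (finsum_eq_of_bijective (f.tgtEquiv v) (f.tgtEquiv v).bijective fun e => ?_).symm
    rw [← f.src_onE]
    rfl
  have hd : Y'.degree (f.onV v) = Y.degree v := by
    rw [degree, degree, Nat.card_congr (f.srcEquiv v), Nat.card_congr (f.tgtEquiv v)]
  rw [principal, principal, hs, ht, hd]
  simp [finsum_eq_sum_of_fintype, Finsupp.mapDomain_single, map_sum, map_sub]

lemma lmapDomain_div0 (f : Covering Y Y') {d : Y.Div p} (hd : d ∈ Y.Div0 p) :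
    Finsupp.lmapDomain ℤ_[p] ℤ_[p] f.onV d ∈ Y'.Div0 p := by
  rw [Div0, LinearMap.mem_ker] at hd ⊢
  rw [Finsupp.lmapDomain_apply, Finsupp.linearCombination_mapDomain]
  exact hd

lemma lmapDomain_pr (f : Covering Y Y') {d : Y.Div p} (hd : d ∈ Y.Pr p) :
    Finsupp.lmapDomain ℤ_[p] ℤ_[p] f.onV d ∈ Y'.Pr p := by
  have : Y.Pr p ≤ (Y'.Pr p).comap (Finsupp.lmapDomain ℤ_[p] ℤ_[p] f.onV) := by
    rw [Pr, Submodule.span_le]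
    rintro _ ⟨v, rfl⟩
    exact Submodule.subset_span ⟨f.onV v, (f.lmapDomain_principal p v).symm⟩
  exact this hd

/-- The map `J(Y) → J(Y')` induced by a covering, sending the class of `∑ a_v v` to the class of
`∑ a_v f(v)`. -/
noncomputable def jac (f : Covering Y Y') : Y.Jac p →ₗ[ℤ_[p]] Y'.Jac p :=
  subquotientMap (Finsupp.lmapDomain ℤ_[p] ℤ_[p] f.onV) (fun _ hd => f.lmapDomain_div0 p hd)
    fun _ hd => f.lmapDomain_pr p hd

lemma jac_comp {V'' E'' : Type*} {Y'' : Multigraph V'' E''} (f : Covering Y Y')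
    (g : Covering Y' Y'') (h : Covering Y Y'') (hh : ∀ v, h.onV v = g.onV (f.onV v)) (x : Y.Jac p) :
    g.jac p (f.jac p x) = h.jac p x := by
  refine subquotientMap_comp _ _ _ _ _ _ _ _ _ (fun d => ?_) x
  simp only [Finsupp.lmapDomain_apply]
  rw [← Finsupp.mapDomain_comp]
  congr 1
  exact funext hh

lemma jac_id (f : Covering Y Y) (hf : ∀ v, f.onV v = v) (x : Y.Jac p) : f.jac p x = x := by
  refine subquotientMap_id _ _ _ (fun d => ?_) x
  rw [Finsupp.lmapDomain_apply, show f.onV = id from funext hf, Finsupp.mapDomain_id]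

end Covering

/-! ### Derived graphs -/

section Derived

variable {G G' : Type*} [AddCommGroup G] [AddCommGroup G']

/-- The derived graph `X(G, S, α)` of a voltage assignment `α` with values in the abelian group `G`
(written additively): for every edge `e` of `X` from `v` to `w` and every `g ∈ G` there is an
edge `(e, g)` from `(v, g)` to `(w, g + α(e))`. -/
def derived (X : Multigraph V E) (α : E → G) : Multigraph (V × G) (E × G) where
  src e := (X.src e.1, e.2)
  tgt e := (X.tgt e.1, e.2 + α e.1)
  finite_src v := by
    have := X.finite_src v.1
    refine Finite.of_injective
      (fun e : {e : E × G // (X.src e.1, e.2) = v} =>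
        (⟨e.1.1, congrArg Prod.fst e.2⟩ : {e // X.src e = v.1})) fun a b hab => ?_
    have h1 : a.1.1 = b.1.1 := congrArg Subtype.val hab
    have h2 : a.1.2 = b.1.2 := (congrArg Prod.snd a.2).trans (congrArg Prod.snd b.2).symm
    exact Subtype.ext (Prod.ext h1 h2)
  finite_tgt v := by
    have := X.finite_tgt v.1
    refine Finite.of_injective
      (fun e : {e : E × G // (X.tgt e.1, e.2 + α e.1) = v} =>
        (⟨e.1.1, congrArg Prod.fst e.2⟩ : {e // X.tgt e = v.1})) fun a b hab => ?_
    have h1 : a.1.1 = b.1.1 := congrArg Subtype.val hab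
    have h2 : a.1.2 + α a.1.1 = b.1.2 + α b.1.1 :=
      (congrArg Prod.snd a.2).trans (congrArg Prod.snd b.2).symm
    rw [h1] at h2
    exact Subtype.ext (Prod.ext h1 (add_right_cancel h2))

/-- The covering `X(G, S, α) → X(G', S, φ ∘ α)`, `(v, g) ↦ (v, φ(g) + c)`, for a homomorphism
`φ : G → G'` and `c ∈ G'`. -/
def derivedCovering (X : Multigraph V E) {α : E → G} {α' : E → G'} (φ : G →+ G')
    (hα : ∀ e, φ (α e) = α' e) (c : G') : Covering (X.derived α) (X.derived α') where
  onV v := (v.1, φ v.2 + c)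
  onE e := (e.1, φ e.2 + c)
  src_onE _ := rfl
  tgt_onE e := by
    change (X.tgt e.1, φ e.2 + c + α' e.1) = (X.tgt e.1, φ (e.2 + α e.1) + c)
    rw [map_add, hα, add_right_comm]
  lift_src v e' h := by
    obtain ⟨e, g'⟩ := e'
    have h1 : X.src e = v.1 := congrArg Prod.fst h
    have h2 : g' = φ v.2 + c := congrArg Prod.snd h
    refine ⟨(e, v.2), ⟨Prod.ext h1 rfl, Prod.ext rfl h2.symm⟩, ?_⟩
    rintro ⟨e1, g1⟩ ⟨k1, k2⟩
    have k3 : e1 = e := congrArg Prod.fst k2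
    have k4 : g1 = v.2 := congrArg Prod.snd k1
    exact Prod.ext k3 k4
  lift_tgt v e' h := by
    obtain ⟨e, g'⟩ := e'
    have h1 : X.tgt e = v.1 := congrArg Prod.fst h
    have h2 : g' + α' e = φ v.2 + c := congrArg Prod.snd h
    refine ⟨(e, v.2 - α e), ⟨Prod.ext h1 (sub_add_cancel _ _), Prod.ext rfl ?_⟩, ?_⟩
    · change φ (v.2 - α e) + c = g'
      rw [map_sub, hα, sub_add_eq_add_sub, ← h2, add_sub_cancel_right]
    · rintro ⟨e1, g1⟩ ⟨k1, k2⟩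
      have k3 : e1 = e := congrArg Prod.fst k2
      subst k3
      have k4 : g1 + α e1 = v.2 := congrArg Prod.snd k1
      exact Prod.ext rfl (eq_sub_of_add_eq k4)

/-- The action of `G` on `J(X(G, S, α))` induced by `g' ∘ (v, g) = (v, g + g')`. -/
noncomputable def deckAction (p : ℕ) [Fact p.Prime] (X : Multigraph V E) (α : E → G) :
    Representation ℤ_[p] (Multiplicative G) ((X.derived α).Jac p) where
  toFun g := (X.derivedCovering (α := α) (AddMonoidHom.id G) (fun _ => rfl) g.toAdd).jac p
  map_one' := LinearMap.ext fun x => Covering.jac_id p _ (fun v => Prod.ext rfl (add_zero _)) x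
  map_mul' g h := LinearMap.ext fun x => by
    refine (Covering.jac_comp p _ _ _ (fun v => Prod.ext rfl ?_) x).symm
    change v.2 + (g.toAdd + h.toAdd) = v.2 + h.toAdd + g.toAdd
    rw [add_assoc, add_comm h.toAdd]

end Derived

/-! ### The `ℤ_p^l`-voltage cover and its Iwasawa module -/

section Tower

variable {p : ℕ} [Fact p.Prime] {l : ℕ}

/-- The reduction `α_m` of a voltage assignment modulo `p ^ m`. -/
noncomputable def voltageMod (α : E → Fin l → ℤ_[p]) (m : ℕ) (e : E) (i : Fin l) : ZMod (p ^ m) :=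
  PadicInt.toZModPow m (α e i)

/-- The graph `X_m = X((ℤ/p^m)^l, S, α_m)`. -/
noncomputable abbrev level (X : Multigraph V E) (α : E → Fin l → ℤ_[p]) (m : ℕ) :
    Multigraph (V × (Fin l → ZMod (p ^ m))) (E × (Fin l → ZMod (p ^ m))) :=
  X.derived (voltageMod α m)

/-- Reduction `(ℤ/p^{m+1})^l → (ℤ/p^m)^l`. -/
def reduction (p l m : ℕ) : (Fin l → ZMod (p ^ (m + 1))) →+ (Fin l → ZMod (p ^ m)) where
  toFun g i := ZMod.castHom (pow_dvd_pow p m.le_succ) (ZMod (p ^ m)) (g i)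
  map_zero' := funext fun _ => map_zero _
  map_add' _ _ := funext fun _ => map_add _ _ _

lemma reduction_voltageMod (α : E → Fin l → ℤ_[p]) (m : ℕ) (e : E) :
    reduction p l m (voltageMod α (m + 1) e) = voltageMod α m e :=
  funext fun i => RingHom.congr_fun (PadicInt.zmod_cast_comp_toZModPow m (m + 1) m.le_succ) (α e i)

/-- The transition map `J(X_{m+1}) → J(X_m)`. -/
noncomputable def transition (X : Multigraph V E) (α : E → Fin l → ℤ_[p]) (m : ℕ) :
    (X.level α (m + 1)).Jac p →ₗ[ℤ_[p]] (X.level α m).Jac p :=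
  (X.derivedCovering (reduction p l m) (reduction_voltageMod α m) 0).jac p

/-- The image of the `i`-th standard topological generator `γ_i` of `ℤ_p^l` in `(ℤ/p^m)^l`. -/
def levelGen (p l m : ℕ) (i : Fin l) : Multiplicative (Fin l → ZMod (p ^ m)) :=
  Multiplicative.ofAdd (Pi.single i 1)

lemma levelGen_pow (p l m : ℕ) (i : Fin l) : levelGen p l m i ^ p ^ m = 1 := by
  apply Multiplicative.toAdd.injective
  funext j
  simp [levelGen]

/-- The action of `Λ` on `J(X_m)`: the power series `T_i` acts as `γ_i - 1`. -/
noncomputable def levelAction (X : Multigraph V E) (α : E → Fin l → ℤ_[p]) (m : ℕ) :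
    Iwasawa p l →ₐ[ℤ_[p]] Module.End ℤ_[p] ((X.level α m).Jac p) :=
  haveI : NeZero (p ^ m) := ⟨pow_ne_zero m (Fact.out : p.Prime).ne_zero⟩
  ((X.deckAction p (voltageMod α m)).asAlgebraHom).comp
    (evalGroupRing (levelGen p l m) (levelGen_pow p l m))

lemma transition_levelAction (X : Multigraph V E) (α : E → Fin l → ℤ_[p]) (m : ℕ)
    (F : Iwasawa p l) (x : (X.level α (m + 1)).Jac p) :
    X.transition α m (X.levelAction α (m + 1) F x) =
      X.levelAction α m F (X.transition α m x) := by
  have : NeZero (p ^ m) := ⟨pow_ne_zero m (Fact.out : p.Prime).ne_zero⟩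
  have : NeZero (p ^ (m + 1)) := ⟨pow_ne_zero (m + 1) (Fact.out : p.Prime).ne_zero⟩
  have hgen : ∀ i, (reduction p l m).toMultiplicative (levelGen p l (m + 1) i) =
      levelGen p l m i := by
    intro i
    apply Multiplicative.toAdd.injective
    funext j
    change ZMod.castHom (pow_dvd_pow p m.le_succ) _ ((Pi.single i 1 : Fin l → ZMod (p ^ (m + 1))) j) =
      (Pi.single i 1 : Fin l → ZMod (p ^ m)) j
    rcases eq_or_ne j i with rfl | h
    · rw [Pi.single_eq_same, Pi.single_eq_same, map_one]
    · rw [Pi.single_eq_of_ne h, Pi.single_eq_of_ne h, map_zero]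
  have hring : ∀ (r : MonoidAlgebra ℤ_[p] (Multiplicative (Fin l → ZMod (p ^ (m + 1))))),
      ∀ x, X.transition α m ((X.deckAction p (voltageMod α (m + 1))).asAlgebraHom r x) =
      (X.deckAction p (voltageMod α m)).asAlgebraHom
        (MonoidAlgebra.lift ℤ_[p] _ _ ((MonoidAlgebra.of ℤ_[p] _).comp
          (reduction p l m).toMultiplicative) r) (X.transition α m x) := by
    intro r x
    induction r using MonoidAlgebra.induction_on with
    | of g =>
      rw [MonoidAlgebra.lift_of]
      simp only [MonoidHom.comp_apply, Representation.asAlgebraHom_of]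
      exact (Covering.jac_comp p _ _
        (X.derivedCovering (reduction p l m) (reduction_voltageMod α m)
          (reduction p l m g.toAdd)) (fun v => Prod.ext rfl (by
            change reduction p l m v.2 + _ = reduction p l m (v.2 + g.toAdd) + 0
            rw [map_add, add_zero])) x).trans
        (Covering.jac_comp p _ _ _ (fun v => Prod.ext rfl (by
            change reduction p l m v.2 + _ = reduction p l m v.2 + 0 + _
            rw [add_zero]; rfl)) x).symm
    | add a b ha hb =>
      simp only [map_add, LinearMap.add_apply, ha, hb]
    | smul c a ha =>
      simp only [map_smul, LinearMap.smul_apply, ha]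
  change X.transition α m ((X.deckAction p (voltageMod α (m + 1))).asAlgebraHom
    (evalGroupRing (levelGen p l (m + 1)) (levelGen_pow p l (m + 1)) F) x) = _
  rw [hring, map_evalGroupRing _ _ (levelGen_pow p l m) hgen]
  rfl

/-- `J_∞ = lim J(X_m)`. -/
noncomputable def jacLimit (X : Multigraph V E) (α : E → Fin l → ℤ_[p]) :
    Submodule ℤ_[p] (∀ m, (X.level α m).Jac p) where
  carrier := {x | ∀ m, X.transition α m (x (m + 1)) = x m}
  zero_mem' _ := map_zero _
  add_mem' hx hy m := by
    change X.transition α m (_ + _) = _ + _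
    rw [map_add, hx m, hy m]
  smul_mem' c x hx m := by
    change X.transition α m (c • _) = c • _
    rw [map_smul, hx m]

/-- `Λ` acts on `J_∞ = lim J(X_m)` through its actions on the `J(X_m)`. -/
noncomputable instance (X : Multigraph V E) (α : E → Fin l → ℤ_[p]) :
    Module (Iwasawa p l) (X.jacLimit α) where
  smul F x := ⟨fun m => X.levelAction α m F (x.1 m), fun m => by
    rw [X.transition_levelAction, x.2 m]⟩
  one_smul x := Subtype.ext <| funext fun m => by
    change X.levelAction α m 1 (x.1 m) = x.1 m
    rw [map_one]; rfl
  mul_smul F F' x := Subtype.ext <| funext fun m => by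
    change X.levelAction α m (F * F') (x.1 m) = _
    rw [map_mul]; rfl
  smul_zero F := Subtype.ext <| funext fun m => map_zero (X.levelAction α m F)
  smul_add F x y := Subtype.ext <| funext fun m => map_add (X.levelAction α m F) _ _
  add_smul F F' x := Subtype.ext <| funext fun m => by
    change X.levelAction α m (F + F') (x.1 m) = _
    rw [map_add]; rfl
  zero_smul x := Subtype.ext <| funext fun m => by
    change X.levelAction α m 0 (x.1 m) = _
    rw [map_zero]; rfl

/-- The algebraic tensor product `Λ ⊗_R J(X_∞)` over `R = ℤ_p[ℤ_p^l]`, where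
`X_∞ = X(ℤ_p^l, S, α)`. -/
abbrev jacTensor (X : Multigraph V E) (α : E → Fin l → ℤ_[p]) : Type _ :=
  TensorProduct (GroupRing p l) (Iwasawa p l) (X.deckAction p α).asModule

/-- The voltage assignment matrix `A_α`: its entry at `(v, w)` is the sum of `α(e)` over the directed
edges `e` from `v` to `w`. A loop at `v` counts in both directions, i.e. contributes
`α(e) + α(e)⁻¹`. -/
noncomputable def voltageMatrix [DecidableEq V] [Fintype E] (X : Multigraph V E)
    (α : E → Fin l → ℤ_[p]) : Matrix V V (Iwasawa p l) := fun v w =>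
  (∑ e : E, if X.src e = v ∧ X.tgt e = w then groupElem p l (Multiplicative.ofAdd (α e)) else 0) +
  ∑ e : E, if X.tgt e = v ∧ X.src e = w then groupElem p l (Multiplicative.ofAdd (-α e)) else 0

/-- The voltage Laplacian `Δ_∞ = D - A_α`. -/
noncomputable def voltageLaplacian [DecidableEq V] [Fintype E] (X : Multigraph V E)
    (α : E → Fin l → ℤ_[p]) : Matrix V V (Iwasawa p l) :=
  Matrix.diagonal (fun v => (X.degree v : Iwasawa p l)) - X.voltageMatrix α

end Tower
end Multigraph

end VoltageIwasawa

/-! Write Δ for the voltage Laplacian. Divisors on a derived graph with group `G` are vectors over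
the group ring of `G`; principal divisors then form the row space of the Laplacian, and the degree
is the sum of the augmentations. A compactness argument passes this description to the limit: `J_∞`
is the quotient of `(Λ^V)^0`, the vectors whose constant coefficients sum to zero, by the row space
of Δ (`jacLimitOf_surjective`, `jacLimitOf_eq_zero_iff`). The inclusion of `(Λ^V)^0` into `Λ^V`
induces an injection of `J_∞` into the cokernel of the transpose of Δ, and its cokernel is killed by
every `T_i`. Since `l ≥ 2`, two of the `T_i` are relatively prime, so this is a pseudo-isomorphism.
Over the group ring the same inclusion exists for `J(X_∞)`; base change to `Λ` need not keep it
injective, but its kernel and cokernel stay killed by every `T_i`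
(`LinearMap.baseChange_of_smul_mem_range`).

It remains to treat the cokernel of a square matrix `B` over `Λ` with nonzero determinant
(`isCharIdeal_coker`). The ring `Λ` is factorial, by Weierstrass preparation and induction on the
number of variables. Inverting all nonzero elements prime to `det B` gives a principal ideal domain;
Smith normal form there, with denominators cleared, yields `P * B = diag(d) * Q` with `det P` and
`det Q` prime to `det B`. Hence the cokernel is pseudo-isomorphic to `⨁ Λ/(d_i)`, and `∏ d_i` is
associated to `det B`. Characteristic ideals are unique because the multiplicity of a prime `π` in a
generator is the length of the module localized at `(π)`.

Finally `det Δ ≠ 0`: a row vector killed by Δ gives a harmonic function on each finite connected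
graph `X_m`, which is therefore constant. Its constant coefficients are thus divisible by `p^(ml)`
for all `m`, so the vector vanishes at every level, and then it is zero
(`eq_zero_of_forall_levelEval_eq_zero`). -/

open scoped MvPowerSeries.WithPiTopology

/-! ### Adic completeness of power series rings over `ℤ_p`. -/

section AdicComplete

/-- A compatible sequence gives a decreasing chain of cosets `f n + I ^ n`. They are closed, because
ideals of a compact Hausdorff Noetherian ring are, so compactness provides a common point. -/
lemma IsAdicComplete.of_compactSpace (A : Type*) [CommRing A] [IsNoetherianRing A] [IsLocalRing A]
    [TopologicalSpace A] [IsTopologicalRing A] [CompactSpace A] [T2Space A] :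
    IsAdicComplete (IsLocalRing.maximalIdeal A) A where
  prec' f hf := by
    set I := IsLocalRing.maximalIdeal A
    have hmem : ∀ m n x, x ≡ f m [SMOD (I ^ n • ⊤ : Submodule A A)] ↔ x - f m ∈ I ^ n := by
      intro m n x
      rw [SModEq.sub_mem, smul_eq_mul, Ideal.mul_top]
    have hclosed : ∀ n, IsClosed {x | x - f n ∈ I ^ n} := fun n =>
      (IsNoetherianRing.isClosed_ideal (I ^ n)).preimage (continuous_id.sub continuous_const)
    have hanti : ∀ n, {x | x - f (n + 1) ∈ I ^ (n + 1)} ⊆ {x | x - f n ∈ I ^ n} := by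
      intro n x hx
      have h1 : f n - f (n + 1) ∈ I ^ n := (hmem _ _ _).1 (hf n.le_succ)
      have h2 : x - f (n + 1) ∈ I ^ n := Ideal.pow_le_pow_right n.le_succ hx
      simpa using sub_mem h2 h1
    obtain ⟨L, hL⟩ := IsCompact.nonempty_iInter_of_sequence_nonempty_isCompact_isClosed
      (fun n => {x | x - f n ∈ I ^ n}) hanti (fun n => ⟨f n, by simp⟩)
      (hclosed 0).isCompact hclosed
    exact ⟨L, fun n => ((hmem n n L).2 (Set.mem_iInter.1 hL n)).symm⟩

instance MvPowerSeries.compactSpace {σ R : Type*} [TopologicalSpace R] [CompactSpace R] :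
    CompactSpace (MvPowerSeries σ R) :=
  inferInstanceAs (CompactSpace ((σ →₀ ℕ) → R))

instance MvPowerSeries.isAdicComplete_padicInt (p n : ℕ) [Fact p.Prime] :
    IsAdicComplete (IsLocalRing.maximalIdeal (MvPowerSeries (Fin n) ℤ_[p]))
      (MvPowerSeries (Fin n) ℤ_[p]) :=
  IsAdicComplete.of_compactSpace _

end AdicComplete

/-! ### Weierstrass preparation and prime elements. -/

section Weierstrass

open Polynomial in
/-- A factor of a distinguished polynomial is a unit multiple of a distinguished polynomial. -/
lemma Polynomial.IsDistinguishedAt.exists_of_dvd {A : Type*} [CommRing A] [IsDomain A]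
    {I : Ideal A} (hI : I.IsPrime) {g q : A[X]} (hg : g.IsDistinguishedAt I) (hq : q ∣ g) :
    ∃ q' : A[X], Associated q q' ∧ q'.IsDistinguishedAt I := by
  obtain ⟨r, rfl⟩ := hq
  have hlc : q.leadingCoeff * r.leadingCoeff = 1 := by
    rw [← leadingCoeff_mul]; exact hg.monic
  have hu : IsUnit q.leadingCoeff := IsUnit.of_mul_eq_one _ hlc
  have hmon : (C r.leadingCoeff * q).Monic := by
    rw [Monic, leadingCoeff_mul, leadingCoeff_C, mul_comm, hlc]
  have hru : IsUnit r.leadingCoeff := IsUnit.of_mul_eq_one q.leadingCoeff (by rw [mul_comm]; exact hlc)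
  refine ⟨C r.leadingCoeff * q, ?_, ⟨?_⟩, hmon⟩
  · exact (associated_unit_mul_left _ _ (isUnit_C.2 hru)).symm
  · intro n hn
    have h1 := hg.map_eq_X_pow
    -- Modulo `I` the monic factor divides a power of `X` over a domain, so it is itself a power of
    -- `X`; its lower coefficients therefore lie in `I`.
    have h2 : (C r.leadingCoeff * q).map (Ideal.Quotient.mk I) ∣ X ^ (q * r).natDegree := by
      rw [← h1, ← Polynomial.coe_mapRingHom]
      refine map_dvd _ ?_
      refine ⟨C q.leadingCoeff * r, ?_⟩
      have : C q.leadingCoeff * C r.leadingCoeff = (1 : A[X]) := by rw [← C_mul, hlc, C_1]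
      linear_combination (- q * r) * this
    obtain ⟨k, hk, hk'⟩ := (dvd_prime_pow prime_X _).1 h2
    have h3 := eq_of_monic_of_associated (hmon.map _) (monic_X_pow k) hk'
    have : Nontrivial (A ⧸ I) := Ideal.Quotient.nontrivial_iff.2 hI.ne_top
    have h4 : k = (C r.leadingCoeff * q).natDegree := by
      rw [← hmon.natDegree_map (Ideal.Quotient.mk I), h3, natDegree_X_pow]
    have h5 := congrArg (fun s => s.coeff n) h3
    simp only [coeff_map, coeff_X_pow] at h5
    rw [if_neg (by omega)] at h5
    exact Ideal.Quotient.eq_zero_iff_mem.1 h5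

open PowerSeries in
/-- A prime ideal of `A⟦X⟧` containing a power series with nonzero reduction contains a prime
element. -/
lemma PowerSeries.exists_prime_mem_of_map_residue_ne_zero {A : Type*} [CommRing A] [IsDomain A]
    [IsLocalRing A] [IsAdicComplete (IsLocalRing.maximalIdeal A) A] [UniqueFactorizationMonoid A]
    {P : Ideal A⟦X⟧} (hP : P.IsPrime) {f : A⟦X⟧} (hf : f ∈ P)
    (hf0 : f.map (IsLocalRing.residue A) ≠ 0) : ∃ x ∈ P, Prime x := by
  -- Up to a unit, `f` is a distinguished polynomial, so a prime factor can be looked for in `A[X]`,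
  -- which is factorial.
  obtain ⟨g, h, H⟩ := exists_isWeierstrassFactorization hf0
  have hgP : (g : A⟦X⟧) ∈ P := by
    rw [H.eq_mul] at hf
    exact (hP.mem_or_mem hf).resolve_right fun hh => hP.ne_top (P.eq_top_of_isUnit_mem hh H.isUnit)
  let Q : Ideal (Polynomial A) := P.comap (Polynomial.coeToPowerSeries.ringHom)
  have hQ : Q.IsPrime := Ideal.comap_isPrime _ _
  have hgQ : g ∈ Q := hgP
  have hg0 : g ≠ 0 := H.isDistinguishedAt.monic.ne_zero
  have hgu : ¬ IsUnit g := fun hu => hQ.ne_top (Q.eq_top_of_isUnit_mem hgQ hu)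
  obtain ⟨q, hqQ, hq, hqg⟩ : ∃ q ∈ Q, Prime q ∧ q ∣ g := by
    obtain ⟨s, hs, hsg⟩ := UniqueFactorizationMonoid.exists_prime_factors g hg0
    have : s.prod ∈ Q := by
      obtain ⟨u, hu⟩ := hsg.symm
      rw [← hu]
      exact Q.mul_mem_right _ hgQ
    obtain ⟨q, hqs, hqQ⟩ := (hQ.multiset_prod_mem_iff_exists_mem s).1 this
    exact ⟨q, hqQ, hs q hqs, (Multiset.dvd_prod hqs).trans hsg.dvd⟩
  obtain ⟨q', hqq', hq'⟩ := H.isDistinguishedAt.exists_of_dvd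
    (IsLocalRing.maximalIdeal.isMaximal A).isPrime hqg
  have hq'p : Prime q' := hqq'.prime hq
  have hq'Q : q' ∈ Q := by
    obtain ⟨u, hu⟩ := hqq'
    rw [← hu]
    exact Q.mul_mem_right _ hqQ
  refine ⟨(q' : A⟦X⟧), hq'Q, ?_⟩
  have h0 : (q' : A⟦X⟧) ≠ 0 := by
    rw [Ne, ← Polynomial.coe_zero, Polynomial.coe_inj]
    exact hq'p.ne_zero
  rw [← Ideal.span_singleton_prime h0, ← Ideal.Quotient.isDomain_iff_prime]
  -- Primality passes from polynomials to power series because Weierstrass division identifies the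
  -- two quotients by the distinguished `q'`.
  have : IsDomain (Polynomial A ⧸ Ideal.span {q'}) :=
    (Ideal.Quotient.isDomain_iff_prime _).2 ((Ideal.span_singleton_prime hq'p.ne_zero).2 hq'p)
  exact (hq'.algEquivQuotient).symm.toMulEquiv.isDomain _

end Weierstrass

/-! ### Making a power series regular in the first variable. -/

section ChangeOfVariables

/-- Positive weights, the first one being `1`, for which some member of a given set of exponents is
determined by its weight. -/
lemma exists_separating_weights (n : ℕ) (S : Set (Fin (n + 1) → ℕ)) (hS : S.Nonempty) :
    ∃ c : Fin (n + 1) → ℕ, c 0 = 1 ∧ (∀ i, c i ≠ 0) ∧ ∃ d ∈ S, ∀ d' ∈ S,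
      ∑ i, c i * d' i = ∑ i, c i * d i → d' = d := by
  induction n with
  | zero =>
    obtain ⟨d, hd⟩ := hS
    refine ⟨fun _ => 1, rfl, fun _ => one_ne_zero, d, hd, fun d' _ h => ?_⟩
    funext i
    fin_cases i
    simpa using h
  | succ n ih =>
    obtain ⟨d1, hd1, hmin⟩ : ∃ d ∈ S, ∀ d' ∈ S, d (Fin.last _) ≤ d' (Fin.last _) := by
      obtain ⟨d, hd, h⟩ := WellFounded.has_min (measure fun d : Fin (n + 2) → ℕ =>
        d (Fin.last _)).wf S hS
      exact ⟨d, hd, fun d' hd' => not_lt.1 (h d' hd')⟩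
    obtain ⟨c, hc0, hc, d, ⟨d2, ⟨hd2, hd2l⟩, rfl⟩, hd⟩ := ih
      (Fin.init '' {d ∈ S | d (Fin.last _) = d1 (Fin.last _)}) ⟨_, d1, ⟨hd1, rfl⟩, rfl⟩
    -- The last weight exceeds the weight of the other coordinates of `d2`. As the last coordinate
    -- of `d2` is minimal on `S`, equality of weights forces equal last coordinates, and the
    -- induction hypothesis handles that slice.
    refine ⟨Fin.snoc c (1 + ∑ i, c i * d2 i.castSucc), ?_, ?_, d2, hd2, ?_⟩
    · rw [← Fin.castSucc_zero, Fin.snoc_castSucc, hc0]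
    · intro i
      refine Fin.lastCases ?_ (fun i => ?_) i
      · rw [Fin.snoc_last]; omega
      · rw [Fin.snoc_castSucc]; exact hc i
    · intro d' hd' h
      rw [Fin.sum_univ_castSucc, Fin.sum_univ_castSucc (n := n + 1)
        (f := fun i => (Fin.snoc c (1 + ∑ i, c i * d2 i.castSucc) : Fin (n + 2) → ℕ) i * d2 i)] at h
      simp only [Fin.snoc_castSucc, Fin.snoc_last] at h
      have hle := hmin d' hd'
      have hlast : d' (Fin.last _) = d2 (Fin.last _) := by
        by_contra hne
        obtain ⟨k, hk⟩ : ∃ k, d' (Fin.last _) = d2 (Fin.last _) + 1 + k :=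
          Nat.exists_eq_add_of_le (by omega)
        rw [hk] at h
        nlinarith [Nat.zero_le (∑ i, c i * d' i.castSucc),
          Nat.zero_le ((∑ i, c i * d2 i.castSucc) * k)]
      have h' : Fin.init d' = Fin.init d2 :=
        hd _ ⟨d', ⟨hd', hlast.trans hd2l⟩, rfl⟩ (by rw [hlast] at h; simpa [Fin.init] using h)
      rw [← Fin.snoc_init_self d', ← Fin.snoc_init_self d2, h', hlast]

namespace MvPowerSeries

variable {R : Type*} [CommRing R] {n : ℕ}

/-- The substitution `T_0 ↦ T_0`, `T_i ↦ T_i + r T_0^{c_i}` for `i ≠ 0`. -/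
noncomputable def shear (R : Type*) [CommRing R] {n : ℕ} (c : Fin (n + 1) → ℕ) (r : R)
    (i : Fin (n + 1)) : MvPowerSeries (Fin (n + 1)) R :=
  X i + if i = 0 then 0 else C r * X 0 ^ c i

lemma hasSubst_shear {c : Fin (n + 1) → ℕ} (hc : ∀ i, c i ≠ 0) (r : R) :
    HasSubst (shear R c r) := by
  refine hasSubst_of_constantCoeff_zero fun i => ?_
  rw [shear]
  split_ifs <;> simp [hc i]

lemma subst_shear_shear {c : Fin (n + 1) → ℕ} (hc : ∀ i, c i ≠ 0) {r s : R} (hrs : r + s = 0)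
    (f : MvPowerSeries (Fin (n + 1)) R) : subst (shear R c s) (subst (shear R c r) f) = f := by
  rw [subst_comp_subst_apply (hasSubst_shear hc r) (hasSubst_shear hc s)]
  have : (fun i => subst (shear R c s) (shear R c r i)) = X := by
    funext i
    have hs := hasSubst_shear hc s
    rw [shear, subst_add hs, subst_X hs]
    split_ifs with h
    · rw [← substAlgHom_apply hs, map_zero, shear, if_pos h]
      simp
    · rw [subst_mul hs, subst_pow hs, subst_X hs, subst_C, shear, shear, if_neg h, if_pos rfl,
        add_zero]
      have : (C r : MvPowerSeries (Fin (n + 1)) R) + C s = 0 := by rw [← map_add, hrs, map_zero]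
      linear_combination X 0 ^ c i * this
  rw [this, subst_self, id]

/-- The automorphism with `T_0 ↦ T_0`, `T_i ↦ T_i + T_0^{c_i}` for `i ≠ 0`. -/
noncomputable def shearEquiv {c : Fin (n + 1) → ℕ} (hc : ∀ i, c i ≠ 0) :
    MvPowerSeries (Fin (n + 1)) R ≃ₐ[R] MvPowerSeries (Fin (n + 1)) R :=
  AlgEquiv.ofAlgHom (substAlgHom (hasSubst_shear hc 1)) (substAlgHom (hasSubst_shear hc (-1)))
    (AlgHom.ext fun f => by simp [subst_shear_shear hc])
    (AlgHom.ext fun f => by simp [subst_shear_shear hc])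

lemma shearEquiv_apply {c : Fin (n + 1) → ℕ} (hc : ∀ i, c i ≠ 0)
    (f : MvPowerSeries (Fin (n + 1)) R) : shearEquiv hc f = subst (shear R c 1) f :=
  substAlgHom_apply (hasSubst_shear hc 1) f

/-- Only pure powers of `T_0` are seen, so the other variables may be set to zero. Then every `T_i`
goes to `T_0^{c_i}`, including `i = 0` because `c 0 = 1`, and a monomial becomes `T_0` to its
weight. -/
lemma coeff_cons_zero_prod_shear {c : Fin (n + 1) → ℕ} (hc0 : c 0 = 1) (d : Fin (n + 1) →₀ ℕ)
    (k : ℕ) : coeff (Finsupp.cons k 0) (d.prod fun s e => shear R c 1 s ^ e) =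
      if k = ∑ i, c i * d i then 1 else 0 := by
  let ρ : MvPowerSeries (Fin (n + 1)) R →+* PowerSeries R :=
    (PowerSeries.map constantCoeff).comp (finSuccEquiv R n).toRingEquiv.toRingHom
  have hρ : ∀ F, coeff (Finsupp.cons k 0) F = PowerSeries.coeff k (ρ F) := by
    intro F
    change _ = PowerSeries.coeff k (PowerSeries.map constantCoeff (finSuccEquiv R n F))
    rw [PowerSeries.coeff_map, ← coeff_coeff_finSuccEquiv, coeff_zero_eq_constantCoeff_apply]
  have hX : ∀ i, ρ (shear R c 1 i) = PowerSeries.X ^ c i := by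
    intro i
    change PowerSeries.map constantCoeff (finSuccEquiv R n (shear R c 1 i)) = _
    refine Fin.cases ?_ (fun j => ?_) i
    · simp [shear, finSuccEquiv_X_zero, hc0]
    · simp [shear, finSuccEquiv_X_zero, finSuccEquiv_X_succ]
  rw [hρ, Finsupp.prod_fintype _ _ (by simp), map_prod]
  simp only [map_pow, hX, ← pow_mul, Finset.prod_pow_eq_pow_sum, PowerSeries.coeff_X_pow]

/-- With separating weights for the support of `map φ f`, exactly one exponent in that support
contributes to a suitable pure power of `T_0`, so no cancellation can occur. -/
lemma exists_shearEquiv_coeff_ne_zero {f : MvPowerSeries (Fin (n + 1)) R} {S : Type*} [CommRing S]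
    (φ : R →+* S) (hf : map φ f ≠ 0) :
    ∃ (c : Fin (n + 1) → ℕ) (hc : ∀ i, c i ≠ 0) (k : ℕ),
      φ (coeff (Finsupp.cons k 0) (shearEquiv hc f)) ≠ 0 := by
  obtain ⟨d0, hd0⟩ := ne_zero_iff_exists_coeff_ne_zero _ |>.1 hf
  obtain ⟨c, hc0, hc, d, hd, hmin⟩ := exists_separating_weights n
    {d | coeff (Finsupp.equivFunOnFinite.symm d) (map φ f) ≠ 0} ⟨d0, by simpa using hd0⟩
  refine ⟨c, hc, ∑ i, c i * d i, ?_⟩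
  have hmap : map φ (shearEquiv hc f) = subst (shear S c 1) (map φ f) := by
    rw [shearEquiv_apply, map_subst (hasSubst_shear hc 1)]
    congr 1
    funext i
    simp only [shear]
    split_ifs <;> simp
  rw [← coeff_map, hmap, coeff_subst (hasSubst_shear hc 1),
    finsum_eq_single _ (Finsupp.equivFunOnFinite.symm d)]
  · rw [coeff_cons_zero_prod_shear hc0, if_pos (by simp)]
    simpa using hd
  · intro d' hd'
    rw [coeff_cons_zero_prod_shear hc0]
    split_ifs with h
    · by_contra hne
      apply hd'
      have := hmin d' (by
        have : coeff d' (map φ f) ≠ 0 := fun h0 => hne (by rw [h0, zero_smul])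
        simpa using this) h.symm
      rw [← this]
      simp
    · rw [smul_zero]

end MvPowerSeries

end ChangeOfVariables

/-! ### Unique factorization in `ℤ_p[[T_1, …, T_n]]`. -/

section UFD

namespace MvPowerSeries

lemma C_dvd_iff {σ R : Type*} [CommRing R] (r : R) (f : MvPowerSeries σ R) :
    C r ∣ f ↔ ∀ d, r ∣ coeff d f := by
  constructor
  · rintro ⟨g, rfl⟩ d
    rw [coeff_C_mul]
    exact dvd_mul_right _ _
  · intro h
    choose g hg using h
    exact ⟨(g : MvPowerSeries σ R),
      MvPowerSeries.ext fun d => (hg d).trans (coeff_C_mul d (g : MvPowerSeries σ R) r).symm⟩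

lemma map_eq_zero_iff_C_dvd {σ R S : Type*} [CommRing R] [CommRing S] (φ : R →+* S) {r : R}
    (h : RingHom.ker φ = Ideal.span {r}) (f : MvPowerSeries σ R) : map φ f = 0 ↔ C r ∣ f := by
  rw [C_dvd_iff, MvPowerSeries.ext_iff]
  refine forall_congr' fun d => ?_
  rw [coeff_map, coeff_zero, ← RingHom.mem_ker, h, Ideal.mem_span_singleton]

lemma map_toZMod_eq_zero_iff {σ : Type*} (p : ℕ) [Fact p.Prime] (f : MvPowerSeries σ ℤ_[p]) :
    map (PadicInt.toZMod (p := p)) f = 0 ↔ (p : MvPowerSeries σ ℤ_[p]) ∣ f := by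
  rw [map_eq_zero_iff_C_dvd _ (r := (p : ℤ_[p]))]
  · rw [map_natCast]
  · rw [PadicInt.ker_toZMod, PadicInt.maximalIdeal_eq_span_p]

instance isDomain {σ R : Type*} [CommRing R] [IsDomain R] : IsDomain (MvPowerSeries σ R) :=
  haveI : Nontrivial (MvPowerSeries σ R) :=
    (constantCoeff (σ := σ) (R := R)).domain_nontrivial
  NoZeroDivisors.to_isDomain _

/-- Divisibility by `p` is vanishing of the reduction, and power series over the residue field form
a domain. -/
lemma prime_natCast (σ : Type*) (p : ℕ) [Fact p.Prime] : Prime (p : MvPowerSeries σ ℤ_[p]) := by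
  have h0 : (p : MvPowerSeries σ ℤ_[p]) ≠ 0 := by
    intro h
    have h1 := congrArg constantCoeff h
    rw [map_natCast, map_zero] at h1
    exact (Fact.out : p.Prime).ne_zero (by exact_mod_cast h1)
  refine ⟨h0, fun hu => ?_, fun a b hab => ?_⟩
  · have := hu.map (constantCoeff (σ := σ) (R := ℤ_[p]))
    rw [map_natCast] at this
    exact (PadicInt.prime_p (p := p)).not_isUnit this
  · rw [← map_toZMod_eq_zero_iff, map_mul, mul_eq_zero, map_toZMod_eq_zero_iff,
      map_toZMod_eq_zero_iff] at hab
    exact hab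

/-- By Kaplansky's criterion it suffices to find a prime element in each nonzero prime ideal. Either
`p` itself lies in it, or powers of `p` can be stripped from a nonzero member; a shear then makes
the result regular in `T_0` over the ring in one variable fewer, where Weierstrass preparation
applies. -/
instance uniqueFactorizationMonoid_padicInt (p n : ℕ) [Fact p.Prime] :
    UniqueFactorizationMonoid (MvPowerSeries (Fin n) ℤ_[p]) := by
  induction n with
  | zero =>
    exact (isEmptyEquiv (σ := Fin 0) (R := ℤ_[p])).symm.toMulEquiv.uniqueFactorizationMonoid
      inferInstance
  | succ n ih =>
    refine UniqueFactorizationMonoid.iff_exists_prime_mem_of_isPrime.2 fun P hP0 hP => ?_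
    by_cases hpP : (p : MvPowerSeries (Fin (n + 1)) ℤ_[p]) ∈ P
    · exact ⟨_, hpP, prime_natCast _ p⟩
    obtain ⟨f, hfP, hf0⟩ := P.ne_bot_iff.1 hP0
    obtain ⟨k, g, hg, rfl⟩ := WfDvdMonoid.max_power_factor hf0 (prime_natCast (Fin (n + 1)) p).irreducible
    have hgP : g ∈ P := (hP.mem_or_mem hfP).resolve_left fun h => hpP (hP.mem_of_pow_mem _ h)
    rw [← map_toZMod_eq_zero_iff] at hg
    obtain ⟨c, hc, m, hm⟩ := exists_shearEquiv_coeff_ne_zero _ hg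
    let e : MvPowerSeries (Fin (n + 1)) ℤ_[p] ≃+* PowerSeries (MvPowerSeries (Fin n) ℤ_[p]) :=
      ((shearEquiv hc).trans (finSuccEquiv ℤ_[p] n)).toRingEquiv
    have hQ : (P.comap e.symm.toRingHom).IsPrime := Ideal.comap_isPrime _ _
    -- The coefficient of `T_0^m` has a constant term not divisible by `p`, so it is a unit and
    -- survives in the residue field.
    obtain ⟨x, hx, hxp⟩ := PowerSeries.exists_prime_mem_of_map_residue_ne_zero hQ (f := e g)
      (by simpa [Ideal.mem_comap] using hgP) (fun h0 => hm (by
        have h1 := congrArg (PowerSeries.coeff m) h0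
        rw [PowerSeries.coeff_map, map_zero, IsLocalRing.residue_eq_zero_iff,
          IsLocalRing.mem_maximalIdeal, mem_nonunits_iff, isUnit_iff_constantCoeff,
          ← mem_nonunits_iff, ← IsLocalRing.mem_maximalIdeal, ← PadicInt.ker_toZMod,
          RingHom.mem_ker] at h1
        rw [← h1, ← coeff_coeff_finSuccEquiv, coeff_zero_eq_constantCoeff_apply]
        rfl))
    exact ⟨e.symm x, hx, (MulEquiv.prime_iff e.symm.toMulEquiv).2 hxp⟩

end MvPowerSeries

end UFD

/-! ### Pseudo-null modules and pseudo-isomorphisms, tested one prime at a time. -/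

namespace VoltageIwasawa

section PseudoNull

variable {R A B C : Type*} [CommRing R]
  [AddCommGroup A] [Module R A] [AddCommGroup B] [Module R B] [AddCommGroup C] [Module R C]

lemma IsPseudoNull.exists_not_dvd (h : IsPseudoNull R A) {π : R} (hπ : Prime π) :
    ∃ a : R, ¬ π ∣ a ∧ ∀ x : A, a • x = 0 := by
  obtain ⟨a, b, hab, h⟩ := h
  by_cases ha : π ∣ a
  · exact ⟨b, fun hb => hπ.not_isUnit (hab ha hb), fun x => (h x).2⟩
  · exact ⟨a, ha, fun x => (h x).1⟩

lemma IsPseudoIso.exists_not_dvd {φ : A →ₗ[R] B} (h : IsPseudoIso φ) {π : R} (hπ : Prime π) :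
    ∃ a : R, ¬ π ∣ a ∧ (∀ x, φ x = 0 → a • x = 0) ∧ ∀ y, ∃ x, φ x = a • y := by
  obtain ⟨a, ha, hak⟩ := h.1.exists_not_dvd hπ
  obtain ⟨b, hb, hbc⟩ := h.2.exists_not_dvd hπ
  refine ⟨a * b, fun h => (hπ.dvd_or_dvd h).elim ha hb, fun x hx => ?_, fun y => ?_⟩
  · rw [mul_comm, mul_smul, show a • x = 0 from congrArg Subtype.val (hak ⟨x, hx⟩), smul_zero]
  · have := hbc (Submodule.Quotient.mk y)
    rw [← Submodule.Quotient.mk_smul, Submodule.Quotient.mk_eq_zero] at this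
    obtain ⟨x, hx⟩ := this
    exact ⟨a • x, by rw [map_smul, hx, mul_smul]⟩

/-- A linear map whose kernel and cokernel are killed by two relatively prime elements. -/
lemma isPseudoIso_of_isRelPrime {φ : A →ₗ[R] B} {a b : R} (hab : IsRelPrime a b)
    (h1 : ∀ x, φ x = 0 → a • x = 0 ∧ b • x = 0)
    (h2 : ∀ y, (∃ x, φ x = a • y) ∧ ∃ x, φ x = b • y) : IsPseudoIso φ := by
  refine ⟨⟨a, b, hab, fun x => ?_⟩, ⟨a, b, hab, fun y => ?_⟩⟩
  · exact ⟨Subtype.ext (h1 x x.2).1, Subtype.ext (h1 x x.2).2⟩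
  · obtain ⟨y, rfl⟩ := Submodule.Quotient.mk_surjective _ y
    rw [← Submodule.Quotient.mk_smul, ← Submodule.Quotient.mk_smul, Submodule.Quotient.mk_eq_zero,
      Submodule.Quotient.mk_eq_zero]
    exact h2 y

variable [IsDomain R] [UniqueFactorizationMonoid R]

/-- One nonzero annihilator `x` has finitely many prime factors up to units. Prime avoidance yields
a second annihilator outside all the corresponding principal primes, hence prime to `x`. The prime
`π₀` only serves to produce `x`. -/
lemma isPseudoNull_of_forall_prime {π₀ : R} (hπ₀ : Prime π₀)
    (h : ∀ π : R, Prime π → ∃ a : R, ¬ π ∣ a ∧ ∀ x : A, a • x = 0) : IsPseudoNull R A := by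
  obtain ⟨x, hx, hxA⟩ := h π₀ hπ₀
  have hx0 : x ≠ 0 := fun h => hx (h ▸ dvd_zero _)
  obtain ⟨s, hs, hsx⟩ := UniqueFactorizationMonoid.exists_prime_factors x hx0
  let I := Module.annihilator R A
  have hI : ¬ ((I : Set R) ⊆ ⋃ π ∈ {π | π ∈ s}, (Ideal.span {π} : Ideal R)) := by
    -- The two zeros are placeholders for the indices that prime avoidance exempts from primality;
    -- every ideal here is prime.
    rw [Ideal.subset_union_prime_finite (Multiset.finite_toSet s) (f := fun π => Ideal.span {π}) 0 0
      fun π hπ _ _ => (Ideal.span_singleton_prime (hs π hπ).ne_zero).2 (hs π hπ)]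
    rintro ⟨π, hπ, hle⟩
    obtain ⟨a, ha, haA⟩ := h π (hs π hπ)
    exact ha (Ideal.mem_span_singleton.1 (hle (Module.mem_annihilator.2 haA)))
  obtain ⟨y, hyI, hy⟩ := Set.not_subset.1 hI
  refine ⟨x, y, ?_, fun z => ⟨hxA z, Module.mem_annihilator.1 hyI z⟩⟩
  rw [UniqueFactorizationMonoid.isRelPrime_iff_no_prime_factors hx0]
  intro d hdx hdy hd
  apply hy
  have hds : d ∣ s.prod := hdx.trans hsx.symm.dvd
  obtain ⟨π, hπ, hdπ⟩ := hd.exists_mem_multiset_dvd hds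
  rw [Set.mem_iUnion₂]
  exact ⟨π, hπ, Ideal.mem_span_singleton.2 (((hd.dvd_prime_iff_associated (hs π hπ)).1 hdπ).symm.dvd.trans hdy)⟩

lemma isPseudoIso_of_forall_prime {π₀ : R} (hπ₀ : Prime π₀) {φ : A →ₗ[R] B}
    (h : ∀ π : R, Prime π →
      ∃ a : R, ¬ π ∣ a ∧ (∀ x, φ x = 0 → a • x = 0) ∧ ∀ y, ∃ x, φ x = a • y) : IsPseudoIso φ := by
  refine ⟨isPseudoNull_of_forall_prime hπ₀ fun π hπ => ?_,
    isPseudoNull_of_forall_prime hπ₀ fun π hπ => ?_⟩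
  · obtain ⟨a, ha, h1, -⟩ := h π hπ
    exact ⟨a, ha, fun x => Subtype.ext (h1 x x.2)⟩
  · obtain ⟨a, ha, -, h2⟩ := h π hπ
    refine ⟨a, ha, fun y => ?_⟩
    obtain ⟨y, rfl⟩ := Submodule.Quotient.mk_surjective _ y
    rw [← Submodule.Quotient.mk_smul, Submodule.Quotient.mk_eq_zero]
    exact h2 y

lemma IsPseudoIso.comp {π₀ : R} (hπ₀ : Prime π₀) {ψ : B →ₗ[R] C} {φ : A →ₗ[R] B}
    (hψ : IsPseudoIso ψ) (hφ : IsPseudoIso φ) : IsPseudoIso (ψ ∘ₗ φ) := by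
  refine isPseudoIso_of_forall_prime hπ₀ fun π hπ => ?_
  obtain ⟨a, ha, h1, h2⟩ := hφ.exists_not_dvd hπ
  obtain ⟨b, hb, h3, h4⟩ := hψ.exists_not_dvd hπ
  refine ⟨a * b, fun h => (hπ.dvd_or_dvd h).elim ha hb, fun x hx => ?_, fun y => ?_⟩
  · have := h3 (φ x) hx
    rw [← map_smul] at this
    rw [mul_smul]
    exact h1 _ this
  · obtain ⟨z, hz⟩ := h4 y
    obtain ⟨x, hx⟩ := h2 z
    exact ⟨x, by rw [LinearMap.comp_apply, hx, map_smul, hz, mul_smul]⟩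

end PseudoNull

/-! ### Lengths of localized modules. -/

section LocalLength

variable {R A B C : Type*} [CommRing R] (S : Submonoid R)
  [AddCommGroup A] [Module R A] [AddCommGroup B] [Module R B] [AddCommGroup C] [Module R C]

variable {S} in
lemma localizedModule_mk_eq_zero_iff {x : A} {s : S} :
    LocalizedModule.mk x s = 0 ↔ ∃ u : S, u • x = 0 := by
  rw [← LocalizedModule.zero_mk 1, LocalizedModule.mk_eq]
  simp

/-- The length of the localization of a module. -/
noncomputable def localLength (A : Type*) [AddCommGroup A] [Module R A] : ℕ∞ :=
  Module.length (Localization S) (LocalizedModule S A)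

/-- Kernel and cokernel are `S`-torsion elementwise, so `φ` becomes bijective after inverting `S`.
-/
lemma localLength_eq_of_forall_exists (φ : A →ₗ[R] B) (h1 : ∀ x, φ x = 0 → ∃ a ∈ S, a • x = 0)
    (h2 : ∀ y, ∃ a ∈ S, ∃ x, φ x = a • y) : localLength S A = localLength S B := by
  have key : ∀ m s, LocalizedModule.map S φ (LocalizedModule.mk m s) =
      LocalizedModule.mk (φ m) s := fun m s => LocalizedModule.map_mk S φ m s
  refine (LinearEquiv.ofBijective (LocalizedModule.map S φ) ⟨?_, ?_⟩).length_eq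
  · rw [injective_iff_map_eq_zero]
    intro x
    induction x using LocalizedModule.induction_on with
    | h m s =>
      rw [key, localizedModule_mk_eq_zero_iff, localizedModule_mk_eq_zero_iff]
      rintro ⟨t, ht⟩
      rw [Submonoid.smul_def, ← map_smul] at ht
      obtain ⟨a, haS, ha⟩ := h1 _ ht
      exact ⟨⟨a, haS⟩ * t, by rwa [mul_smul]⟩
  · intro y
    induction y using LocalizedModule.induction_on with
    | h m s =>
      obtain ⟨a, haS, x, hx⟩ := h2 m
      refine ⟨LocalizedModule.mk x (⟨a, haS⟩ * s), ?_⟩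
      rw [key, hx]
      exact LocalizedModule.mk_cancel_common_left ⟨a, haS⟩ s m

lemma LinearEquiv.localLength_eq (e : A ≃ₗ[R] B) : localLength S A = localLength S B :=
  localLength_eq_of_forall_exists S e.toLinearMap
    (fun x hx => ⟨1, S.one_mem, by simpa using hx⟩)
    (fun y => ⟨1, S.one_mem, e.symm y, by simp⟩)

lemma localLength_eq_zero (h : ∀ x : A, ∃ a ∈ S, a • x = 0) : localLength S A = 0 := by
  have : Subsingleton (LocalizedModule S A) := by
    refine subsingleton_of_forall_eq 0 fun x => ?_
    induction x using LocalizedModule.induction_on with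
    | h m s =>
      obtain ⟨a, haS, ha⟩ := h m
      exact (localizedModule_mk_eq_zero_iff).2 ⟨⟨a, haS⟩, ha⟩
  exact Module.length_eq_zero

lemma localLength_eq_add_of_exact (f : A →ₗ[R] B) (g : B →ₗ[R] C) (hf : Function.Injective f)
    (hg : Function.Surjective g) (H : Function.Exact f g) :
    localLength S B = localLength S A + localLength S C :=
  Module.length_eq_add_of_exact (LocalizedModule.map S f) (LocalizedModule.map S g)
    (IsLocalizedModule.map_injective S _ _ f hf) (IsLocalizedModule.map_surjective S _ _ g hg)
    (LocalizedModule.map_exact S f g H)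

lemma localLength_prod : localLength S (A × B) = localLength S A + localLength S B :=
  localLength_eq_add_of_exact S _ _ LinearMap.inl_injective LinearMap.snd_surjective .inl_snd

lemma localLength_pi_fin : ∀ {n : ℕ} (M : Fin n → Type*) [∀ i, AddCommGroup (M i)]
    [∀ i, Module R (M i)], localLength S (∀ i, M i) = ∑ i, localLength S (M i) := by
  intro n
  induction n with
  | zero =>
    intro M _ _
    rw [Fin.sum_univ_zero]
    exact localLength_eq_zero S fun x => ⟨1, S.one_mem, Subsingleton.elim _ _⟩
  | succ n ih =>
    intro M _ _
    rw [Fin.sum_univ_succ, ← ih, ← localLength_prod]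
    exact (LinearEquiv.localLength_eq S (Fin.consLinearEquiv R M)).symm

lemma localLength_quotient_one : localLength S (R ⧸ Ideal.span {(1 : R)}) = 0 := by
  refine localLength_eq_zero S fun x => ⟨1, S.one_mem, ?_⟩
  obtain ⟨x, rfl⟩ := Submodule.Quotient.mk_surjective _ x
  rw [one_smul, Submodule.Quotient.mk_eq_zero, Ideal.span_singleton_one]
  trivial

/-- The submonoid of elements which are not divisible by a prime element. -/
def notDvd {π : R} (hπ : Prime π) : Submonoid R where
  carrier := {a | ¬ π ∣ a}
  one_mem' h := hπ.not_isUnit (isUnit_of_dvd_one h)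
  mul_mem' ha hb h := (hπ.dvd_or_dvd h).elim ha hb

/-- A nonzero fraction has numerator outside `(π)`, which is invertible in the localization, so
every nonzero element generates. -/
lemma localLength_quotient_prime {π : R} (hπ : Prime π) :
    localLength (notDvd hπ) (R ⧸ Ideal.span {π}) = 1 := by
  rw [localLength, Module.length_eq_one_iff, isSimpleModule_iff_toSpanSingleton_surjective]
  refine ⟨⟨LocalizedModule.mk (Submodule.Quotient.mk 1) 1, 0, fun h => ?_⟩, fun x hx y => ?_⟩
  · obtain ⟨⟨u, hu⟩, h⟩ := localizedModule_mk_eq_zero_iff.1 h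
    rw [Submonoid.smul_def, ← Submodule.Quotient.mk_smul, Submodule.Quotient.mk_eq_zero,
      Ideal.mem_span_singleton] at h
    exact hu (by simpa using h)
  · induction x, y using LocalizedModule.induction_on₂ with
    | h x y s t =>
      obtain ⟨x, rfl⟩ := Submodule.Quotient.mk_surjective _ x
      obtain ⟨y, rfl⟩ := Submodule.Quotient.mk_surjective _ y
      have hxπ : ¬ π ∣ x := fun h => hx (by
        rw [(Submodule.Quotient.mk_eq_zero _).2 (Ideal.mem_span_singleton.2 h),
          LocalizedModule.zero_mk])
      refine ⟨Localization.mk (y * s) (t * ⟨x, hxπ⟩), ?_⟩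
      rw [LinearMap.toSpanSingleton_apply, LocalizedModule.mk_smul_mk, LocalizedModule.mk_eq]
      refine ⟨1, ?_⟩
      simp only [Submonoid.smul_def, ← Submodule.Quotient.mk_smul, smul_eq_mul]
      congr 1
      simp only [Submonoid.coe_mul]
      ring

lemma IsPseudoIso.localLength_eq {π : R} (hπ : Prime π) {φ : A →ₗ[R] B} (h : IsPseudoIso φ) :
    localLength (notDvd hπ) A = localLength (notDvd hπ) B := by
  obtain ⟨a, ha, h1, h2⟩ := h.exists_not_dvd hπ
  exact localLength_eq_of_forall_exists _ φ (fun x hx => ⟨a, ha, h1 x hx⟩) fun y => ⟨a, ha, h2 y⟩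

variable [IsDomain R]

/-- This is additivity along `0 → R/(a) → R/(ab) → R/(b) → 0`, whose first map is multiplication by
`b`. -/
lemma localLength_quotient_mul {a b : R} (hb : b ≠ 0) :
    localLength S (R ⧸ Ideal.span {a * b}) =
      localLength S (R ⧸ Ideal.span {a}) + localLength S (R ⧸ Ideal.span {b}) := by
  let f : (R ⧸ Ideal.span {a}) →ₗ[R] (R ⧸ Ideal.span {a * b}) :=
    Submodule.mapQ _ _ (LinearMap.mulRight R b) (by
      rw [Ideal.span, Submodule.span_le, Set.singleton_subset_iff]
      exact Ideal.mem_span_singleton_self _)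
  let g : (R ⧸ Ideal.span {a * b}) →ₗ[R] (R ⧸ Ideal.span {b}) :=
    Submodule.mapQ _ _ LinearMap.id (by
      rw [Ideal.span, Submodule.span_le, Set.singleton_subset_iff]
      exact Ideal.mul_mem_left _ _ (Ideal.mem_span_singleton_self _))
  have hf : ∀ x : R, f (Submodule.Quotient.mk x) = Submodule.Quotient.mk (x * b) := fun _ => rfl
  have hg : ∀ x : R, g (Submodule.Quotient.mk x) = Submodule.Quotient.mk x := fun _ => rfl
  refine localLength_eq_add_of_exact S f g ?_ ?_ ?_
  · rw [injective_iff_map_eq_zero]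
    intro x hx
    obtain ⟨x, rfl⟩ := Submodule.Quotient.mk_surjective _ x
    rw [hf, Submodule.Quotient.mk_eq_zero, Ideal.mem_span_singleton] at hx
    rw [Submodule.Quotient.mk_eq_zero, Ideal.mem_span_singleton]
    exact (mul_dvd_mul_iff_right hb).1 hx
  · intro x
    obtain ⟨x, rfl⟩ := Submodule.Quotient.mk_surjective _ x
    exact ⟨Submodule.Quotient.mk x, hg x⟩
  · intro x
    obtain ⟨x, rfl⟩ := Submodule.Quotient.mk_surjective _ x
    rw [hg, Submodule.Quotient.mk_eq_zero, Ideal.mem_span_singleton]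
    constructor
    · rintro ⟨y, rfl⟩
      exact ⟨Submodule.Quotient.mk y, by rw [hf, mul_comm y b]⟩
    · rintro ⟨y, hy⟩
      obtain ⟨y, rfl⟩ := Submodule.Quotient.mk_surjective _ y
      rw [hf, Submodule.Quotient.eq, Ideal.mem_span_singleton] at hy
      have h1 : b ∣ y * b - x := (dvd_mul_left b a).trans hy
      exact (dvd_sub_right (dvd_mul_left b y)).1 h1

lemma localLength_quotient_pow {a : R} (ha : a ≠ 0) (k : ℕ) :
    localLength S (R ⧸ Ideal.span {a ^ k}) = k * localLength S (R ⧸ Ideal.span {a}) := by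
  induction k with
  | zero =>
    rw [pow_zero, localLength_quotient_one]
    simp
  | succ k ih =>
    rw [pow_succ, localLength_quotient_mul S ha, ih]
    push_cast
    ring

lemma localLength_quotient_prod {n : ℕ} (d : Fin n → R) (hd : ∀ i, d i ≠ 0) :
    localLength S (R ⧸ Ideal.span {∏ i, d i}) = ∑ i, localLength S (R ⧸ Ideal.span {d i}) := by
  induction n with
  | zero => rw [Fin.prod_univ_zero, Fin.sum_univ_zero, localLength_quotient_one]
  | succ n ih =>
    rw [Fin.prod_univ_succ, Fin.sum_univ_succ, ← ih _ fun i => hd _, localLength_quotient_mul]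
    exact Finset.prod_ne_zero_iff.2 fun i _ => hd _

variable [UniqueFactorizationMonoid R]

lemma localLength_quotient_eq_emultiplicity {π : R} (hπ : Prime π) {a : R} (ha : a ≠ 0) :
    localLength (notDvd hπ) (R ⧸ Ideal.span {a}) = emultiplicity π a := by
  obtain ⟨k, b, hb, rfl⟩ := WfDvdMonoid.max_power_factor ha hπ.irreducible
  have hb0 : b ≠ 0 := right_ne_zero_of_mul ha
  rw [localLength_quotient_mul _ hb0, localLength_quotient_pow _ hπ.ne_zero,
    localLength_quotient_prime, localLength_eq_zero (notDvd hπ) (A := R ⧸ Ideal.span {b}),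
    emultiplicity_mul hπ, emultiplicity_pow_self_of_prime hπ, emultiplicity_eq_zero.2 hb]
  · simp
  · refine fun x => ⟨b, hb, ?_⟩
    obtain ⟨x, rfl⟩ := Submodule.Quotient.mk_surjective _ x
    rw [← Submodule.Quotient.mk_smul, Submodule.Quotient.mk_eq_zero, Ideal.mem_span_singleton]
    exact dvd_mul_right _ _

lemma associated_of_forall_emultiplicity_eq {a b : R} (ha : a ≠ 0) (hb : b ≠ 0)
    (h : ∀ π : R, Prime π → emultiplicity π a = emultiplicity π b) : Associated a b :=
  associated_of_dvd_dvd
    ((UniqueFactorizationMonoid.dvd_iff_emultiplicity_le ha).2 fun π hπ => (h π hπ).le)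
    ((UniqueFactorizationMonoid.dvd_iff_emultiplicity_le hb).2 fun π hπ => (h π hπ).ge)

end LocalLength

/-! ### Uniqueness of the characteristic ideal. -/

section Uniqueness

variable {p l : ℕ} [Fact p.Prime]

lemma ne_zero_of_isRelPrime_natCast {g : Iwasawa p l} (h : IsRelPrime g (p : Iwasawa p l)) :
    g ≠ 0 := by
  rintro rfl
  exact (MvPowerSeries.prime_natCast (Fin l) p).not_isUnit (h (dvd_zero _) dvd_rfl)

lemma localLength_elementary (S : Submonoid (Iwasawa p l)) {s t : ℕ} (e : Fin s → ℕ)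
    (g : Fin t → Iwasawa p l) (hg : ∀ j, IsRelPrime (g j) (p : Iwasawa p l)) :
    localLength S (Elementary p l e g) =
      localLength S (Iwasawa p l ⧸ Ideal.span {(p : Iwasawa p l) ^ (∑ i, e i) * ∏ j, g j}) := by
  have hp := (MvPowerSeries.prime_natCast (Fin l) p).ne_zero
  have hg0 := fun j => ne_zero_of_isRelPrime_natCast (hg j)
  rw [localLength_prod, localLength_pi_fin, localLength_pi_fin,
    localLength_quotient_mul _ (Finset.prod_ne_zero_iff.2 fun j _ => hg0 j),
    ← Finset.prod_pow_eq_pow_sum, localLength_quotient_prod _ _ fun i => pow_ne_zero _ hp,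
    localLength_quotient_prod _ _ hg0]

/-- The multiplicity of `π` in either generator is the length of `A` localized at `(π)`, which does
not depend on the chosen elementary module; in a factorial ring multiplicities determine an element
up to units. -/
lemma IsCharIdeal.unique {A : Type*} [AddCommGroup A] [Module (Iwasawa p l) A]
    {I J : Ideal (Iwasawa p l)} (hI : IsCharIdeal p l A I) (hJ : IsCharIdeal p l A J) : I = J := by
  obtain ⟨s, t, e, g, hg, ⟨φ, hφ⟩, rfl⟩ := hI
  obtain ⟨s', t', e', g', hg', ⟨φ', hφ'⟩, rfl⟩ := hJ
  have hp := (MvPowerSeries.prime_natCast (Fin l) p).ne_zero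
  have h0 : (p : Iwasawa p l) ^ (∑ i, e i) * ∏ j, g j ≠ 0 := mul_ne_zero (pow_ne_zero _ hp)
    (Finset.prod_ne_zero_iff.2 fun j _ => ne_zero_of_isRelPrime_natCast (hg j))
  have h0' : (p : Iwasawa p l) ^ (∑ i, e' i) * ∏ j, g' j ≠ 0 := mul_ne_zero (pow_ne_zero _ hp)
    (Finset.prod_ne_zero_iff.2 fun j _ => ne_zero_of_isRelPrime_natCast (hg' j))
  rw [Ideal.span_singleton_eq_span_singleton]
  refine associated_of_forall_emultiplicity_eq h0 h0' fun π hπ => ?_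
  rw [← localLength_quotient_eq_emultiplicity hπ h0, ← localLength_quotient_eq_emultiplicity hπ h0',
    ← localLength_elementary _ _ _ hg, ← localLength_elementary _ _ _ hg', ← hφ.localLength_eq hπ,
    hφ'.localLength_eq hπ]

lemma IsCharIdeal.of_isPseudoIso {A B : Type*} [AddCommGroup A] [Module (Iwasawa p l) A]
    [AddCommGroup B] [Module (Iwasawa p l) B] {φ : A →ₗ[Iwasawa p l] B} (hφ : IsPseudoIso φ)
    {I : Ideal (Iwasawa p l)} (hB : IsCharIdeal p l B I) : IsCharIdeal p l A I := by
  obtain ⟨s, t, e, g, hg, ⟨ψ, hψ⟩, rfl⟩ := hB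
  exact ⟨s, t, e, g, hg, ⟨ψ ∘ₗ φ, hψ.comp (MvPowerSeries.prime_natCast (Fin l) p) hφ⟩, rfl⟩

end Uniqueness

end VoltageIwasawa

/-! ### Diagonalization up to pseudo-isomorphism, and cokernels of square matrices. -/

namespace VoltageIwasawa

section Diagonalization

open Matrix

variable {R : Type*} [CommRing R]

/-- Injectivity makes the image of `B` a submodule of full rank. Adapted bases `b` of `K^ι` and `a i
• b i` of the image pull back to `B * Cm = Pm * diag(a)` with invertible `Pm` and `Cm`. -/
lemma Matrix.exists_smith_normal_form {K ι : Type*} [CommRing K] [IsDomain K]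
    [IsPrincipalIdealRing K] [Fintype ι] [DecidableEq ι] (B : Matrix ι ι K) (hB : B.det ≠ 0) :
    ∃ (P Q : Matrix ι ι K) (a : ι → K), IsUnit P.det ∧ IsUnit Q.det ∧
      P * B = Matrix.diagonal a * Q := by
  have hinj : Function.Injective B.mulVecLin := by
    rw [← LinearMap.ker_eq_bot, LinearMap.ker_eq_bot']
    intro x hx
    exact Matrix.eq_zero_of_mulVec_eq_zero hB hx
  let e : (ι → K) ≃ₗ[K] LinearMap.range B.mulVecLin := LinearEquiv.ofInjective _ hinj
  obtain ⟨b, a, c, hbc⟩ := Submodule.exists_smith_normal_form_of_rank_eq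
    (N := LinearMap.range B.mulVecLin) (Pi.basisFun K ι) e.symm.finrank_eq
  let c' := c.map e.symm
  have hc' : ∀ i, B *ᵥ c' i = a i • b i := fun i => by
    rw [← hbc i]
    have : e (c' i) = c i := by simp [c']
    rw [← this]
    rfl
  have hU : ∀ d : Module.Basis ι K (ι → K), IsUnit ((Pi.basisFun K ι).toMatrix d).det := by
    intro d
    have := (Pi.basisFun K ι).invertibleToMatrix d
    exact (Matrix.isUnit_iff_isUnit_det _).1 (isUnit_of_invertible _)
  set Pm := (Pi.basisFun K ι).toMatrix b with hPm
  set Cm := (Pi.basisFun K ι).toMatrix c' with hCm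
  have hmul : B * Cm = Pm * Matrix.diagonal a := by
    ext i j
    rw [Matrix.mul_diagonal, Matrix.mul_apply]
    have := congrFun (hc' j) i
    simp only [Matrix.mulVec, dotProduct, Pi.smul_apply, smul_eq_mul] at this
    simp only [hPm, hCm, Module.Basis.toMatrix_apply, Pi.basisFun_repr]
    rw [this, mul_comm]
  refine ⟨Pm⁻¹, Cm⁻¹, a, ?_, ?_, ?_⟩
  · rw [Matrix.isUnit_nonsing_inv_det_iff]; exact hU b
  · rw [Matrix.isUnit_nonsing_inv_det_iff]; exact hU c'
  · calc Pm⁻¹ * B = Pm⁻¹ * (B * Cm) * Cm⁻¹ := by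
          rw [Matrix.mul_assoc, Matrix.mul_assoc, Matrix.mul_nonsing_inv _ (hU c'), Matrix.mul_one]
      _ = Matrix.diagonal a * Cm⁻¹ := by
          rw [hmul, ← Matrix.mul_assoc, Matrix.nonsing_inv_mul _ (hU b), Matrix.one_mul]

variable [IsDomain R] [UniqueFactorizationMonoid R]

/-- The submonoid of nonzero elements which are relatively prime to `f`. -/
def relPrimeSubmonoid (f : R) : Submonoid R where
  carrier := {s | s ≠ 0 ∧ IsRelPrime s f}
  one_mem' := ⟨one_ne_zero, isRelPrime_one_left⟩
  mul_mem' ha hb := ⟨mul_ne_zero ha.1 hb.1, ha.2.mul_left hb.2⟩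

lemma relPrimeSubmonoid_le (f : R) : relPrimeSubmonoid f ≤ nonZeroDivisors R :=
  fun _ hs => mem_nonZeroDivisors_of_ne_zero hs.1

/-- A nonzero prime of the localization contracts to a prime `q` in which every nonzero element
shares a prime factor with `f`. Prime avoidance puts `q` inside one `(π)`, while factoriality puts a
prime element into `q`; so `q` is principal. -/
lemma isPrincipalIdealRing_localization {f : R} (hf : f ≠ 0) :
    IsPrincipalIdealRing (Localization (relPrimeSubmonoid f)) := by
  set S := relPrimeSubmonoid f
  have : IsDomain (Localization S) := IsLocalization.isDomain_localization (relPrimeSubmonoid_le f)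
  refine IsPrincipalIdealRing.of_prime fun P hP => ?_
  rcases eq_or_ne P ⊥ with rfl | hP0
  · exact ⟨0, by simp⟩
  set q := P.comap (algebraMap R (Localization S)) with hq
  have hqP : q.map (algebraMap R (Localization S)) = P := IsLocalization.map_under S _ P
  have hqp : q.IsPrime := Ideal.comap_isPrime _ _
  have hq0 : q ≠ ⊥ := by
    intro h
    rw [h, Ideal.map_bot] at hqP
    exact hP0 hqP.symm
  have hqS : ∀ x ∈ q, x ∉ S := fun x hx hxS =>
    hP.ne_top (P.eq_top_of_isUnit_mem hx (IsLocalization.map_units _ (⟨x, hxS⟩ : S)))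
  obtain ⟨s, hs, hsf⟩ := UniqueFactorizationMonoid.exists_prime_factors f hf
  have hsub : (q : Set R) ⊆ ⋃ π ∈ {π | π ∈ s}, (Ideal.span {π} : Ideal R) := by
    obtain ⟨y, hyq, hy0⟩ := q.ne_bot_iff.1 hq0
    intro x hx
    rw [Set.mem_iUnion₂]
    have key : ∀ z ∈ q, z ≠ 0 → ∃ π ∈ s, π ∣ z := by
      intro z hz hz0
      have : ¬ IsRelPrime z f := fun h => hqS z hz ⟨hz0, h⟩
      rw [UniqueFactorizationMonoid.isRelPrime_iff_no_prime_factors hz0] at this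
      push Not at this
      obtain ⟨d, hdz, hdf, hd⟩ := this
      obtain ⟨π, hπ, hdπ⟩ := hd.exists_mem_multiset_dvd (hdf.trans hsf.symm.dvd)
      exact ⟨π, hπ, (((hd.dvd_prime_iff_associated (hs π hπ)).1 hdπ).symm.dvd.trans hdz)⟩
    rcases eq_or_ne x 0 with rfl | hx0
    · obtain ⟨π, hπ, -⟩ := key y hyq hy0
      exact ⟨π, hπ, Ideal.zero_mem _⟩
    · obtain ⟨π, hπ, h⟩ := key x hx hx0
      exact ⟨π, hπ, Ideal.mem_span_singleton.2 h⟩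
  rw [Ideal.subset_union_prime_finite (Multiset.finite_toSet s) (f := fun π => Ideal.span {π}) 0 0
      fun π hπ _ _ => (Ideal.span_singleton_prime (hs π hπ).ne_zero).2 (hs π hπ)] at hsub
  obtain ⟨π, hπ, hle⟩ := hsub
  obtain ⟨ϖ, hϖq, hϖ⟩ := hqp.exists_mem_prime_of_ne_bot hq0
  have hass : Associated π ϖ :=
    ((hs π hπ).dvd_prime_iff_associated hϖ).1 (Ideal.mem_span_singleton.1 (hle hϖq))
  have hqeq : q = Ideal.span {ϖ} := by
    refine le_antisymm (hle.trans (Ideal.span_singleton_eq_span_singleton.2 hass).le) ?_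
    rwa [Ideal.span_le, Set.singleton_subset_iff]
  rw [← hqP, hqeq, Ideal.map_span, Set.image_singleton]
  exact ⟨_, rfl⟩

/-- The numerator of `x` divides `f` times an element of the multiplicative set. Splitting it
accordingly, the factor dividing that element becomes a unit and the other one divides `f`. -/
lemma exists_dvd_associated_algebraMap {f : R} {x : Localization (relPrimeSubmonoid f)}
    (hx : x ∣ algebraMap R _ f) :
    ∃ d, d ∣ f ∧ Associated (algebraMap R (Localization (relPrimeSubmonoid f)) d) x := by
  have hinj : Function.Injective (algebraMap R (Localization (relPrimeSubmonoid f))) :=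
    IsLocalization.injective _ (relPrimeSubmonoid_le f)
  obtain ⟨y, hy⟩ := hx
  obtain ⟨a, s, rfl⟩ := IsLocalization.exists_mk'_eq (relPrimeSubmonoid f) x
  obtain ⟨b, t, rfl⟩ := IsLocalization.exists_mk'_eq (relPrimeSubmonoid f) y
  rw [← IsLocalization.mk'_mul, eq_comm, IsLocalization.mk'_eq_iff_eq_mul, ← map_mul] at hy
  have hdvd : a ∣ ((s * t : relPrimeSubmonoid f) : R) * f := ⟨b, by rw [mul_comm, ← hinj hy]⟩
  obtain ⟨a1, a2, h1, h2, rfl⟩ := exists_dvd_and_dvd_of_dvd_mul hdvd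
  refine ⟨a2, h2, ?_⟩
  have hu1 : IsUnit (algebraMap R (Localization (relPrimeSubmonoid f)) a1) :=
    isUnit_of_dvd_unit (map_dvd _ h1) (IsLocalization.map_units _ (s * t))
  have hmk : algebraMap R (Localization (relPrimeSubmonoid f)) s *
        IsLocalization.mk' _ (a1 * a2) s =
      algebraMap R (Localization (relPrimeSubmonoid f)) a1 * algebraMap R _ a2 := by
    rw [IsLocalization.mul_mk'_eq_mk'_of_mul, IsLocalization.mk'_mul_cancel_left, map_mul]
  exact (associated_unit_mul_right _ _ hu1).trans
    (hmk ▸ (associated_unit_mul_left _ _ (IsLocalization.map_units _ s)))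

lemma isRelPrime_of_isUnit_algebraMap {f x : R}
    (hx : IsUnit (algebraMap R (Localization (relPrimeSubmonoid f)) x)) :
    x ≠ 0 ∧ IsRelPrime x f := by
  obtain ⟨y, hy, hxy⟩ := (IsLocalization.algebraMap_isUnit_iff (relPrimeSubmonoid f)).1 hx
  exact ⟨fun h => hy.1 (zero_dvd_iff.1 (h ▸ hxy)), fun d hd hdf => hy.2 (hd.trans hxy) hdf⟩

/-- A square matrix over a factorial ring can be diagonalized up to matrices whose determinants are
relatively prime to its determinant. -/
lemma Matrix.exists_diagonal_of_det_ne_zero {ι : Type*} [Fintype ι] [DecidableEq ι]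
    (B : Matrix ι ι R) (hB : B.det ≠ 0) :
    ∃ (P Q : Matrix ι ι R) (d : ι → R), (P.det ≠ 0 ∧ IsRelPrime P.det B.det) ∧
      (Q.det ≠ 0 ∧ IsRelPrime Q.det B.det) ∧ (∀ i, d i ∣ B.det) ∧
      P * B = Matrix.diagonal d * Q := by
  set S := relPrimeSubmonoid B.det
  set K := Localization S
  have hinj : Function.Injective (algebraMap R K) :=
    IsLocalization.injective _ (relPrimeSubmonoid_le B.det)
  have : IsDomain K := IsLocalization.isDomain_localization (relPrimeSubmonoid_le B.det)
  have : IsPrincipalIdealRing K := isPrincipalIdealRing_localization hB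
  have hdet : ((algebraMap R K).mapMatrix B).det = algebraMap R K B.det :=
    (RingHom.map_det _ _).symm
  obtain ⟨P, Q, a, hP, hQ, hPQ⟩ := Matrix.exists_smith_normal_form ((algebraMap R K).mapMatrix B)
    (by rw [hdet, map_ne_zero_iff _ hinj]; exact hB)
  have ha : ∀ i, a i ∣ algebraMap R K B.det := by
    intro i
    have h := congrArg Matrix.det hPQ
    rw [Matrix.det_mul, Matrix.det_mul, Matrix.det_diagonal, hdet] at h
    have : a i ∣ P.det * algebraMap R K B.det := by
      rw [h]
      exact (Finset.dvd_prod_of_mem a (Finset.mem_univ i)).mul_right _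
    exact hP.dvd_mul_left.1 this
  choose d hd hda using fun i => exists_dvd_associated_algebraMap (ha i)
  choose u hu using hda
  -- One denominator clears both matrices. The units relating `d i` to `a i` are moved into the
  -- right-hand factor beforehand.
  obtain ⟨s, hs⟩ := IsLocalization.exist_integer_multiples_of_finite S
    (Sum.elim (fun ij : ι × ι => P ij.1 ij.2) (fun ij : ι × ι => (u ij.1 : K) * Q ij.1 ij.2))
  choose F hF using hs
  have hsu : IsUnit (algebraMap R K s) := IsLocalization.map_units _ s
  let P' : Matrix ι ι R := fun i j => F (Sum.inl (i, j))
  let Q' : Matrix ι ι R := fun i j => F (Sum.inr (i, j))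
  have hP' : (algebraMap R K).mapMatrix P' = algebraMap R K s • P := by
    ext i j
    exact (hF (Sum.inl (i, j))).trans (Algebra.smul_def _ _)
  have hQ' : (algebraMap R K).mapMatrix Q' =
      algebraMap R K s • (Matrix.diagonal (fun i => (u i : K)) * Q) := by
    ext i j
    rw [Matrix.smul_apply, Matrix.diagonal_mul]
    exact (hF (Sum.inr (i, j))).trans (Algebra.smul_def _ _)
  refine ⟨P', Q', d, isRelPrime_of_isUnit_algebraMap ?_, isRelPrime_of_isUnit_algebraMap ?_, hd, ?_⟩
  · rw [RingHom.map_det, hP', Matrix.det_smul]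
    exact (hsu.pow _).mul hP
  · rw [RingHom.map_det, hQ', Matrix.det_smul, Matrix.det_mul, Matrix.det_diagonal]
    exact (hsu.pow _).mul (IsUnit.mul (IsUnit.prod_univ_iff.2 fun i => (u i).isUnit) hQ)
  · apply Matrix.map_injective hinj
    change (algebraMap R K).mapMatrix _ = (algebraMap R K).mapMatrix _
    rw [map_mul, map_mul, hP', hQ', Matrix.smul_mul, hPQ, Matrix.mul_smul, ← Matrix.mul_assoc]
    rw [RingHom.mapMatrix_apply, Matrix.diagonal_map (map_zero _), Matrix.diagonal_mul_diagonal]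
    congr 3
    funext i
    exact (hu i).symm

/-- The diagonal entries in `Matrix.exists_diagonal_of_det_ne_zero` multiply to the determinant. -/
lemma associated_prod_of_mul_eq_diagonal_mul {ι : Type*} [Fintype ι] [DecidableEq ι]
    {B P Q : Matrix ι ι R} {d : ι → R} (hP : IsRelPrime P.det B.det) (hQ : IsRelPrime Q.det B.det)
    (hd : ∀ i, d i ∣ B.det) (h : P * B = Matrix.diagonal d * Q) : Associated (∏ i, d i) B.det := by
  have hdet := congrArg Matrix.det h
  rw [Matrix.det_mul, Matrix.det_mul, Matrix.det_diagonal] at hdet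
  refine associated_of_dvd_dvd ?_ ?_
  · refine IsRelPrime.dvd_of_dvd_mul_left (y := P.det) ?_ (hdet ▸ dvd_mul_right _ _)
    exact IsRelPrime.prod_left fun i _ => fun x hx hxP => hP hxP (hx.trans (hd i))
  · exact IsRelPrime.dvd_of_dvd_mul_right hQ.symm (hdet ▸ dvd_mul_left _ _)

/-- The map is induced by `P`. At primes dividing `det B`, the element `det Q * det P` works, by the
adjugates of `Q` and `P`; at all other primes `det B` itself kills both modules. Nonvanishing of
`det P` allows `P` to be cancelled. -/
lemma isPseudoIso_of_mul_eq_diagonal_mul {ι : Type*} [Fintype ι] [DecidableEq ι]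
    {π₀ : R} (hπ₀ : Prime π₀)
    {B P Q : Matrix ι ι R} {d : ι → R} (hP0 : P.det ≠ 0) (hP : IsRelPrime P.det B.det)
    (hQ : IsRelPrime Q.det B.det)
    (hd : ∀ i, d i ∣ B.det) (h : P * B = Matrix.diagonal d * Q) :
    ∃ φ : ((ι → R) ⧸ LinearMap.range B.mulVecLin) →ₗ[R] (∀ i, R ⧸ Ideal.span {d i}),
      IsPseudoIso φ := by
  let φ₀ : (ι → R) →ₗ[R] (∀ i, R ⧸ Ideal.span {d i}) :=
    LinearMap.pi fun i => (Ideal.span {d i}).mkQ ∘ₗ LinearMap.proj i ∘ₗ P.mulVecLin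
  have hφ₀ : ∀ x i, φ₀ x i = Submodule.Quotient.mk ((P *ᵥ x) i) := fun _ _ => rfl
  have hle : LinearMap.range B.mulVecLin ≤ LinearMap.ker φ₀ := by
    rintro _ ⟨x, rfl⟩
    rw [LinearMap.mem_ker]
    funext i
    rw [hφ₀, Matrix.mulVecLin_apply, Matrix.mulVec_mulVec, h, ← Matrix.mulVec_mulVec,
      Matrix.mulVec_diagonal, Pi.zero_apply, Submodule.Quotient.mk_eq_zero,
      Ideal.mem_span_singleton]
    exact dvd_mul_right _ _
  refine ⟨Submodule.liftQ _ φ₀ hle, isPseudoIso_of_forall_prime hπ₀ fun π hπ => ?_⟩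
  have hker : ∀ x, B.det • x ∈ LinearMap.range B.mulVecLin := fun x =>
    ⟨B.adjugate *ᵥ x, by
      rw [Matrix.mulVecLin_apply, Matrix.mulVec_mulVec, Matrix.mul_adjugate, Matrix.smul_mulVec,
        Matrix.one_mulVec]⟩
  by_cases hπB : π ∣ B.det
  · refine ⟨Q.det * P.det, fun hdvd => ?_, fun x hx => ?_, fun y => ?_⟩
    · rcases hπ.dvd_or_dvd hdvd with h1 | h1
      · exact hπ.not_isUnit (hQ h1 hπB)
      · exact hπ.not_isUnit (hP h1 hπB)
    · obtain ⟨x, rfl⟩ := Submodule.Quotient.mk_surjective _ x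
      rw [Submodule.liftQ_apply] at hx
      have hy : ∀ i, d i ∣ (P *ᵥ x) i := fun i => by
        rw [← Ideal.mem_span_singleton, ← Submodule.Quotient.mk_eq_zero, ← hφ₀, hx, Pi.zero_apply]
      choose y hy using hy
      have hPx : P *ᵥ x = Matrix.diagonal d *ᵥ y := by
        funext i
        rw [hy, Matrix.mulVec_diagonal]
      have h1 : P *ᵥ (B *ᵥ (Q.adjugate *ᵥ y)) = P *ᵥ (Q.det • x) := by
        rw [Matrix.mulVec_mulVec, h, ← Matrix.mulVec_mulVec, Matrix.mulVec_mulVec _ Q,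
          Matrix.mul_adjugate, Matrix.smul_mulVec, Matrix.one_mulVec, Matrix.mulVec_smul,
          Matrix.mulVec_smul, hPx]
      have h2 : B *ᵥ (Q.adjugate *ᵥ y) = Q.det • x := by
        rw [← sub_eq_zero]
        refine Matrix.eq_zero_of_mulVec_eq_zero hP0 ?_
        rw [Matrix.mulVec_sub, h1, sub_self]
      rw [← Submodule.Quotient.mk_smul, Submodule.Quotient.mk_eq_zero, mul_comm, mul_smul, ← h2]
      exact Submodule.smul_mem _ _ ⟨_, rfl⟩
    · choose z hz using fun i => Submodule.Quotient.mk_surjective _ (y i)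
      refine ⟨Submodule.Quotient.mk (Q.det • (P.adjugate *ᵥ z)), ?_⟩
      rw [Submodule.liftQ_apply]
      funext i
      rw [hφ₀, Matrix.mulVec_smul, Matrix.mulVec_mulVec, Matrix.mul_adjugate, Matrix.smul_mulVec,
        Matrix.one_mulVec, ← mul_smul, Pi.smul_apply, Pi.smul_apply, Submodule.Quotient.mk_smul, hz]
  · refine ⟨B.det, hπB, fun x hx => ?_, fun y => ⟨0, ?_⟩⟩
    · obtain ⟨x, rfl⟩ := Submodule.Quotient.mk_surjective _ x
      rw [← Submodule.Quotient.mk_smul, Submodule.Quotient.mk_eq_zero]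
      exact hker x
    · rw [map_zero]
      funext i
      obtain ⟨z, hz⟩ := Submodule.Quotient.mk_surjective _ (y i)
      rw [Pi.zero_apply, Pi.smul_apply, ← hz, ← Submodule.Quotient.mk_smul, eq_comm,
        Submodule.Quotient.mk_eq_zero, Ideal.mem_span_singleton]
      exact (hd i).mul_right z

/-- `⨁ R/(q^{e_i} g_i) → ⨁ R/(q^{e_i}) ⊕ ⨁ R/(g_i)` is a pseudo-isomorphism for `g_i` prime to the
prime element `q`. -/
lemma exists_isPseudoIso_split {q : R} (hq : Prime q) {ι κ : Type*} [Fintype κ] (σ : κ ≃ ι)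
    (e : κ → ℕ) (g : κ → R) (hg : ∀ k, ¬ q ∣ g k) (d : ι → R)
    (hd : ∀ k, d (σ k) = q ^ e k * g k) :
    ∃ φ : (∀ i, R ⧸ Ideal.span {d i}) →ₗ[R]
        (∀ k, R ⧸ Ideal.span {q ^ e k}) × (∀ k, R ⧸ Ideal.span {g k}), IsPseudoIso φ := by
  have hle1 : ∀ k, Ideal.span {d (σ k)} ≤ Submodule.comap LinearMap.id (Ideal.span {q ^ e k}) :=
    fun k => by
      rw [Submodule.comap_id, Ideal.span_singleton_le_span_singleton, hd]
      exact dvd_mul_right _ _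
  have hle2 : ∀ k, Ideal.span {d (σ k)} ≤ Submodule.comap LinearMap.id (Ideal.span {g k}) :=
    fun k => by
      rw [Submodule.comap_id, Ideal.span_singleton_le_span_singleton, hd]
      exact dvd_mul_left _ _
  let φ : (∀ i, R ⧸ Ideal.span {d i}) →ₗ[R]
        (∀ k, R ⧸ Ideal.span {q ^ e k}) × (∀ k, R ⧸ Ideal.span {g k}) :=
    LinearMap.prod
      (LinearMap.pi fun k => Submodule.mapQ _ _ LinearMap.id (hle1 k) ∘ₗ LinearMap.proj (σ k))
      (LinearMap.pi fun k => Submodule.mapQ _ _ LinearMap.id (hle2 k) ∘ₗ LinearMap.proj (σ k))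
  have hφ1 : ∀ (x : ι → R) k, (φ fun i => Submodule.Quotient.mk (x i)).1 k =
    Submodule.Quotient.mk (x (σ k)) := fun _ _ => rfl
  have hφ2 : ∀ (x : ι → R) k, (φ fun i => Submodule.Quotient.mk (x i)).2 k =
    Submodule.Quotient.mk (x (σ k)) := fun _ _ => rfl
  have hinj : ∀ x, φ x = 0 → x = 0 := by
    intro x hx
    choose z hz using fun i => Submodule.Quotient.mk_surjective _ (x i)
    obtain rfl : (fun i => Submodule.Quotient.mk (z i)) = x := funext hz
    funext i
    obtain ⟨k, rfl⟩ := σ.surjective i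
    have h1 := congrFun (congrArg Prod.fst hx) k
    have h2 := congrFun (congrArg Prod.snd hx) k
    rw [hφ1, Prod.fst_zero, Pi.zero_apply, Submodule.Quotient.mk_eq_zero,
      Ideal.mem_span_singleton] at h1
    rw [hφ2, Prod.snd_zero, Pi.zero_apply, Submodule.Quotient.mk_eq_zero,
      Ideal.mem_span_singleton] at h2
    rw [Pi.zero_apply, Submodule.Quotient.mk_eq_zero, Ideal.mem_span_singleton, hd]
    exact IsRelPrime.mul_dvd ((hq.irreducible.isRelPrime_iff_not_dvd.2 (hg k)).pow_left) h1 h2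
  refine ⟨φ, isPseudoIso_of_forall_prime hq fun π hπ => ?_⟩
  by_cases hπq : π ∣ q
  · have hass := (hπ.dvd_prime_iff_associated hq).1 hπq
    -- At primes associated to `q`, multiplication by `∏ g` kills the second summand, so `∏ g • y`
    -- is hit by lifting only the first component. At other primes `∏ q ^ e` plays the symmetric
    -- role.
    refine ⟨∏ k, g k, fun h => ?_, fun x hx => by rw [hinj x hx, smul_zero], fun y => ?_⟩
    · obtain ⟨k, -, hk⟩ := hπ.exists_mem_finset_dvd h
      exact hg k (hass.symm.dvd.trans hk)
    · choose z hz using fun k => Submodule.Quotient.mk_surjective _ (y.1 k)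
      choose w hw using fun k => Submodule.Quotient.mk_surjective _ (y.2 k)
      refine ⟨fun i => Submodule.Quotient.mk ((∏ k, g k) • z (σ.symm i)),
        Prod.ext (funext fun k => ?_) (funext fun k => ?_)⟩
      · rw [hφ1, σ.symm_apply_apply, Submodule.Quotient.mk_smul, hz]
        rfl
      · rw [hφ2, Prod.smul_snd, Pi.smul_apply, ← hw, ← Submodule.Quotient.mk_smul,
          Submodule.Quotient.eq, Ideal.mem_span_singleton, ← smul_sub]
        exact (Finset.dvd_prod_of_mem g (Finset.mem_univ k)).mul_right _
  · refine ⟨∏ k, q ^ e k, fun h => ?_, fun x hx => by rw [hinj x hx, smul_zero], fun y => ?_⟩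
    · obtain ⟨k, -, hk⟩ := hπ.exists_mem_finset_dvd h
      exact hπq (hπ.dvd_of_dvd_pow hk)
    · choose z hz using fun k => Submodule.Quotient.mk_surjective _ (y.1 k)
      choose w hw using fun k => Submodule.Quotient.mk_surjective _ (y.2 k)
      refine ⟨fun i => Submodule.Quotient.mk ((∏ k, q ^ e k) • w (σ.symm i)),
        Prod.ext (funext fun k => ?_) (funext fun k => ?_)⟩
      · rw [hφ1, Prod.smul_fst, Pi.smul_apply, ← hz, ← Submodule.Quotient.mk_smul,
          Submodule.Quotient.eq, Ideal.mem_span_singleton, ← smul_sub]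
        exact (Finset.dvd_prod_of_mem (fun k => q ^ e k) (Finset.mem_univ k)).mul_right _
      · rw [hφ2, σ.symm_apply_apply, Submodule.Quotient.mk_smul, hw]
        rfl

end Diagonalization

/-- The cokernel of a square matrix with nonzero determinant has characteristic ideal generated by
the determinant. -/
theorem isCharIdeal_coker {p l : ℕ} [Fact p.Prime] {ι : Type*} [Fintype ι] [DecidableEq ι]
    (B : Matrix ι ι (Iwasawa p l)) (hB : B.det ≠ 0) :
    IsCharIdeal p l ((ι → Iwasawa p l) ⧸ LinearMap.range B.mulVecLin) (Ideal.span {B.det}) := by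
  have hp := MvPowerSeries.prime_natCast (Fin l) p
  obtain ⟨P, Q, d, ⟨hP0, hP⟩, ⟨-, hQ⟩, hd, h⟩ := Matrix.exists_diagonal_of_det_ne_zero B hB
  obtain ⟨φ, hφ⟩ := isPseudoIso_of_mul_eq_diagonal_mul hp hP0 hP hQ hd h
  have hd0 : ∀ i, d i ≠ 0 := fun i h0 => hB (zero_dvd_iff.1 (h0 ▸ hd i))
  let σ := (Fintype.equivFin ι).symm
  -- Each `d_i` is split into its power of `p` and a cofactor prime to `p`, as the shape of an
  -- elementary module requires.
  choose e g hg hdeg using fun k => WfDvdMonoid.max_power_factor (hd0 (σ k)) hp.irreducible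
  obtain ⟨ψ, hψ⟩ := exists_isPseudoIso_split hp σ e g hg d hdeg
  refine ⟨_, _, e, g, fun k => (hp.irreducible.isRelPrime_iff_not_dvd.2 (hg k)).symm,
    ⟨ψ ∘ₗ φ, hψ.comp hp hφ⟩, ?_⟩
  rw [Ideal.span_singleton_eq_span_singleton, ← Finset.prod_pow_eq_pow_sum,
    ← Finset.prod_mul_distrib]
  simp only [← hdeg]
  rw [σ.prod_comp d]
  exact (associated_prod_of_mul_eq_diagonal_mul hP hQ hd h).symm

end VoltageIwasawa

/-! ### The finite levels of the Iwasawa algebra. -/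

open scoped MvPowerSeries.WithPiTopology

namespace VoltageIwasawa

variable {p l : ℕ} [Fact p.Prime]

instance neZero_prime_pow (p m : ℕ) [Fact p.Prime] : NeZero (p ^ m) :=
  ⟨pow_ne_zero m (Fact.out : p.Prime).ne_zero⟩

/-- The finite level `Λ → ℤ_p[(ℤ/p^m)^l]` of the Iwasawa algebra. -/
noncomputable def levelEval (p l m : ℕ) [Fact p.Prime] :
    Iwasawa p l →ₐ[ℤ_[p]] MonoidAlgebra ℤ_[p] (Multiplicative (Fin l → ZMod (p ^ m))) :=
  evalGroupRing (Multigraph.levelGen p l m) (Multigraph.levelGen_pow p l m)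

section

attribute [local instance] groupRingUniformSpace

lemma continuous_levelEval_coeff (m : ℕ) (h : Multiplicative (Fin l → ZMod (p ^ m))) :
    Continuous fun F : Iwasawa p l => (levelEval p l m F).coeff h := by
  let H := Multiplicative (Fin l → ZMod (p ^ m))
  have := isUniformAddGroup_groupRing (p := p) (H := H)
  have := isTopologicalRing_groupRing (p := p) (H := H)
  have := isLinearTopology_groupRing (p := p) (H := H)
  have := completeSpace_groupRing (p := p) (H := H)
  have := t2Space_groupRing (p := p) (H := H)
  have := continuousSMul_groupRing (p := p) (H := H)
  exact (continuous_coeff h).comp (MvPowerSeries.continuous_aeval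
    (hasEval_groupRing (Multigraph.levelGen_pow p l m)))

end

lemma levelEval_X (m : ℕ) (i : Fin l) : levelEval p l m (MvPowerSeries.X i) =
    MonoidAlgebra.of ℤ_[p] _ (Multigraph.levelGen p l m i) - 1 :=
  evalGroupRing_X _ _ _

omit [Fact p.Prime] in
lemma prod_levelGen_pow (m : ℕ) (a : Fin l → ℕ) :
    ∏ i, Multigraph.levelGen p l m i ^ a i = Multiplicative.ofAdd fun i => (a i : ZMod (p ^ m)) := by
  apply Multiplicative.toAdd.injective
  funext j
  rw [toAdd_prod, Finset.sum_apply, Finset.sum_eq_single j]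
  · simp [Multigraph.levelGen]
  · intro i _ hij
    simp [Multigraph.levelGen, Pi.single_eq_of_ne hij.symm]
  · simp

lemma levelEval_prod_one_add_X_pow (m : ℕ) (a : Fin l → ℕ) :
    levelEval p l m (∏ i, (1 + MvPowerSeries.X i) ^ a i) =
      MonoidAlgebra.of ℤ_[p] _ (Multiplicative.ofAdd fun i => (a i : ZMod (p ^ m))) := by
  rw [← prod_levelGen_pow, map_prod, map_prod]
  refine Finset.prod_congr rfl fun i _ => ?_
  rw [map_pow, map_add, map_one, levelEval_X, add_sub_cancel, map_pow]

section GroupElem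

lemma continuous_groupElem :
    Continuous fun a : Fin l → ℤ_[p] => groupElem p l (Multiplicative.ofAdd a) := by
  change Continuous fun a : Fin l → ℤ_[p] => ∏ i : Fin l, (MvPowerSeries.rename (fun _ : Unit => i)
    (PowerSeries.binomialSeries ℤ_[p] (a i)) : Iwasawa p l)
  refine continuous_finsetProd _ fun i _ => continuous_pi fun d => ?_
  change Continuous fun a : Fin l → ℤ_[p] => MvPowerSeries.coeff d
    (MvPowerSeries.rename (fun _ : Unit => i) (PowerSeries.binomialSeries ℤ_[p] (a i)))
  simp only [MvPowerSeries.coeff_rename]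
  refine continuous_finsetSum _ fun x _ => ?_
  obtain ⟨n, rfl⟩ : ∃ n, x = Finsupp.single () n := ⟨x (), by ext; simp⟩
  have : ∀ a : Fin l → ℤ_[p], MvPowerSeries.coeff (Finsupp.single () n)
      (PowerSeries.binomialSeries ℤ_[p] (a i)) = Ring.choose (a i) n := fun a => by
    rw [← PowerSeries.coeff_def rfl, PowerSeries.binomialSeries_coeff, smul_eq_mul, mul_one,
      Finsupp.single_eq_same]
  simp only [this]
  exact (PadicInt.continuous_choose n).comp (continuous_apply i)

lemma groupElem_natCast (a : Fin l → ℕ) :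
    groupElem p l (Multiplicative.ofAdd fun i => (a i : ℤ_[p])) =
      ∏ i, (1 + MvPowerSeries.X i) ^ a i := by
  change ∏ i : Fin l, (MvPowerSeries.rename (fun _ : Unit => i)
    (PowerSeries.binomialSeries ℤ_[p] (a i : ℤ_[p])) : Iwasawa p l) = _
  refine Finset.prod_congr rfl fun i _ => ?_
  rw [PowerSeries.binomialSeries_nat, map_pow, map_add, map_one]
  congr 2
  exact MvPowerSeries.rename_X _ _

lemma continuous_toZModPow (m : ℕ) : Continuous (PadicInt.toZModPow m : ℤ_[p] → ZMod (p ^ m)) := by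
  refine continuous_of_continuousAt_zero (PadicInt.toZModPow m) ?_
  rw [ContinuousAt, map_zero, nhds_discrete (ZMod (p ^ m)), Filter.tendsto_pure]
  have hp : (0 : ℝ) < p := by exact_mod_cast (Fact.out : p.Prime).pos
  filter_upwards [Metric.ball_mem_nhds (0 : ℤ_[p]) (zpow_pos hp (-(m : ℤ)))] with x hx
  rw [mem_ball_zero_iff] at hx
  rw [← RingHom.mem_ker, PadicInt.ker_toZModPow, ← PadicInt.norm_le_pow_iff_mem_span_pow]
  exact hx.le

/-- Both sides depend continuously on `a`, and on the dense subset of natural exponents the binomial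
series are honest powers of `1 + T_i`. -/
lemma levelEval_groupElem (m : ℕ) (a : Fin l → ℤ_[p]) :
    levelEval p l m (groupElem p l (Multiplicative.ofAdd a)) =
      MonoidAlgebra.of ℤ_[p] _ (Multiplicative.ofAdd fun i => PadicInt.toZModPow m (a i)) := by
  classical
  ext h
  have hc : Continuous fun a : Fin l → ℤ_[p] =>
      (levelEval p l m (groupElem p l (Multiplicative.ofAdd a))).coeff h :=
    (continuous_levelEval_coeff m h).comp continuous_groupElem
  have hmod : Continuous fun (a : Fin l → ℤ_[p]) (i : Fin l) => PadicInt.toZModPow m (a i) :=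
    continuous_pi fun i => (continuous_toZModPow m).comp (continuous_apply i)
  have hd : Continuous fun a : Fin l → ℤ_[p] => (MonoidAlgebra.of ℤ_[p]
      (Multiplicative (Fin l → ZMod (p ^ m)))
      (Multiplicative.ofAdd fun i => PadicInt.toZModPow m (a i))).coeff h :=
    (continuous_of_discreteTopology (f := fun g : Fin l → ZMod (p ^ m) =>
      (MonoidAlgebra.of ℤ_[p] (Multiplicative (Fin l → ZMod (p ^ m)))
        (Multiplicative.ofAdd g)).coeff h)).comp hmod
  have hdense : DenseRange (Pi.map fun _ : Fin l => (Nat.cast : ℕ → ℤ_[p])) :=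
    DenseRange.piMap fun _ => PadicInt.denseRange_natCast
  refine congrFun (hdense.equalizer hc hd (funext fun a => ?_)) a
  change (levelEval p l m (groupElem p l (Multiplicative.ofAdd fun i => (a i : ℤ_[p])))).coeff h =
    (MonoidAlgebra.of ℤ_[p] _ (Multiplicative.ofAdd fun i => PadicInt.toZModPow m (a i))).coeff h
  rw [groupElem_natCast, levelEval_prod_one_add_X_pow]
  simp only [map_natCast]

lemma levelEval_surjective (m : ℕ) : Function.Surjective (levelEval p l m) := by
  intro x
  induction x using MonoidAlgebra.induction_on with
  | of g =>
    refine ⟨∏ i, (1 + MvPowerSeries.X i) ^ (g.toAdd i).val, ?_⟩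
    rw [levelEval_prod_one_add_X_pow]
    congr 1
    apply Multiplicative.toAdd.injective
    funext i
    exact ZMod.natCast_zmod_val _
  | add x y hx hy =>
    obtain ⟨a, rfl⟩ := hx
    obtain ⟨b, rfl⟩ := hy
    exact ⟨a + b, map_add _ _ _⟩
  | smul c x hx =>
    obtain ⟨a, rfl⟩ := hx
    exact ⟨c • a, map_smul _ _ _⟩

end GroupElem

/-! ### Joint injectivity of the finite levels. -/

section Injectivity

/-- The substitution `X_i ↦ 1 + X_i` is surjective, so the products of powers of `1 + X_i`, which
are the group elements inside `Λ`, span the polynomials. -/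
lemma MvPolynomial.induction_on_one_add_X {σ R : Type*} [CommRing R] {M : MvPolynomial σ R → Prop}
    (h1 : ∀ d : σ →₀ ℕ, M (d.prod fun i n => (1 + MvPolynomial.X i) ^ n))
    (h2 : ∀ P Q, M P → M Q → M (P + Q)) (h3 : ∀ (c : R) P, M P → M (c • P))
    (P : MvPolynomial σ R) : M P := by
  obtain ⟨Q, rfl⟩ : ∃ Q : MvPolynomial σ R,
      MvPolynomial.aeval (fun i => 1 + MvPolynomial.X i) Q = P := by
    refine ⟨MvPolynomial.aeval (fun i => (MvPolynomial.X i - 1 : MvPolynomial σ R)) P, ?_⟩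
    have : (MvPolynomial.aeval (fun i => 1 + MvPolynomial.X i)).comp
        (MvPolynomial.aeval (fun i => (MvPolynomial.X i - 1 : MvPolynomial σ R))) =
        AlgHom.id R (MvPolynomial σ R) := by
      ext i : 1
      simp
    exact DFunLike.congr_fun this P
  induction Q using MvPolynomial.induction_on' with
  | monomial d c =>
    rw [MvPolynomial.aeval_monomial, ← Algebra.smul_def]
    exact h3 _ _ (h1 d)
  | add P Q hP hQ => rw [map_add]; exact h2 _ _ hP hQ

lemma coeff_prod_one_add_X_pow (R : Type*) [CommRing R] (a : Fin l → ℕ) (d : Fin l →₀ ℕ) :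
    MvPowerSeries.coeff d (∏ i, (1 + MvPowerSeries.X i) ^ a i : MvPowerSeries (Fin l) R) =
      ∏ i, ((a i).choose (d i) : R) := by
  classical
  have h1 : ∀ i, (1 + MvPowerSeries.X i : MvPowerSeries (Fin l) R) ^ a i =
      ∑ j ∈ Finset.range (a i + 1), MvPowerSeries.X i ^ j * ((a i).choose j : MvPowerSeries (Fin l) R) := by
    intro i
    rw [add_comm, add_pow]
    simp
  have h2 : ∀ x : Fin l → ℕ, (∏ i, MvPowerSeries.X i ^ x i * ((a i).choose (x i) :
      MvPowerSeries (Fin l) R)) = MvPowerSeries.monomial (Finsupp.equivFunOnFinite.symm x)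
        (∏ i, ((a i).choose (x i) : R)) := by
    intro x
    rw [Finset.prod_mul_distrib, MvPowerSeries.monomial_eq', Finsupp.prod_fintype _ _ (by simp),
      mul_comm, map_prod]
    simp
  simp only [h1, Finset.prod_univ_sum, h2, map_sum, MvPowerSeries.coeff_monomial]
  by_cases hd : ∀ i, d i ≤ a i
  · rw [Finset.sum_eq_single (d : Fin l → ℕ)]
    · simp
    · intro x _ hx
      rw [if_neg]
      rintro rfl
      exact hx (by simp)
    · intro h
      simp only [Fintype.mem_piFinset, Finset.mem_range, not_forall] at h
      obtain ⟨i, hi⟩ := h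
      have := hd i
      omega
  · push Not at hd
    obtain ⟨i, hi⟩ := hd
    rw [Finset.prod_eq_zero (Finset.mem_univ i) (by rw [Nat.choose_eq_zero_of_lt hi, Nat.cast_zero])]
    refine Finset.sum_eq_zero fun x hx => if_neg ?_
    rintro rfl
    have := Fintype.mem_piFinset.1 hx i
    simp only [Finset.mem_range, Finsupp.equivFunOnFinite_symm_apply_apply] at this hi
    omega

/-- The coefficients of `F` are approximated by the binomial moments of its finite levels. -/
lemma toZModPow_sum_descFactorial (m : ℕ) (d : Fin l →₀ ℕ) (F : Iwasawa p l) :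
    PadicInt.toZModPow m (∑ g : Fin l → ZMod (p ^ m),
        (levelEval p l m F).coeff (Multiplicative.ofAdd g) *
          ∏ i, ((g i).val.descFactorial (d i) : ℤ_[p])) =
      PadicInt.toZModPow m ((∏ i, ((d i).factorial : ℤ_[p])) * MvPowerSeries.coeff d F) := by
  classical
  have hcl := isClosed_eq
    ((continuous_toZModPow (p := p) m).comp (continuous_finsetSum Finset.univ
      fun (g : Fin l → ZMod (p ^ m)) _ => (continuous_levelEval_coeff m (Multiplicative.ofAdd g)).mul
        (continuous_const (y := ∏ i, ((g i).val.descFactorial (d i) : ℤ_[p])))))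
    ((continuous_toZModPow (p := p) m).comp
      ((continuous_const (y := ∏ i, ((d i).factorial : ℤ_[p]))).mul
        (MvPowerSeries.WithPiTopology.continuous_coeff _ d)))
  have hadd : ∀ (F G : Iwasawa p l) g, (levelEval p l m (F + G)).coeff g =
      (levelEval p l m F).coeff g + (levelEval p l m G).coeff g := fun F G g => by
    rw [map_add]
    rfl
  have hsmul : ∀ c (F : Iwasawa p l) g, (levelEval p l m (c • F)).coeff g =
      c * (levelEval p l m F).coeff g := fun c F g => by
    rw [map_smul]
    rfl
  -- Both sides are additive, compatible with scalars and continuous in `F`, so the products of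
  -- powers of `1 + T_i` suffice.
  refine MvPowerSeries.WithPiTopology.denseRange_toMvPowerSeries.induction_on F hcl fun P => ?_
  induction P using MvPolynomial.induction_on_one_add_X with
  | h1 a =>
    have hP : ((a.prod fun i n => (1 + MvPolynomial.X i) ^ n : MvPolynomial (Fin l) ℤ_[p]) :
        MvPowerSeries (Fin l) ℤ_[p]) = ∏ i, (1 + MvPowerSeries.X i) ^ a i := by
      rw [Finsupp.prod_fintype _ _ (by simp)]
      change MvPolynomial.coeToMvPowerSeries.ringHom _ = _
      rw [map_prod]
      simp
    rw [hP, levelEval_prod_one_add_X_pow, coeff_prod_one_add_X_pow,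
      Finset.sum_eq_single fun i => (a i : ZMod (p ^ m))]
    · rw [← Finset.prod_mul_distrib]
      simp only [MonoidAlgebra.of_apply, MonoidAlgebra.coeff_single, Finsupp.single_eq_same, one_mul,
        map_prod, map_mul, map_natCast]
      refine Finset.prod_congr rfl fun i _ => ?_
      -- The descending factorial is an integral polynomial, so modulo `p ^ m` it depends only on
      -- the residue of `a i`. Binomial coefficients lack this property, hence the factor `∏ (d
      -- i)!`.
      rw [← descPochhammer_eval_eq_descFactorial, ZMod.natCast_zmod_val,
        descPochhammer_eval_eq_descFactorial, Nat.descFactorial_eq_factorial_mul_choose]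
      push_cast
      rfl
    · intro g _ hg
      rw [MonoidAlgebra.of_apply, MonoidAlgebra.coeff_single, Finsupp.single_eq_of_ne, zero_mul]
      exact fun h => hg (Multiplicative.ofAdd.injective h)
    · simp
  | h2 P Q hP hQ =>
    rw [MvPolynomial.coe_add]
    simp only [hadd, add_mul, Finset.sum_add_distrib]
    rw [map_add, hP, hQ, ← map_add, ← mul_add, map_add]
  | h3 c P hP =>
    rw [MvPolynomial.coe_smul]
    simp only [hsmul, mul_assoc]
    rw [← Finset.mul_sum, map_mul, hP, ← map_mul, map_smul, smul_eq_mul, mul_left_comm]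

/-- Each coefficient times `∏ (d i)!` is zero modulo all `p ^ m`, and the factorials are nonzero in
`ℤ_p`. -/
lemma eq_zero_of_forall_levelEval_eq_zero {F : Iwasawa p l} (h : ∀ m, levelEval p l m F = 0) :
    F = 0 := by
  ext d
  have h1 : (∏ i, ((d i).factorial : ℤ_[p])) * MvPowerSeries.coeff d F = 0 := by
    refine PadicInt.ext_of_toZModPow.1 fun m => ?_
    rw [← toZModPow_sum_descFactorial, h]
    simp
  refine (mul_eq_zero.1 h1).resolve_left ?_
  exact Finset.prod_ne_zero_iff.2 fun i _ => by exact_mod_cast (d i).factorial_ne_zero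

end Injectivity

end VoltageIwasawa

/-! ### Divisors on derived graphs as vectors over the group ring. -/

open Matrix

namespace VoltageIwasawa

namespace Multigraph

section GroupRingDivisors

variable (p : ℕ) [Fact p.Prime] {V G' G : Type*} [Finite V] [AddCommGroup G'] [AddCommGroup G]

/-- Divisors on `V × G` as vectors over the group ring of `G`. -/
noncomputable def divEquiv (V G : Type*) [Finite V] [AddCommGroup G] :
    (V × G →₀ ℤ_[p]) ≃ₗ[ℤ_[p]] (V → MonoidAlgebra ℤ_[p] (Multiplicative G)) :=
  (Finsupp.curryLinearEquiv ℤ_[p]).trans <|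
    (Finsupp.linearEquivFunOnFinite ℤ_[p] (G →₀ ℤ_[p]) V).trans <|
      LinearEquiv.piCongrRight fun _ => (Finsupp.domLCongr Multiplicative.ofAdd).trans
        (MonoidAlgebra.coeffLinearEquiv ℤ_[p]).symm

variable {p}

lemma divEquiv_apply_coeff (d : V × G →₀ ℤ_[p]) (v : V) (g : G) :
    (divEquiv p V G d v).coeff (Multiplicative.ofAdd g) = d (v, g) := rfl

lemma divEquiv_single [DecidableEq V] (v : V) (g : G) (c : ℤ_[p]) :
    divEquiv p V G (Finsupp.single (v, g) c) =
      Pi.single v (MonoidAlgebra.single (Multiplicative.ofAdd g) c) := by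
  classical
  funext w
  ext h
  refine (divEquiv_apply_coeff _ w h.toAdd).trans ?_
  rw [Finsupp.single_apply]
  rcases eq_or_ne w v with rfl | hw
  · rw [Pi.single_eq_same, MonoidAlgebra.coeff_single, Finsupp.single_apply]
    exact if_congr (by rw [Prod.mk_inj]; exact ⟨fun h => h.2 ▸ rfl, fun h => ⟨rfl, h ▸ rfl⟩⟩) rfl rfl
  · rw [Pi.single_eq_of_ne hw, if_neg (fun h => hw (congrArg Prod.fst h).symm)]
    rfl

lemma divEquiv_lmapDomain_add (c : G) (d : V × G →₀ ℤ_[p]) :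
    divEquiv p V G (Finsupp.lmapDomain ℤ_[p] ℤ_[p] (fun v => (v.1, v.2 + c)) d) =
      MonoidAlgebra.of ℤ_[p] _ (Multiplicative.ofAdd c) • divEquiv p V G d := by
  classical
  induction d using Finsupp.induction_linear with
  | zero => simp
  | add a b ha hb => rw [map_add, map_add, map_add, smul_add, ha, hb]
  | single x r =>
    obtain ⟨v, g⟩ := x
    rw [Finsupp.lmapDomain_apply, Finsupp.mapDomain_single, divEquiv_single, divEquiv_single,
      ← Pi.single_smul, smul_eq_mul, MonoidAlgebra.of_apply, MonoidAlgebra.single_mul_single,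
      one_mul, add_comm, ofAdd_add]

lemma divEquiv_lmapDomain_map (φ : G →+ G') (d : V × G →₀ ℤ_[p]) (v : V) :
    divEquiv p V G' (Finsupp.lmapDomain ℤ_[p] ℤ_[p] (fun v => (v.1, φ v.2 + 0)) d) v =
      MonoidAlgebra.lift ℤ_[p] (MonoidAlgebra ℤ_[p] (Multiplicative G')) (Multiplicative G)
        ((MonoidAlgebra.of ℤ_[p] (Multiplicative G')).comp (AddMonoidHom.toMultiplicative φ))
        (divEquiv p V G d v) := by
  classical
  induction d using Finsupp.induction_linear with
  | zero => simp
  | add a b ha hb => rw [map_add, map_add, map_add, Pi.add_apply, Pi.add_apply, map_add, ha, hb]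
  | single x r =>
    obtain ⟨w, g⟩ := x
    rw [Finsupp.lmapDomain_apply, Finsupp.mapDomain_single, divEquiv_single, divEquiv_single]
    rcases eq_or_ne v w with rfl | hw
    · rw [Pi.single_eq_same, Pi.single_eq_same, MonoidAlgebra.lift_single, add_zero]
      simp
    · rw [Pi.single_eq_of_ne hw, Pi.single_eq_of_ne hw, map_zero]

/-- The augmentation of the group ring. -/
noncomputable def augmentation (p : ℕ) [Fact p.Prime] (H : Type*) [Monoid H] :
    MonoidAlgebra ℤ_[p] H →ₐ[ℤ_[p]] ℤ_[p] :=
  MonoidAlgebra.lift ℤ_[p] ℤ_[p] H 1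

lemma augmentation_single {H : Type*} [Monoid H] (h : H) (c : ℤ_[p]) :
    augmentation p H (MonoidAlgebra.single h c) = c := by
  rw [augmentation, MonoidAlgebra.lift_single]
  simp

lemma sum_augmentation_divEquiv [Fintype V] (d : V × G →₀ ℤ_[p]) :
    ∑ v, augmentation p (Multiplicative G) (divEquiv p V G d v) =
      Finsupp.linearCombination ℤ_[p] (fun _ : V × G => (1 : ℤ_[p])) d := by
  classical
  induction d using Finsupp.induction_linear with
  | zero => simp
  | add a b ha hb =>
    rw [map_add, map_add, ← ha, ← hb, ← Finset.sum_add_distrib]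
    exact Finset.sum_congr rfl fun v _ => by rw [Pi.add_apply, map_add]
  | single x r =>
    obtain ⟨w, g⟩ := x
    rw [divEquiv_single, Finset.sum_eq_single w, Pi.single_eq_same, augmentation_single,
      Finsupp.linearCombination_single, smul_eq_mul, mul_one]
    · intro v _ hv
      rw [Pi.single_eq_of_ne hv, map_zero]
    · simp

end GroupRingDivisors

section GroupLaplacian

variable {p : ℕ} [Fact p.Prime] {V E G : Type*} [Fintype V] [DecidableEq V] [Fintype E]
  [AddCommGroup G]

/-- The voltage Laplacian of a voltage assignment with values in `G`, over the group ring of `G`. -/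
noncomputable def groupLaplacian (p : ℕ) [Fact p.Prime] (X : Multigraph V E) (β : E → G) :
    Matrix V V (MonoidAlgebra ℤ_[p] (Multiplicative G)) :=
  Matrix.diagonal (fun v => (X.degree v : MonoidAlgebra ℤ_[p] (Multiplicative G))) - Matrix.of fun v w =>
    ((∑ e : E, if X.src e = v ∧ X.tgt e = w then
        MonoidAlgebra.of ℤ_[p] _ (Multiplicative.ofAdd (β e)) else 0) +
      ∑ e : E, if X.tgt e = v ∧ X.src e = w then
        MonoidAlgebra.of ℤ_[p] _ (Multiplicative.ofAdd (-β e)) else 0)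

/-- The edges of the derived graph with a given source. -/
def derivedSrcEquiv (X : Multigraph V E) (β : E → G) (v : V) (g : G) :
    {e // X.src e = v} ≃ {e // (X.derived β).src e = (v, g)} where
  toFun e := ⟨(e.1, g), Prod.ext e.2 rfl⟩
  invFun e := ⟨e.1.1, congrArg Prod.fst e.2⟩
  left_inv _ := rfl
  right_inv e := Subtype.ext (Prod.ext rfl (congrArg Prod.snd e.2).symm)

/-- The edges of the derived graph with a given target. -/
def derivedTgtEquiv (X : Multigraph V E) (β : E → G) (v : V) (g : G) :
    {e // X.tgt e = v} ≃ {e // (X.derived β).tgt e = (v, g)} where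
  toFun e := ⟨(e.1, g - β e.1), Prod.ext e.2 (sub_add_cancel _ _)⟩
  invFun e := ⟨e.1.1, congrArg Prod.fst e.2⟩
  left_inv _ := rfl
  right_inv e := Subtype.ext (Prod.ext rfl (sub_eq_of_eq_add (congrArg Prod.snd e.2).symm))

lemma finsum_subtype_eq_sum_ite {M : Type*} [AddCommMonoid M] (P : E → Prop) [DecidablePred P]
    (f : E → M) : ∑ᶠ e : {e // P e}, f e = ∑ e, if P e then f e else 0 := by
  rw [finsum_eq_sum_of_fintype, ← Finset.sum_filter]
  exact (Finset.sum_subtype (Finset.univ.filter P) (by simp) f).symm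

omit [Fintype V] in
lemma derived_principal (X : Multigraph V E) (β : E → G) (v : V) (g : G) :
    (X.derived β).principal p (v, g) = (X.degree v : ℤ_[p]) • Finsupp.single (v, g) 1
      - (∑ e, if X.src e = v then Finsupp.single (X.tgt e, g + β e) 1 else 0)
      - ∑ e, if X.tgt e = v then Finsupp.single (X.src e, g - β e) 1 else 0 := by
  have hs : ∑ᶠ e : {e // (X.derived β).src e = (v, g)},
      Finsupp.single ((X.derived β).tgt e) (1 : ℤ_[p]) =
      ∑ᶠ e : {e // X.src e = v}, Finsupp.single (X.tgt e, g + β e) (1 : ℤ_[p]) :=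
    (finsum_eq_of_bijective _ (X.derivedSrcEquiv β v g).bijective fun _ => rfl).symm
  have ht : ∑ᶠ e : {e // (X.derived β).tgt e = (v, g)},
      Finsupp.single ((X.derived β).src e) (1 : ℤ_[p]) =
      ∑ᶠ e : {e // X.tgt e = v}, Finsupp.single (X.src e, g - β e) (1 : ℤ_[p]) :=
    (finsum_eq_of_bijective _ (X.derivedTgtEquiv β v g).bijective fun _ => rfl).symm
  have hd : (X.derived β).degree (v, g) = X.degree v := by
    rw [degree, degree, Nat.card_congr (X.derivedSrcEquiv β v g),
      Nat.card_congr (X.derivedTgtEquiv β v g)]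
  rw [principal, hs, ht, hd, finsum_subtype_eq_sum_ite (fun e => X.src e = v)
    (fun e => Finsupp.single (X.tgt e, g + β e) (1 : ℤ_[p])),
    finsum_subtype_eq_sum_ite (fun e => X.tgt e = v)
    (fun e => Finsupp.single (X.src e, g - β e) (1 : ℤ_[p]))]

/-- The principal divisor at `(v, g)` is the translate by `g` of the row of the Laplacian at `v`;
edges run backwards contribute the inverse voltage. -/
lemma divEquiv_principal (X : Multigraph V E) (β : E → G) (v : V) (g : G) :
    divEquiv p V G ((X.derived β).principal p (v, g)) =
      divEquiv p V G (Finsupp.single (v, g) 1) ᵥ* X.groupLaplacian p β := by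
  have h1 : ∀ (P : E → Prop) [DecidablePred P] (f : E → V × G) (w : V),
      divEquiv p V G (∑ e, if P e then Finsupp.single (f e) 1 else 0) w =
        ∑ e, if P e ∧ (f e).1 = w then
          MonoidAlgebra.single (Multiplicative.ofAdd (f e).2) (1 : ℤ_[p]) else 0 := by
    intro P _ f w
    rw [map_sum, Finset.sum_apply]
    refine Finset.sum_congr rfl fun e _ => ?_
    split_ifs with h1 h2 h2
    · rw [← h2.2, ← Prod.mk.eta (p := f e), divEquiv_single, Pi.single_eq_same]
    · rw [← Prod.mk.eta (p := f e), divEquiv_single, Pi.single_eq_of_ne]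
      exact fun h => h2 ⟨h1, h.symm⟩
    · exact absurd h2.1 h1
    · rw [map_zero, Pi.zero_apply]
  funext w
  rw [derived_principal, map_sub, map_sub, Pi.sub_apply, Pi.sub_apply, h1, h1, map_smul,
    divEquiv_single, Matrix.single_vecMul, groupLaplacian]
  simp only [Pi.smul_apply, Matrix.row, Matrix.sub_apply, Matrix.of_apply, smul_eq_mul, mul_sub, mul_add,
    Finset.mul_sum, mul_ite, mul_zero, MonoidAlgebra.of_apply, MonoidAlgebra.single_mul_single,
    one_mul, ← ofAdd_add, ← sub_eq_add_neg, sub_sub]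
  congr 1
  rcases eq_or_ne w v with rfl | hw
  · rw [Pi.single_eq_same, Matrix.diagonal_apply_eq, ← nsmul_eq_mul', Nat.cast_smul_eq_nsmul]
  · rw [Pi.single_eq_of_ne hw, Matrix.diagonal_apply_ne _ hw.symm, smul_zero, mul_zero]

lemma divEquiv_linearCombination_principal (X : Multigraph V E) (β : E → G) (d : V × G →₀ ℤ_[p]) :
    divEquiv p V G (Finsupp.linearCombination ℤ_[p] ((X.derived β).principal p) d) =
      divEquiv p V G d ᵥ* X.groupLaplacian p β := by
  induction d using Finsupp.induction_linear with
  | zero => simp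
  | add a b ha hb => rw [map_add, map_add, map_add, Matrix.add_vecMul, ha, hb]
  | single x r =>
    obtain ⟨v, g⟩ := x
    rw [Finsupp.linearCombination_single, map_smul, divEquiv_principal, ← Matrix.smul_vecMul,
      ← map_smul, Finsupp.smul_single, smul_eq_mul, mul_one]

lemma mem_Pr_derived_iff (X : Multigraph V E) (β : E → G) (d : V × G →₀ ℤ_[p]) :
    d ∈ (X.derived β).Pr p ↔ ∃ c, divEquiv p V G d = c ᵥ* X.groupLaplacian p β := by
  rw [Pr, ← Finsupp.range_linearCombination, LinearMap.mem_range]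
  constructor
  · rintro ⟨c, rfl⟩
    exact ⟨_, X.divEquiv_linearCombination_principal β c⟩
  · rintro ⟨c, hc⟩
    refine ⟨(divEquiv p V G).symm c, (divEquiv p V G).injective ?_⟩
    rw [divEquiv_linearCombination_principal, LinearEquiv.apply_symm_apply, hc]

omit [DecidableEq V] [Fintype E] in
lemma mem_Div0_derived_iff (X : Multigraph V E) (β : E → G) (d : V × G →₀ ℤ_[p]) :
    d ∈ (X.derived β).Div0 p ↔ ∑ v, augmentation p (Multiplicative G) (divEquiv p V G d v) = 0 := by
  rw [Div0, LinearMap.mem_ker, sum_augmentation_divEquiv]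

variable (p V G) in
/-- Vectors over the group ring of total degree zero. -/
noncomputable def degZero :
    Submodule (MonoidAlgebra ℤ_[p] (Multiplicative G))
      (V → MonoidAlgebra ℤ_[p] (Multiplicative G)) where
  carrier := {z | ∑ v, augmentation p (Multiplicative G) (z v) = 0}
  zero_mem' := by simp
  add_mem' {a b} ha hb := by
    simp only [Set.mem_ofPred_eq, Pi.add_apply, map_add, Finset.sum_add_distrib] at *
    rw [ha, hb, add_zero]
  smul_mem' r z hz := by
    simp only [Set.mem_ofPred_eq, Pi.smul_apply, smul_eq_mul, map_mul, ← Finset.mul_sum] at *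
    rw [hz, mul_zero]

omit [DecidableEq V] in
lemma mem_degZero {z : V → MonoidAlgebra ℤ_[p] (Multiplicative G)} :
    z ∈ degZero p V G ↔ ∑ v, augmentation p (Multiplicative G) (z v) = 0 := Iff.rfl

omit [DecidableEq V] [Fintype E] in
lemma symm_mem_Div0 (X : Multigraph V E) (β : E → G)
    (z : degZero p V G) :
    (divEquiv p V G).symm z ∈ (X.derived β).Div0 p := by
  rw [mem_Div0_derived_iff, LinearEquiv.apply_symm_apply]
  exact z.2

/-- The class of a divisor of degree zero. -/
noncomputable def Jac.mk (Y : Multigraph V E) (p : ℕ) [Fact p.Prime] : Y.Div0 p →ₗ[ℤ_[p]] Y.Jac p where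
  toFun := Submodule.Quotient.mk
  map_add' _ _ := rfl
  map_smul' _ _ := rfl

/-- The class in `J(X(G, S, β))` of a vector of total degree zero. -/
noncomputable def jacOf (p : ℕ) [Fact p.Prime] (X : Multigraph V E) (β : E → G) :
    degZero p V G →ₗ[ℤ_[p]] (X.derived β).Jac p :=
  Jac.mk _ p ∘ₗ LinearMap.codRestrict ((X.derived β).Div0 p)
    ((divEquiv p V G).symm.toLinearMap ∘ₗ (degZero p V G).subtype.restrictScalars ℤ_[p])
    (X.symm_mem_Div0 β)

omit [DecidableEq V] [Fintype E] in
lemma jacOf_surjective (X : Multigraph V E) (β : E → G) : Function.Surjective (X.jacOf p β) := by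
  intro x
  obtain ⟨d, rfl⟩ := Submodule.Quotient.mk_surjective _ x
  refine ⟨⟨divEquiv p V G d, (X.mem_Div0_derived_iff β _).1 d.2⟩, ?_⟩
  change Jac.mk _ p _ = Jac.mk _ p d
  congr 1
  exact Subtype.ext ((divEquiv p V G).symm_apply_apply _)

lemma jacOf_eq_zero_iff (X : Multigraph V E) (β : E → G) (z : degZero p V G) :
    X.jacOf p β z = 0 ↔ ∃ c, (z : V → _) = c ᵥ* X.groupLaplacian p β := by
  refine (Submodule.Quotient.mk_eq_zero _).trans ?_
  change (divEquiv p V G).symm z ∈ (X.derived β).Pr p ↔ _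
  rw [mem_Pr_derived_iff, LinearEquiv.apply_symm_apply]

omit [DecidableEq V] [Fintype E] in
lemma jacOf_smul (X : Multigraph V E) (β : E → G)
    (r : MonoidAlgebra ℤ_[p] (Multiplicative G)) (z : degZero p V G) :
    X.jacOf p β (r • z) = (X.deckAction p β).asAlgebraHom r (X.jacOf p β z) := by
  induction r using MonoidAlgebra.induction_on with
  | of g =>
    rw [Representation.asAlgebraHom_of]
    change Jac.mk _ p _ = Jac.mk _ p _
    congr 1
    refine Subtype.ext ((divEquiv p V G).symm_apply_eq.2 ?_)
    refine Eq.trans ?_ (divEquiv_lmapDomain_add g.toAdd ((divEquiv p V G).symm z)).symm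
    rw [LinearEquiv.apply_symm_apply]
    rfl
  | add a b ha hb => rw [add_smul, map_add, map_add, LinearMap.add_apply, ha, hb]
  | smul c a ha => rw [smul_assoc, (X.jacOf p β).map_smul, ha, map_smul]; rfl

/-- `jacOf` as a linear map over the group ring. -/
noncomputable def jacOfLinear (p : ℕ) [Fact p.Prime] (X : Multigraph V E) (β : E → G) :
    degZero p V G →ₗ[MonoidAlgebra ℤ_[p] (Multiplicative G)] (X.deckAction p β).asModule where
  toFun z := (X.deckAction p β).asModuleEquiv.symm (X.jacOf p β z)
  map_add' y z := by rw [map_add, map_add]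
  map_smul' r z := by
    rw [RingHom.id_apply, LinearEquiv.symm_apply_eq, Representation.asModuleEquiv_map_smul,
      LinearEquiv.apply_symm_apply, jacOf_smul]

omit [DecidableEq V] [Fintype E] in
lemma jacOfLinear_surjective (X : Multigraph V E) (β : E → G) :
    Function.Surjective (X.jacOfLinear p β) :=
  (X.deckAction p β).asModuleEquiv.symm.surjective.comp (X.jacOf_surjective β)

lemma jacOfLinear_eq_zero_iff (X : Multigraph V E) (β : E → G) (z : degZero p V G) :
    X.jacOfLinear p β z = 0 ↔ ∃ c, (z : V → _) = c ᵥ* X.groupLaplacian p β :=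
  ((X.deckAction p β).asModuleEquiv.symm.map_eq_zero_iff).trans (X.jacOf_eq_zero_iff β z)

lemma vecMul_groupLaplacian_mem_degZero (X : Multigraph V E) (β : E → G)
    (c : V → MonoidAlgebra ℤ_[p] (Multiplicative G)) :
    c ᵥ* X.groupLaplacian p β ∈ degZero p V G := by
  have h := (X.mem_Pr_derived_iff β ((divEquiv p V G).symm (c ᵥ* X.groupLaplacian p β))).2
    ⟨c, LinearEquiv.apply_symm_apply _ _⟩
  have h2 := (X.mem_Div0_derived_iff β _).1 ((X.derived β).pr_le_div0 p h)
  rwa [LinearEquiv.apply_symm_apply] at h2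

end GroupLaplacian

end Multigraph

end VoltageIwasawa

/-! ### Nonvanishing of the determinant of the Laplacian. -/

open Matrix

open scoped MvPowerSeries.WithPiTopology

namespace VoltageIwasawa

/-- Positivity arguments need an ordered field. A `ℚ`-linear functional on `ℚ_p` transports them to
`ℤ_p`-valued functions. -/
lemma exists_addMonoidHom_rat_ne_zero {p : ℕ} [Fact p.Prime] {c : ℤ_[p]} (hc : c ≠ 0) :
    ∃ f : ℤ_[p] →+ ℚ, f c ≠ 0 := by
  have h : (c : ℚ_[p]) ≠ 0 := by simpa using hc
  rw [Ne, ← Module.forall_dual_apply_eq_zero_iff ℚ] at h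
  push Not at h
  obtain ⟨f, hf⟩ := h
  exact ⟨f.toAddMonoidHom.comp (PadicInt.Coe.ringHom (p := p) : ℤ_[p] →+ ℚ_[p]), hf⟩

namespace Multigraph

section Harmonic

variable {p : ℕ} [Fact p.Prime] {W F : Type*} [Fintype W] [DecidableEq W] [Fintype F]

/-- This is the factorization of the Laplacian as boundary times coboundary, summed over edges. -/
lemma linearCombination_principal_eq_sum (Y : Multigraph W F) (d : W →₀ ℤ_[p]) :
    Finsupp.linearCombination ℤ_[p] (Y.principal p) d = ∑ e, (d (Y.src e) - d (Y.tgt e)) •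
      (Finsupp.single (Y.src e) (1 : ℤ_[p]) - Finsupp.single (Y.tgt e) 1) := by
  have h1 : ∀ (f : F → W) (v : W), (Nat.card {e // f e = v} : ℤ_[p]) =
      ∑ e, if f e = v then 1 else 0 := fun f v => by
    rw [Nat.card_eq_fintype_card, Fintype.card_subtype, Finset.sum_boole]
  have h2 : ∀ v, Y.principal p v =
      (∑ e, if Y.src e = v then Finsupp.single v (1 : ℤ_[p]) - Finsupp.single (Y.tgt e) 1 else 0) +
      ∑ e, if Y.tgt e = v then Finsupp.single v (1 : ℤ_[p]) - Finsupp.single (Y.src e) 1 else 0 := by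
    intro v
    rw [principal, degree, Nat.cast_add, h1, h1,
      finsum_subtype_eq_sum_ite (fun e => Y.src e = v) fun e => Finsupp.single (Y.tgt e) (1 : ℤ_[p]),
      finsum_subtype_eq_sum_ite (fun e => Y.tgt e = v) fun e => Finsupp.single (Y.src e) (1 : ℤ_[p]),
      add_smul, Finset.sum_smul, Finset.sum_smul, sub_sub, add_sub_add_comm,
      ← Finset.sum_sub_distrib, ← Finset.sum_sub_distrib]
    congr 1 <;> refine Finset.sum_congr rfl fun e _ => ?_ <;> split_ifs <;> simp
  rw [Finsupp.linearCombination_apply, Finsupp.sum_fintype _ _ (by simp)]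
  simp only [h2, smul_add, Finset.smul_sum, smul_ite, smul_zero]
  rw [Finset.sum_add_distrib, Finset.sum_comm, add_comm, Finset.sum_comm,
    ← Finset.sum_add_distrib]
  refine Finset.sum_congr rfl fun e _ => ?_
  simp only [Finset.sum_ite_eq, Finset.mem_univ, if_true]
  module

/-- The Dirichlet form of a harmonic function is zero. Read through a functional to `ℚ`, it is a sum
of squares over the edges, so every difference along an edge vanishes; connectedness finishes. -/
lemma eq_of_linearCombination_principal_eq_zero {Y : Multigraph W F} (hY : Y.Connected)
    {d : W →₀ ℤ_[p]} (hd : Finsupp.linearCombination ℤ_[p] (Y.principal p) d = 0) (v w : W) :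
    d v = d w := by
  have hedge : ∀ e, d (Y.src e) = d (Y.tgt e) := by
    intro e
    by_contra hne
    obtain ⟨f, hf⟩ := exists_addMonoidHom_rat_ne_zero (sub_ne_zero.2 hne)
    have h1 : ∑ e, f (d (Y.src e) - d (Y.tgt e)) ^ 2 = 0 := by
      -- Pairing with `f ∘ d`: evaluated on the Laplacian of `d`, it is the sum of squares.
      let Q : (W →₀ ℤ_[p]) →+ ℚ :=
        Finsupp.liftAddHom fun w => (AddMonoidHom.mulRight (f (d w))).comp f
      have hQ : ∀ w c, Q (Finsupp.single w c) = f c * f (d w) := fun w c =>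
        Finsupp.liftAddHom_apply_single _ _ _
      have h2 := congrArg Q hd
      rw [linearCombination_principal_eq_sum, map_sum, map_zero] at h2
      rw [← h2]
      refine Finset.sum_congr rfl fun e _ => ?_
      rw [smul_sub, Finsupp.smul_single, Finsupp.smul_single, smul_eq_mul, mul_one, map_sub Q, hQ, hQ,
        ← mul_sub, ← map_sub f, sq]
    rw [Finset.sum_eq_zero_iff_of_nonneg fun _ _ => sq_nonneg _] at h1
    exact hf (pow_eq_zero_iff two_ne_zero |>.1 (h1 e (Finset.mem_univ e)))
  have := hY.2 v w
  induction this with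
  | rel a b h =>
    obtain ⟨e, rfl, rfl⟩ := h
    exact hedge e
  | refl => rfl
  | symm _ _ _ ih => exact ih.symm
  | trans _ _ _ _ _ h1 h2 => exact h1.trans h2

end Harmonic

section Levels

variable {p l : ℕ} [Fact p.Prime]

lemma augmentation_eq_sum {H : Type*} [Monoid H] [Fintype H] (x : MonoidAlgebra ℤ_[p] H) :
    augmentation p H x = ∑ h, x.coeff h := by
  rw [augmentation, MonoidAlgebra.lift_apply, Finsupp.sum_fintype _ _ (by simp)]
  simp

lemma augmentation_levelEval (m : ℕ) (F : Iwasawa p l) :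
    augmentation p _ (levelEval p l m F) = MvPowerSeries.constantCoeff F := by
  classical
  have hcl : IsClosed {F : Iwasawa p l | augmentation p _ (levelEval p l m F) =
      MvPowerSeries.constantCoeff F} := by
    simp only [augmentation_eq_sum]
    exact isClosed_eq (continuous_finsetSum _ fun h _ => continuous_levelEval_coeff m h)
      (MvPowerSeries.WithPiTopology.continuous_coeff _ 0)
  refine MvPowerSeries.WithPiTopology.denseRange_toMvPowerSeries.induction_on F hcl fun P => ?_
  induction P using MvPolynomial.induction_on_one_add_X with
  | h1 a =>
    have hP : ((a.prod fun i n => (1 + MvPolynomial.X i) ^ n : MvPolynomial (Fin l) ℤ_[p]) :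
        MvPowerSeries (Fin l) ℤ_[p]) = ∏ i, (1 + MvPowerSeries.X i) ^ a i := by
      rw [Finsupp.prod_fintype _ _ (by simp)]
      change MvPolynomial.coeToMvPowerSeries.ringHom _ = _
      rw [map_prod]
      simp
    rw [hP, levelEval_prod_one_add_X_pow, MonoidAlgebra.of_apply, augmentation_single]
    simp
  | h2 P Q hP hQ => rw [MvPolynomial.coe_add, map_add, map_add, map_add, hP, hQ]
  | h3 c P hP =>
    rw [MvPolynomial.coe_smul, map_smul, map_smul, hP, MvPowerSeries.smul_eq_C_mul,
      map_mul, MvPowerSeries.constantCoeff_C, smul_eq_mul]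

end Levels

section Determinant

variable {p l : ℕ} [Fact p.Prime] {V E : Type*} [Fintype V] [DecidableEq V] [Fintype E]

omit [Fintype V] in
lemma map_levelEval_voltageLaplacian (X : Multigraph V E) (α : E → Fin l → ℤ_[p]) (m : ℕ) :
    (X.voltageLaplacian α).map (levelEval p l m) = X.groupLaplacian p (voltageMod α m) := by
  have hneg : ∀ e, (fun i => PadicInt.toZModPow m ((-α e) i)) = -voltageMod α m e := fun e =>
    funext fun i => map_neg _ _
  ext1 v w
  simp only [Matrix.map_apply, voltageLaplacian, groupLaplacian, voltageMatrix, Matrix.sub_apply,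
    Matrix.of_apply, map_sub, map_add, map_sum, apply_ite (levelEval p l m), map_zero,
    levelEval_groupElem, hneg, Matrix.diagonal_apply, map_natCast]
  rfl

omit [Fintype V] in
lemma map_algebraMap_groupLaplacian (X : Multigraph V E) (α : E → Fin l → ℤ_[p]) :
    (X.groupLaplacian p α).map (algebraMap (GroupRing p l) (Iwasawa p l)) =
      X.voltageLaplacian α := by
  have hof : ∀ g, algebraMap (GroupRing p l) (Iwasawa p l) (MonoidAlgebra.of ℤ_[p] _ g) =
      groupElem p l g := fun g => MonoidAlgebra.lift_of _ _
  ext1 v w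
  simp only [Matrix.map_apply, voltageLaplacian, groupLaplacian, voltageMatrix, Matrix.sub_apply,
    Matrix.of_apply, map_sub, map_add, map_sum, apply_ite (algebraMap (GroupRing p l) (Iwasawa p l)),
    map_zero, hof, Matrix.diagonal_apply, map_natCast]

lemma levelEval_vecMul (X : Multigraph V E) (α : E → Fin l → ℤ_[p]) (m : ℕ)
    (c : V → Iwasawa p l) :
    levelEval p l m ∘ (c ᵥ* X.voltageLaplacian α) =
      (levelEval p l m ∘ c) ᵥ* X.groupLaplacian p (voltageMod α m) := by
  rw [← map_levelEval_voltageLaplacian]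
  exact funext fun v => RingHom.map_vecMul (levelEval p l m).toRingHom _ c v

/-- A null row vector `u` is harmonic at every level, hence all its group-ring coefficients there
agree, also across vertices. -/
lemma det_voltageLaplacian_ne_zero (hl : l ≠ 0) (X : Multigraph V E) (α : E → Fin l → ℤ_[p])
    (hconn : ∀ m, (X.level α m).Connected) : (X.voltageLaplacian α).det ≠ 0 := by
  classical
  intro hdet
  obtain ⟨u, hu, hu0⟩ := Matrix.exists_vecMul_eq_zero_iff.2 hdet
  have hconst : ∀ m v w g h, (levelEval p l m (u v)).coeff g = (levelEval p l m (u w)).coeff h := by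
    intro m v w g h
    set d := (divEquiv p V (Fin l → ZMod (p ^ m))).symm (levelEval p l m ∘ u) with hd
    have h1 : Finsupp.linearCombination ℤ_[p] ((X.level α m).principal p) d = 0 := by
      apply (divEquiv p V (Fin l → ZMod (p ^ m))).injective
      rw [divEquiv_linearCombination_principal, hd, LinearEquiv.apply_symm_apply,
        ← levelEval_vecMul, hu0, map_zero]
      exact funext fun v => map_zero _
    exact eq_of_linearCombination_principal_eq_zero (hconn m) h1 (v, g.toAdd) (w, h.toAdd)
  have hsum : ∀ m v (g : Multiplicative (Fin l → ZMod (p ^ m))),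
      MvPowerSeries.constantCoeff (u v) = ((p ^ m) ^ l : ℕ) * (levelEval p l m (u v)).coeff g := by
    intro m v g
    rw [← augmentation_levelEval m, augmentation_eq_sum,
      Finset.sum_congr rfl fun h _ => hconst m v v h g, Finset.sum_const, nsmul_eq_mul]
    congr 2
    simp
  -- The constant coefficient is `p^(ml)` times a common coefficient; as `l ≠ 0` this is divisible
  -- by `p^m` for every `m`.
  have hzero : ∀ v, MvPowerSeries.constantCoeff (u v) = 0 := by
    intro v
    refine PadicInt.ext_of_toZModPow.1 fun m => ?_
    rw [hsum m v 1, map_mul, map_natCast, Nat.cast_pow, ZMod.natCast_self, zero_pow hl, zero_mul,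
      map_zero]
  refine hu (funext fun v => eq_zero_of_forall_levelEval_eq_zero fun m => ?_)
  ext g
  have h := hsum m v g
  rw [hzero, eq_comm, mul_eq_zero] at h
  refine h.resolve_left (Nat.cast_ne_zero.2 ?_)
  exact pow_ne_zero _ (pow_ne_zero _ (Fact.out : p.Prime).ne_zero)

end Determinant

end Multigraph

end VoltageIwasawa

/-! ### Relative primality of the variables and compactness tools. -/

open Matrix

open scoped MvPowerSeries.WithPiTopology

namespace MvPowerSeries

variable {σ R : Type*} [CommRing R] [IsDomain R]

/-- In a factorization of `T_i` one constant term vanishes, and comparing coefficients of `T_i`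
forces the other to be a unit. -/
lemma X_irreducible (i : σ) : Irreducible (X i : MvPowerSeries σ R) := by
  classical
  have hX : coeff (Finsupp.single i 1) (X i : MvPowerSeries σ R) = 1 := by simp [coeff_X]
  have hX0 : constantCoeff (X i : MvPowerSeries σ R) = 0 := constantCoeff_X i
  refine ⟨fun h => ?_, fun {a b} hab => ?_⟩
  · rw [isUnit_iff_constantCoeff, hX0] at h
    exact not_isUnit_zero h
  · have h0 : constantCoeff a * constantCoeff b = 0 := by rw [← map_mul, ← hab, hX0]
    have h1 : constantCoeff a * coeff (Finsupp.single i 1) b +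
        coeff (Finsupp.single i 1) a * constantCoeff b = 1 := by
      rw [← hX, hab, coeff_mul, Finsupp.antidiagonal_single, Finset.sum_map,
        Finset.Nat.antidiagonal_succ]
      simp
    rw [isUnit_iff_constantCoeff, isUnit_iff_constantCoeff]
    rcases mul_eq_zero.1 h0 with h | h
    · rw [h, zero_mul, zero_add] at h1
      exact Or.inr (.of_mul_eq_one_right _ h1)
    · rw [h, mul_zero, add_zero] at h1
      exact Or.inl (.of_mul_eq_one _ h1)

lemma isRelPrime_X {i j : σ} (hij : i ≠ j) :
    IsRelPrime (X i : MvPowerSeries σ R) (X j) := by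
  classical
  rw [(X_irreducible i).isRelPrime_iff_not_dvd, X_dvd_iff]
  push Not
  exact ⟨Finsupp.single j 1, Finsupp.single_eq_of_ne hij, by simp [coeff_X]⟩

end MvPowerSeries

section Compactness

variable {M : Type*} [AddCommGroup M] [TopologicalSpace M] [IsTopologicalAddGroup M]
  [CompactSpace M]

lemma AddSubgroup.exists_forall_sub_mem {P : ℕ → AddSubgroup M} (hP : ∀ m, P (m + 1) ≤ P m)
    (hcl : ∀ m, IsClosed (P m : Set M)) {z : ℕ → M} (hz : ∀ m, z (m + 1) - z m ∈ P m) :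
    ∃ x, ∀ m, x - z m ∈ P m := by
  have hS : ∀ m, IsClosed {x | x - z m ∈ P m} := fun m =>
    (hcl m).preimage (continuous_id.sub continuous_const)
  have hanti : ∀ m, {x | x - z (m + 1) ∈ P (m + 1)} ⊆ {x | x - z m ∈ P m} := fun m x hx => by
    have := (P m).add_mem (hP m hx) (hz m)
    rwa [sub_add_sub_cancel] at this
  have hne : ∀ m, {x | x - z m ∈ P m}.Nonempty := fun m => ⟨z m, by
    change z m - z m ∈ P m
    rw [sub_self]
    exact zero_mem _⟩
  obtain ⟨x, hx⟩ := IsCompact.nonempty_iInter_of_sequence_nonempty_isCompact_isClosed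
    (fun m => {x | x - z m ∈ P m}) hanti hne (hS 0).isCompact hS
  exact ⟨x, fun m => Set.mem_iInter.1 hx m⟩

lemma AddMonoidHom.isClosed_range_sup [T2Space M] (D : M →+ M) (hD : Continuous D)
    {N : ℕ → AddSubgroup M} (hN : ∀ m, IsClosed (N m : Set M)) (m : ℕ) :
    IsClosed ((D.range ⊔ N m : AddSubgroup M) : Set M) := by
  rw [AddSubgroup.add_normal]
  refine (IsCompact.add ?_ (hN m).isCompact).isClosed
  rw [AddMonoidHom.coe_range]
  exact isCompact_range hD

/-- The sets of `c` with `y - D c ∈ N m` are nonempty, closed and nested; a common point solves `D c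
= y` exactly, since the `N m` meet in zero. -/
lemma AddMonoidHom.mem_range_of_forall_mem_sup (D : M →+ M) (hD : Continuous D)
    {N : ℕ → AddSubgroup M} (hN : ∀ m, IsClosed (N m : Set M))
    (hanti : ∀ m, N (m + 1) ≤ N m)
    (hbot : ∀ x, (∀ m, x ∈ N m) → x = 0) {y : M} (hy : ∀ m, y ∈ D.range ⊔ N m) :
    y ∈ D.range := by
  have hS : ∀ m, IsClosed {c | y - D c ∈ N m} := fun m =>
    (hN m).preimage (continuous_const.sub hD)
  have hne : ∀ m, {c | y - D c ∈ N m}.Nonempty := fun m => by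
    obtain ⟨_, ⟨c, rfl⟩, n, hn, h⟩ := AddSubgroup.mem_sup.1 (hy m)
    refine ⟨c, ?_⟩
    change y - D c ∈ N m
    rwa [← h, add_sub_cancel_left]
  obtain ⟨c, hc⟩ := IsCompact.nonempty_iInter_of_sequence_nonempty_isCompact_isClosed
    (fun m => {c | y - D c ∈ N m}) (fun m x hx => hanti m hx) hne (hS 0).isCompact hS
  exact ⟨c, (sub_eq_zero.1 (hbot _ fun m => Set.mem_iInter.1 hc m)).symm⟩

end Compactness

lemma LinearMap.exists_comp_eq_of_ker_le {R A B C : Type*} [CommRing R] [AddCommGroup A]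
    [AddCommGroup B] [AddCommGroup C] [Module R A] [Module R B] [Module R C] {f : A →ₗ[R] B}
    (hf : Function.Surjective f) {g : A →ₗ[R] C} (h : ∀ x, f x = 0 → g x = 0) :
    ∃ k : B →ₗ[R] C, ∀ x, k (f x) = g x := by
  refine ⟨(LinearMap.ker f).liftQ g h ∘ₗ (f.quotKerEquivOfSurjective hf).symm.toLinearMap,
    fun x => ?_⟩
  have : (f.quotKerEquivOfSurjective hf).symm (f x) = Submodule.Quotient.mk x :=
    (LinearEquiv.symm_apply_eq _).2 rfl
  rw [LinearMap.comp_apply, LinearEquiv.coe_coe, this]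
  exact Submodule.liftQ_apply _ _ _

/-! ### `J_∞` as a quotient of vectors over the Iwasawa algebra. -/

namespace VoltageIwasawa

namespace Multigraph

section Limit

variable {p l : ℕ} [Fact p.Prime] {V E : Type*} [Fintype V] [DecidableEq V] [Fintype E]

lemma lift_reduction_levelEval (m : ℕ) (F : Iwasawa p l) :
    MonoidAlgebra.lift ℤ_[p] (MonoidAlgebra ℤ_[p] (Multiplicative (Fin l → ZMod (p ^ m)))) _
      ((MonoidAlgebra.of ℤ_[p] _).comp (reduction p l m).toMultiplicative)
      (levelEval p l (m + 1) F) = levelEval p l m F := by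
  refine map_evalGroupRing _ (levelGen_pow p l (m + 1)) (levelGen_pow p l m) (fun i => ?_) F
  apply Multiplicative.toAdd.injective
  funext j
  change ZMod.castHom (pow_dvd_pow p m.le_succ) _
    ((Pi.single i 1 : Fin l → ZMod (p ^ (m + 1))) j) = (Pi.single i 1 : Fin l → ZMod (p ^ m)) j
  rcases eq_or_ne j i with rfl | h
  · rw [Pi.single_eq_same, Pi.single_eq_same, map_one]
  · rw [Pi.single_eq_of_ne h, Pi.single_eq_of_ne h, map_zero]

variable (p l V) in
/-- Vectors over the Iwasawa algebra of total degree zero. -/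
noncomputable def degZeroSeries : Submodule (Iwasawa p l) (V → Iwasawa p l) where
  carrier := {z | ∑ v, MvPowerSeries.constantCoeff (z v) = 0}
  zero_mem' := by simp
  add_mem' {a b} ha hb := by
    simp only [Set.mem_ofPred_eq, Pi.add_apply, map_add, Finset.sum_add_distrib] at *
    rw [ha, hb, add_zero]
  smul_mem' r z hz := by
    simp only [Set.mem_ofPred_eq, Pi.smul_apply, smul_eq_mul, map_mul, ← Finset.mul_sum] at *
    rw [hz, mul_zero]

omit [DecidableEq V] in
lemma levelEval_comp_mem_degZero (m : ℕ) {z : V → Iwasawa p l} :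
    levelEval p l m ∘ z ∈ degZero p V (Fin l → ZMod (p ^ m)) ↔ z ∈ degZeroSeries p l V := by
  rw [mem_degZero]
  simp only [Function.comp_apply, augmentation_levelEval]
  rfl

/-- The finite level of a vector of total degree zero. -/
noncomputable def levelVec (m : ℕ) (z : degZeroSeries p l V) :
    degZero p V (Fin l → ZMod (p ^ m)) :=
  ⟨levelEval p l m ∘ z, (levelEval_comp_mem_degZero m).2 z.2⟩

omit [DecidableEq V] in
lemma levelVec_add (m : ℕ) (y z : degZeroSeries p l V) :
    levelVec m (y + z) = levelVec m y + levelVec m z :=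
  Subtype.ext (funext fun _ => map_add _ _ _)

omit [DecidableEq V] in
lemma levelVec_smul (m : ℕ) (F : Iwasawa p l) (z : degZeroSeries p l V) :
    levelVec m (F • z) = levelEval p l m F • levelVec m z :=
  Subtype.ext (funext fun _ => map_mul _ _ _)

omit [DecidableEq V] in
lemma levelVec_surjective (m : ℕ) :
    Function.Surjective (levelVec (p := p) (l := l) (V := V) m) := by
  intro y
  choose z hz using fun v => levelEval_surjective (p := p) (l := l) m (y.1 v)
  have h : levelEval p l m ∘ z = y := funext hz
  exact ⟨⟨z, (levelEval_comp_mem_degZero m).1 (h ▸ y.2)⟩, Subtype.ext h⟩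

omit [DecidableEq V] [Fintype E] in
lemma transition_jacOf (X : Multigraph V E) (α : E → Fin l → ℤ_[p]) (m : ℕ)
    (z : degZeroSeries p l V) :
    X.transition α m (X.jacOf p (voltageMod α (m + 1)) (levelVec (m + 1) z)) =
      X.jacOf p (voltageMod α m) (levelVec m z) := by
  change Jac.mk _ p _ = Jac.mk _ p _
  congr 1
  refine Subtype.ext ((divEquiv p V _).eq_symm_apply.2 (funext fun v => ?_))
  refine (divEquiv_lmapDomain_map (reduction p l m) _ v).trans ?_
  refine Eq.trans ?_ (lift_reduction_levelEval m (z.1 v))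
  congr 1
  exact congrFun (LinearEquiv.apply_symm_apply _ _) v

/-- The class in `J_∞` of a vector of total degree zero. -/
noncomputable def jacLimitOf (X : Multigraph V E) (α : E → Fin l → ℤ_[p]) :
    degZeroSeries p l V →ₗ[Iwasawa p l] X.jacLimit α where
  toFun z := ⟨fun m => X.jacOf p (voltageMod α m) (levelVec m z), fun m => X.transition_jacOf α m z⟩
  map_add' y z := Subtype.ext <| funext fun m => by
    change X.jacOf p _ _ = X.jacOf p _ _ + X.jacOf p _ _
    rw [levelVec_add, (X.jacOf p _).map_add]
  map_smul' F z := Subtype.ext <| funext fun m => by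
    change X.jacOf p _ _ = X.levelAction α m F (X.jacOf p _ _)
    rw [levelVec_smul, jacOf_smul]
    rfl

/-- The vectors over the Iwasawa algebra whose `m`-th level vanishes. -/
noncomputable def levelKer (p l : ℕ) [Fact p.Prime] (V : Type*) (m : ℕ) :
    AddSubgroup (V → Iwasawa p l) where
  carrier := {z | ∀ v, levelEval p l m (z v) = 0}
  zero_mem' _ := map_zero _
  add_mem' {a b} ha hb v := by
    rw [Pi.add_apply, map_add, ha, hb, add_zero]
  neg_mem' {a} ha v := by
    rw [Pi.neg_apply, map_neg, ha, neg_zero]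

omit [Fintype V] [DecidableEq V] in
lemma isClosed_levelKer (m : ℕ) : IsClosed (levelKer p l V m : Set (V → Iwasawa p l)) := by
  have : (levelKer p l V m : Set (V → Iwasawa p l)) =
      ⋂ (v : V) (h : Multiplicative (Fin l → ZMod (p ^ m))), {z | (levelEval p l m (z v)).coeff h = 0} := by
    ext z
    simp only [Set.mem_iInter]
    refine forall_congr' fun v => ⟨fun h g => ?_, fun h => ?_⟩
    · change (levelEval p l m (z v)).coeff g = 0
      rw [h]
      rfl
    · ext g
      exact h g
  rw [this]
  exact isClosed_iInter fun v => isClosed_iInter fun h => isClosed_eq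
    ((continuous_levelEval_coeff m h).comp (continuous_apply v)) continuous_const

omit [Fintype V] [DecidableEq V] in
lemma levelKer_succ_le (m : ℕ) : levelKer p l V (m + 1) ≤ levelKer p l V m := fun z hz v => by
  rw [← lift_reduction_levelEval, hz v, map_zero]

omit [Fintype V] [DecidableEq V] in
lemma eq_zero_of_forall_mem_levelKer {z : V → Iwasawa p l} (hz : ∀ m, z ∈ levelKer p l V m) :
    z = 0 :=
  funext fun v => eq_zero_of_forall_levelEval_eq_zero fun m => hz m v

/-- Multiplication by the voltage Laplacian on row vectors. -/
noncomputable def laplacianHom (X : Multigraph V E) (α : E → Fin l → ℤ_[p]) :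
    (V → Iwasawa p l) →+ (V → Iwasawa p l) where
  toFun c := c ᵥ* X.voltageLaplacian α
  map_zero' := Matrix.zero_vecMul _
  map_add' _ _ := Matrix.add_vecMul _ _ _

lemma continuous_laplacianHom (X : Multigraph V E) (α : E → Fin l → ℤ_[p]) :
    Continuous (X.laplacianHom α) :=
  continuous_pi fun _ => continuous_finsetSum _ fun v _ => (continuous_apply v).mul continuous_const

/-- Solvability at level `m` is rephrased inside the compact group `Λ^V`; surjectivity of
`levelEval` lifts a solution. -/
lemma mem_range_laplacianHom_sup_iff (X : Multigraph V E) (α : E → Fin l → ℤ_[p]) (m : ℕ)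
    (z : V → Iwasawa p l) :
    z ∈ (X.laplacianHom α).range ⊔ levelKer p l V m ↔
      ∃ c, levelEval p l m ∘ z = c ᵥ* X.groupLaplacian p (voltageMod α m) := by
  rw [AddSubgroup.mem_sup]
  constructor
  · rintro ⟨_, ⟨c, rfl⟩, n, hn, rfl⟩
    refine ⟨levelEval p l m ∘ c, ?_⟩
    rw [← levelEval_vecMul]
    funext v
    simp only [Function.comp_apply, Pi.add_apply, map_add]
    rw [hn v, add_zero]
    rfl
  · rintro ⟨c, hc⟩
    choose c' hc' using fun v => levelEval_surjective (p := p) (l := l) m (c v)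
    obtain rfl : levelEval p l m ∘ c' = c := funext hc'
    refine ⟨_, ⟨c', rfl⟩, z - c' ᵥ* X.voltageLaplacian α, fun v => ?_, add_sub_cancel _ _⟩
    rw [Pi.sub_apply, map_sub, sub_eq_zero]
    exact (congrFun hc v).trans (congrFun (X.levelEval_vecMul α m c') v).symm

lemma jacOf_levelVec_eq_zero_iff (X : Multigraph V E) (α : E → Fin l → ℤ_[p]) (m : ℕ)
    (z : degZeroSeries p l V) : X.jacOf p (voltageMod α m) (levelVec m z) = 0 ↔
      z.1 ∈ (X.laplacianHom α).range ⊔ levelKer p l V m :=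
  (X.jacOf_eq_zero_iff _ _).trans (X.mem_range_laplacianHom_sup_iff α m z).symm

lemma jacLimitOf_eq_zero_iff (X : Multigraph V E) (α : E → Fin l → ℤ_[p])
    (z : degZeroSeries p l V) :
    X.jacLimitOf α z = 0 ↔ ∃ c, c ᵥ* X.voltageLaplacian α = z := by
  have h : X.jacLimitOf α z = 0 ↔ ∀ m, z.1 ∈ (X.laplacianHom α).range ⊔ levelKer p l V m := by
    simp only [← jacOf_levelVec_eq_zero_iff]
    exact Subtype.ext_iff.trans funext_iff
  rw [h]
  constructor
  · exact (X.laplacianHom α).mem_range_of_forall_mem_sup (X.continuous_laplacianHom α)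
      isClosed_levelKer levelKer_succ_le fun _ => eq_zero_of_forall_mem_levelKer
  · exact fun hc m => AddSubgroup.mem_sup_left hc

/-- Lifts of the components agree only modulo the row space plus the level kernels. These subgroups
are closed and decreasing, so compactness gives one vector representing all components. -/
lemma jacLimitOf_surjective (X : Multigraph V E) (α : E → Fin l → ℤ_[p]) :
    Function.Surjective (X.jacLimitOf α) := by
  intro x
  choose y hy using fun m => (X.jacOf_surjective (p := p) (voltageMod α m)) (x.1 m)
  choose z hz using fun m => levelVec_surjective m (y m)
  have hx : ∀ m, X.jacOf p (voltageMod α m) (levelVec m (z m)) = x.1 m := fun m => by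
    rw [hz, hy]
  have hsub : ∀ m (a b : degZeroSeries p l V),
      X.jacOf p (voltageMod α m) (levelVec m a) = X.jacOf p (voltageMod α m) (levelVec m b) ↔
      (a - b : V → Iwasawa p l) ∈ (X.laplacianHom α).range ⊔ levelKer p l V m := by
    intro m a b
    have h := (X.jacOf p (voltageMod α m)).map_add (levelVec m (a - b)) (levelVec m b)
    rw [← levelVec_add, sub_add_cancel] at h
    rw [h, add_eq_right, jacOf_levelVec_eq_zero_iff]
    rfl
  obtain ⟨w, hw⟩ := AddSubgroup.exists_forall_sub_mem
    (P := fun m => (X.laplacianHom α).range ⊔ levelKer p l V m) (z := fun m => (z m).1)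
    (fun m => sup_le_sup_left (levelKer_succ_le m) _)
    (fun m => (X.laplacianHom α).isClosed_range_sup (X.continuous_laplacianHom α)
      isClosed_levelKer m)
    (fun m => (hsub m _ _).1 (by rw [← transition_jacOf, hx, hx, x.2 m]))
  -- The degree is already visible at level `0`, where `w` and `z 0` differ by a principal divisor.
  have hw0 : w ∈ degZeroSeries p l V := by
    obtain ⟨c, hc⟩ := (X.mem_range_laplacianHom_sup_iff α 0 _).1 (hw 0)
    have := (levelEval_comp_mem_degZero 0).1
      (hc ▸ X.vecMul_groupLaplacian_mem_degZero (voltageMod α 0) c)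
    simpa using add_mem this (z 0).2
  exact ⟨⟨w, hw0⟩, Subtype.ext (funext fun m => ((hsub m ⟨w, hw0⟩ (z m)).2 (hw m)).trans (hx m))⟩

end Limit

end Multigraph

end VoltageIwasawa

/-! ### Base change of cokernels and of almost surjective injections. -/

open Matrix TensorProduct

section BaseChange

variable {R : Type*} (A : Type*) [CommRing R] [CommRing A] [Algebra R A]

/-- Multiplication by `r` on `M` factors through `J` as `f ∘ k`, and then `k ∘ f = r` as well. Both
identities survive base change, although injectivity of `f` need not. -/
lemma LinearMap.baseChange_of_smul_mem_range {J M : Type*} [AddCommGroup J] [AddCommGroup M]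
    [Module R J] [Module R M] {f : J →ₗ[R] M} (hf : Function.Injective f) {r : R}
    (hr : ∀ y, ∃ x, f x = r • y) :
    (∀ x, f.baseChange A x = 0 → algebraMap R A r • x = 0) ∧
      ∀ y, ∃ x, f.baseChange A x = algebraMap R A r • y := by
  choose g hg using hr
  let k : M →ₗ[R] J :=
    { toFun := g
      map_add' := fun x y => hf (by rw [map_add, hg, hg, hg, smul_add])
      map_smul' := fun c x => hf (by rw [map_smul, hg, hg, RingHom.id_apply, smul_comm]) }
  have h1 : ∀ x, k.baseChange A (f.baseChange A x) = algebraMap R A r • x := fun x => by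
    have : k ∘ₗ f = r • LinearMap.id := LinearMap.ext fun x => hf (by
      change f (g (f x)) = f (r • x)
      rw [hg, map_smul])
    rw [← LinearMap.comp_apply, ← LinearMap.baseChange_comp, this, LinearMap.baseChange_smul,
      LinearMap.baseChange_id, LinearMap.smul_apply, LinearMap.id_apply, algebraMap_smul]
  have h2 : ∀ y, f.baseChange A (k.baseChange A y) = algebraMap R A r • y := fun y => by
    have : f ∘ₗ k = r • LinearMap.id := LinearMap.ext fun y => hg y
    rw [← LinearMap.comp_apply, ← LinearMap.baseChange_comp, this, LinearMap.baseChange_smul,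
      LinearMap.baseChange_id, LinearMap.smul_apply, LinearMap.id_apply, algebraMap_smul]
  exact ⟨fun x hx => by rw [← h1, hx, map_zero], fun y => ⟨_, h2 y⟩⟩

/-- The base change of the cokernel of a matrix is the cokernel of the base change. -/
lemma Matrix.exists_bijective_baseChange_coker {n : Type*} [Fintype n] [DecidableEq n]
    (B : Matrix n n R) :
    ∃ e : A ⊗[R] ((n → R) ⧸ LinearMap.range B.mulVecLin) →ₗ[A]
      (n → A) ⧸ LinearMap.range (B.map (algebraMap R A)).mulVecLin, Function.Bijective e := by
  set P := LinearMap.range B.mulVecLin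
  set Q := LinearMap.range (B.map (algebraMap R A)).mulVecLin
  let f : (n → R) →ₗ[R] (n → A) ⧸ Q :=
    Q.mkQ.restrictScalars R ∘ₗ (Algebra.linearMap R A).compLeft n
  have hf : ∀ x ∈ P, f x = 0 := by
    rintro _ ⟨c, rfl⟩
    refine (Submodule.Quotient.mk_eq_zero Q).2 ⟨algebraMap R A ∘ c, ?_⟩
    funext v
    exact (RingHom.map_mulVec (algebraMap R A) B c v).symm
  let ξ : A ⊗[R] ((n → R) ⧸ P) →ₗ[A] (n → A) ⧸ Q := (P.liftQ f hf).liftBaseChange A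
  -- The inverse of `ξ`, prescribed on the standard basis and then descended to the quotient.
  let g : (n → A) →ₗ[A] A ⊗[R] ((n → R) ⧸ P) :=
    Fintype.linearCombination A fun v => (1 : A) ⊗ₜ[R] P.mkQ (Pi.single v 1)
  have hg1 : ∀ (a : A) (x : n → R), g (a • (algebraMap R A ∘ x)) = a ⊗ₜ P.mkQ x := by
    intro a x
    rw [map_smul, Fintype.linearCombination_apply]
    conv_rhs => rw [pi_eq_sum_univ' x, map_sum, TensorProduct.tmul_sum]
    rw [Finset.smul_sum]
    refine Finset.sum_congr rfl fun v _ => ?_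
    rw [map_smul, TensorProduct.tmul_smul, Function.comp_apply, algebraMap_smul, smul_comm,
      TensorProduct.smul_tmul', smul_eq_mul, mul_one]
  have hg : ∀ x ∈ Q, g x = 0 := by
    rintro _ ⟨c, rfl⟩
    have : (B.map (algebraMap R A)).mulVecLin c =
        ∑ v, c v • (algebraMap R A ∘ (B *ᵥ Pi.single v 1)) := by
      funext w
      simp [Matrix.mulVec, dotProduct, mul_comm]
    rw [this, map_sum]
    refine Finset.sum_eq_zero fun v _ => ?_
    have h0 : P.mkQ (B *ᵥ Pi.single v 1) = 0 := (Submodule.Quotient.mk_eq_zero P).2 ⟨_, rfl⟩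
    rw [hg1, h0, TensorProduct.tmul_zero]
  have h1 : ∀ t, Q.liftQ g hg (ξ t) = t := by
    intro t
    induction t using TensorProduct.induction_on with
    | zero => rw [map_zero, map_zero]
    | add x y hx hy => rw [map_add, map_add, hx, hy]
    | tmul a x =>
      obtain ⟨x, rfl⟩ := P.mkQ_surjective x
      exact hg1 a x
  have h2 : ∀ y, ξ (Q.liftQ g hg y) = y := by
    intro y
    obtain ⟨y, rfl⟩ := Q.mkQ_surjective y
    change ξ (g y) = _
    rw [Fintype.linearCombination_apply, map_sum]
    conv_rhs => rw [pi_eq_sum_univ' y, map_sum]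
    refine Finset.sum_congr rfl fun v _ => ?_
    rw [map_smul, map_smul, LinearMap.liftBaseChange_tmul, one_smul]
    congr 1
    change Q.mkQ _ = _
    congr 1
    funext w
    change algebraMap R A ((Pi.single v 1 : n → R) w) = _
    rw [Pi.single_apply, Pi.single_apply, apply_ite (algebraMap R A), map_one, map_zero]
  exact ⟨ξ, Function.bijective_iff_has_inverse.2 ⟨_, h1, h2⟩⟩

end BaseChange

/-! ### Comparison of the Jacobian modules with cokernels of the Laplacian. -/

namespace VoltageIwasawa

namespace Multigraph

variable {p l : ℕ} [Fact p.Prime] {V E : Type*} [Fintype V] [DecidableEq V] [Fintype E]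

/-- Both sides are quotients by the same row space, which gives injectivity; multiplying any vector
by a series without constant term lands in total degree zero. The transpose appears because
principal divisors are row combinations. -/
lemma exists_jacLimit_to_coker (X : Multigraph V E) (α : E → Fin l → ℤ_[p]) :
    ∃ φ : X.jacLimit α →ₗ[Iwasawa p l]
        (V → Iwasawa p l) ⧸ LinearMap.range (X.voltageLaplacian α)ᵀ.mulVecLin,
      Function.Injective φ ∧
      ∀ F : Iwasawa p l, MvPowerSeries.constantCoeff F = 0 → ∀ y, ∃ x, φ x = F • y := by
  have hmem : ∀ z : degZeroSeries p l V, X.jacLimitOf α z = 0 ↔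
      z.1 ∈ LinearMap.range (X.voltageLaplacian α)ᵀ.mulVecLin := fun z => by
    simp only [jacLimitOf_eq_zero_iff, LinearMap.mem_range, Matrix.mulVecLin_apply,
      Matrix.mulVec_transpose]
  obtain ⟨φ, hφ⟩ := LinearMap.exists_comp_eq_of_ker_le (X.jacLimitOf_surjective α)
    (g := Submodule.mkQ _ ∘ₗ (degZeroSeries p l V).subtype)
    fun z hz => (Submodule.Quotient.mk_eq_zero _).2 ((hmem z).1 hz)
  refine ⟨φ, (injective_iff_map_eq_zero φ).2 fun x hx => ?_, fun F hF y => ?_⟩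
  · obtain ⟨z, rfl⟩ := X.jacLimitOf_surjective α x
    rw [hφ] at hx
    exact (hmem z).2 ((Submodule.Quotient.mk_eq_zero _).1 hx)
  · obtain ⟨y, rfl⟩ := Submodule.mkQ_surjective _ y
    have hy : F • y ∈ degZeroSeries p l V := by
      change ∑ v, MvPowerSeries.constantCoeff (F * y v) = 0
      simp [hF]
    exact ⟨X.jacLimitOf α ⟨F • y, hy⟩, hφ _⟩

lemma exists_jac_to_coker {G : Type*} [AddCommGroup G] (X : Multigraph V E) (β : E → G) :
    ∃ φ : (X.deckAction p β).asModule →ₗ[MonoidAlgebra ℤ_[p] (Multiplicative G)]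
        (V → MonoidAlgebra ℤ_[p] (Multiplicative G)) ⧸
          LinearMap.range (X.groupLaplacian p β)ᵀ.mulVecLin,
      Function.Injective φ ∧
      ∀ r, augmentation p (Multiplicative G) r = 0 → ∀ y, ∃ x, φ x = r • y := by
  have hmem : ∀ z : degZero p V G, X.jacOfLinear p β z = 0 ↔
      z.1 ∈ LinearMap.range (X.groupLaplacian p β)ᵀ.mulVecLin := fun z => by
    simp only [jacOfLinear_eq_zero_iff, LinearMap.mem_range, Matrix.mulVecLin_apply,
      Matrix.mulVec_transpose]
    exact exists_congr fun _ => eq_comm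
  obtain ⟨φ, hφ⟩ := LinearMap.exists_comp_eq_of_ker_le (X.jacOfLinear_surjective β)
    (g := Submodule.mkQ _ ∘ₗ (degZero p V G).subtype)
    fun z hz => (Submodule.Quotient.mk_eq_zero _).2 ((hmem z).1 hz)
  refine ⟨φ, (injective_iff_map_eq_zero φ).2 fun x hx => ?_, fun r hr y => ?_⟩
  · obtain ⟨z, rfl⟩ := X.jacOfLinear_surjective β x
    rw [hφ] at hx
    exact (hmem z).2 ((Submodule.Quotient.mk_eq_zero _).1 hx)
  · obtain ⟨y, rfl⟩ := Submodule.mkQ_surjective _ y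
    have hy : r • y ∈ degZero p V G := by
      change ∑ v, augmentation p (Multiplicative G) (r * y v) = 0
      simp [hr]
    exact ⟨X.jacOfLinear p β ⟨r • y, hy⟩, hφ _⟩

lemma isTorsion_jacLimit (X : Multigraph V E) (α : E → Fin l → ℤ_[p])
    (hdet : (X.voltageLaplacian α).det ≠ 0) :
    Module.IsTorsion (Iwasawa p l) (X.jacLimit α) := by
  intro x
  obtain ⟨φ, hφ, -⟩ := X.exists_jacLimit_to_coker α
  refine ⟨⟨_, mem_nonZeroDivisors_of_ne_zero hdet⟩, hφ ?_⟩
  change φ ((X.voltageLaplacian α).det • x) = φ 0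
  rw [map_smul, map_zero]
  obtain ⟨y, hy⟩ := Submodule.mkQ_surjective _ (φ x)
  rw [← hy, ← map_smul]
  refine (Submodule.Quotient.mk_eq_zero _).2 ⟨(X.voltageLaplacian α)ᵀ.adjugate *ᵥ y, ?_⟩
  rw [Matrix.mulVecLin_apply, Matrix.mulVec_mulVec, Matrix.mul_adjugate, Matrix.smul_mulVec,
    Matrix.one_mulVec, Matrix.det_transpose]

/-- Here `2 ≤ l` is essential: two distinct variables kill the cokernel of the comparison map and
are relatively prime. -/
lemma isCharIdeal_jacLimit (hl : 2 ≤ l) (X : Multigraph V E) (α : E → Fin l → ℤ_[p])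
    (hdet : (X.voltageLaplacian α).det ≠ 0) :
    IsCharIdeal p l (X.jacLimit α) (Ideal.span {(X.voltageLaplacian α).det}) := by
  obtain ⟨φ, hφ, hφ'⟩ := X.exists_jacLimit_to_coker α
  rw [← Matrix.det_transpose] at hdet ⊢
  refine IsCharIdeal.of_isPseudoIso (φ := φ) (isPseudoIso_of_isRelPrime (MvPowerSeries.isRelPrime_X
    (i := (⟨0, by omega⟩ : Fin l)) (j := ⟨1, by omega⟩) (by simp)) (fun x hx => ?_)
    fun y => ⟨?_, ?_⟩) (isCharIdeal_coker _ hdet)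
  · rw [(map_eq_zero_iff φ hφ).1 hx, smul_zero, smul_zero]
    exact ⟨rfl, rfl⟩
  · exact hφ' _ (MvPowerSeries.constantCoeff_X _) y
  · exact hφ' _ (MvPowerSeries.constantCoeff_X _) y

lemma exists_algebraMap_eq_X (p : ℕ) [Fact p.Prime] (i : Fin l) :
    ∃ r : GroupRing p l, algebraMap (GroupRing p l) (Iwasawa p l) r = MvPowerSeries.X i ∧
      augmentation p _ r = 0 := by
  classical
  refine ⟨MonoidAlgebra.of ℤ_[p] _
    (Multiplicative.ofAdd fun j => ((Pi.single i 1 : Fin l → ℕ) j : ℤ_[p])) - 1, ?_, ?_⟩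
  · have : algebraMap (GroupRing p l) (Iwasawa p l) (MonoidAlgebra.of ℤ_[p] _
        (Multiplicative.ofAdd fun j => ((Pi.single i 1 : Fin l → ℕ) j : ℤ_[p]))) =
        groupElem p l _ := MonoidAlgebra.lift_of _ _
    rw [map_sub, map_one, this, groupElem_natCast, Finset.prod_eq_single i, Pi.single_eq_same,
      pow_one, add_sub_cancel_left]
    · intro j _ hj
      rw [Pi.single_eq_of_ne hj, pow_zero]
    · simp
  · rw [map_sub, map_one, MonoidAlgebra.of_apply, augmentation_single, sub_self]

/-- Each `T_i` comes from the group-ring element `γ_i - 1` of augmentation zero, so it kills kernel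
and cokernel of the base-changed comparison map. -/
lemma isCharIdeal_jacTensor (hl : 2 ≤ l) (X : Multigraph V E) (α : E → Fin l → ℤ_[p])
    (hdet : (X.voltageLaplacian α).det ≠ 0) :
    IsCharIdeal p l (X.jacTensor α) (Ideal.span {(X.voltageLaplacian α).det}) := by
  obtain ⟨φ, hφ, hφ'⟩ := X.exists_jac_to_coker (p := p) α
  obtain ⟨e, he⟩ := Matrix.exists_bijective_baseChange_coker (Iwasawa p l) (X.groupLaplacian p α)ᵀ
  have key : ∀ i : Fin l,
      (∀ x, φ.baseChange (Iwasawa p l) x = 0 → (MvPowerSeries.X i : Iwasawa p l) • x = 0) ∧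
      ∀ y, ∃ x, φ.baseChange (Iwasawa p l) x = (MvPowerSeries.X i : Iwasawa p l) • y := fun i => by
    obtain ⟨r, hr, hr0⟩ := exists_algebraMap_eq_X p i
    rw [← hr]
    exact LinearMap.baseChange_of_smul_mem_range (Iwasawa p l) hφ (hφ' r hr0)
  have hmap : ((X.groupLaplacian p α)ᵀ.map (algebraMap (GroupRing p l) (Iwasawa p l))) =
      (X.voltageLaplacian α)ᵀ := by
    rw [Matrix.transpose_map, map_algebraMap_groupLaplacian]
  rw [← Matrix.det_transpose, ← hmap] at hdet ⊢
  refine IsCharIdeal.of_isPseudoIso (φ := e ∘ₗ φ.baseChange (Iwasawa p l))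
    (isPseudoIso_of_isRelPrime (MvPowerSeries.isRelPrime_X
    (i := (⟨0, by omega⟩ : Fin l)) (j := ⟨1, by omega⟩) (by simp)) (fun x hx => ?_)
    fun y => ?_) (isCharIdeal_coker _ hdet)
  · have := (map_eq_zero_iff e he.1).1 hx
    exact ⟨(key _).1 x this, (key _).1 x this⟩
  · obtain ⟨t, rfl⟩ := he.2 y
    obtain ⟨x, hx⟩ := (key ⟨0, by omega⟩).2 t
    obtain ⟨x', hx'⟩ := (key ⟨1, by omega⟩).2 t
    exact ⟨⟨x, by rw [LinearMap.comp_apply, hx, map_smul]⟩,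
      ⟨x', by rw [LinearMap.comp_apply, hx', map_smul]⟩⟩

end Multigraph

end VoltageIwasawa

/-- Iwasawa main conjecture for `ℤ_p^l`-voltage covers of finite connected multigraphs. -/
theorem theorem5p2 {p : ℕ} [Fact p.Prime] {l : ℕ} (hl : 2 ≤ l)
    {V E : Type*} [Fintype V] [DecidableEq V] [Fintype E]
    (X : VoltageIwasawa.Multigraph V E) (α : E → Fin l → ℤ_[p])
    (hconn : ∀ m, (X.level α m).Connected) :
    Module.Finite (VoltageIwasawa.Iwasawa p l) (X.jacLimit α) ∧
    Module.IsTorsion (VoltageIwasawa.Iwasawa p l) (X.jacLimit α) ∧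
    (∀ I : Ideal (VoltageIwasawa.Iwasawa p l),
      VoltageIwasawa.IsCharIdeal p l (X.jacLimit α) I ↔
        I = Ideal.span {(X.voltageLaplacian α).det}) ∧
    (∀ I : Ideal (VoltageIwasawa.Iwasawa p l),
      VoltageIwasawa.IsCharIdeal p l (X.jacTensor α) I ↔
        I = Ideal.span {(X.voltageLaplacian α).det}) := by
  have hdet := X.det_voltageLaplacian_ne_zero (by omega) α hconn
  have h1 := X.isCharIdeal_jacLimit hl α hdet
  have h2 := X.isCharIdeal_jacTensor hl α hdet
  -- The degree-zero vectors form a finitely generated module because `Λ` is Noetherian.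
  refine ⟨Module.Finite.of_surjective _ (X.jacLimitOf_surjective α), X.isTorsion_jacLimit α hdet,
    fun I => ⟨fun h => h.unique h1, ?_⟩, fun I => ⟨fun h => h.unique h2, ?_⟩⟩
  · rintro rfl
    exact h1
  · rintro rfl
    exact h2
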